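/- **Theorem 2.2.** Work in the category $\mathrm{Top}$ of compactly generated spaces (products are formed in this category). Let $\mathbb I$ be the category whose objects are the sets $\mathbf n=\{1,\dots,n\}$, $n\ge 0$, and whose morphisms are all injective maps, symmetric monoidal under concatenation $\mathbf m\sqcup\mathbf n=\{1,\dots,m+n\}$ with symmetry the shuffle $\tau_{\mathbf m,\mathbf n}:\mathbf m\sqcup\mathbf n\to\mathbf n\sqcup\mathbf m$ that exchanges the two blocks. Let $X$ be a commutative $\mathbb I$-monoid, i.e. a functor $X:\mathbb I\to\mathrm{Top}$ with natural transformations $\mu_{\mathbf m,\mathbf n}:X(\mathbf m)\times X(\mathbf n)\to X(\mathbf m\sqcup\mathbf n)$ and $\eta_{\mathbf n}:*\to X(\mathbf n)$ such that $\mu$ is associative, unital with respect to $*=\eta_{\mathbf 0}\in X(\mathbf 0)$, and commutative, $X(\tau_{\mathbf m,\mathbf n})\mu_{\mathbf m,\mathbf n}(x,y)=\mu_{\mathbf n,\mathbf m}(y,x)$. Let $\mathbb I\ltimes X$ be the translation category: the topological category with objects the pairs $(\mathbf n,x)$, $x\in X(\mathbf n)$, and with morphisms $(\mathbf n,x)\to(\mathbf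 n',x')$ the morphisms $\alpha:\mathbf n\to\mathbf n'$ of $\mathbb I$ with $X(\alpha)(x)=x'$. Let $B$ denote the classifying space (geometric realization of the nerve), and let $\operatorname{hocolim}_{\mathbb I}X$ be the homotopy colimit defined by the bar construction, i.e. the realization of the simplicial space $[k]\mapsto\coprod_{\mathbf n_0\to\cdots\to\mathbf n_k}X(\mathbf n_0)$. Then: 1. $\mathbb I\ltimes X$ is a permutative category (a strictly associative and strictly unital symmetric monoidal category) with $(\mathbf m,x)\oplus(\mathbf n,y)=(\mathbf m\sqcup\mathbf n,\mu_{\mathbf m,\mathbf n}(x,y))$, $\alpha\oplus\beta=\alpha\sqcup\beta$, unit object $(\mathbf 0,*)$ and symmetry given by the shuffles $\tau_{\mathbf m,\mathbf n}$. 2. There is a homeomorphism $\operatorname{hocolim}_{\mathbb I}X\cong B(\mathbb I\ltimes X)$ which is the canonical one: it identifies the simplex given by $\mathbf n_0\to\cdots\to\mathbf n_k$ and $x\in X(\mathbf n_0)$ with the simplex $(\mathbf n_0,x)\to\cdots\to(\mathbf n_k,x_k)$ of the nerve, where $x_i\in X(\mathbf n_i)$ is the image of $x$. 3. $\operatorname{hocolim}_{\mathbb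 I}X=B(\mathbb I\ltimes X)$ is an $E_\infty$-space, structured by an action of the Barratt–Eccles operad that comes from the permutative category $\mathbb I\ltimes X$. Precisely, let $\widetilde\Sigma_j$ be the category with object set the symmetric group $\Sigma_j$ and exactly one morphism between any two objects. The spaces $\mathcal D(j)=B\widetilde\Sigma_j$ form an operad $\mathcal D$ (the Barratt–Eccles operad), whose structure maps are induced, simplexwise, by the right multiplication of $\Sigma_j$ on itself, by $1\in\Sigma_1$ and by $\gamma(\sigma;\tau_1,\dots,\tau_k)=\sigma(j_1,\dots,j_k)\circ(\tau_1\oplus\cdots\oplus\tau_k)$, where $\sigma(j_1,\dots,j_k)$ permutes $k$ blocks of $j_1,\dots,j_k$ letters as $\sigma$ permutes $k$ letters. This operad is an $E_\infty$-operad: $\mathcal D(0)$ is a point, every $\mathcal D(j)$ is contractible, and $\Sigma_j$ acts freely on $\mathcal D(j)$. It acts on the compactly generated space $B(\mathbb I\ltimes X)$, and the action maps $\mathcal D(j)\times B(\mathbb I\ltimes X)^j\to B(\mathbb I\ltimes X)$ are those induced by the functors $\widetilde\Sigma_j\times(\mathbb I\ltimes X)^j\to\mathbb I\ltimes X$ which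 send $(\sigma;c_1,\dots,c_j)$ to $c_{\sigma^{-1}(1)}\oplus\cdots\oplus c_{\sigma^{-1}(j)}$, and which send a morphism $(\sigma\to\tau;f_1,\dots,f_j)$, with $f_i:c_i\to c_i'$, to the composite of $f_{\sigma^{-1}(1)}\oplus\cdots\oplus f_{\sigma^{-1}(j)}$ with the symmetry isomorphism $c'_{\sigma^{-1}(1)}\oplus\cdots\oplus c'_{\sigma^{-1}(j)}\to c'_{\tau^{-1}(1)}\oplus\cdots\oplus c'_{\tau^{-1}(j)}$ of the permutative category that permutes the summands. -/

import Mathlib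

open CategoryTheory MonoidalCategory Opposite Topology

universe v u w

noncomputable section

namespace IHocolim

/-! ### Spaces

"Space" means compactly generated space (a `k`-space, no separation axiom imposed), and products
of spaces are products in that category, i.e. the usual products re-topologised by the compactly
generated topology. -/

/-- Continuity of a map out of the `k`-ification of `A`.  It is used for maps out of products:
for compactly generated `A₁`, `A₂`, a map `A₁ × A₂ → B` satisfies `KContinuous` iff it is
continuous on the product of `A₁` and `A₂` in the category of compactly generated spaces. -/
def KContinuous {A : Type u} {B : Type w} [TopologicalSpace A] [TopologicalSpace B]
    (f : A → B) : Prop :=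
  Continuous[TopologicalSpace.compactlyGenerated.{u} A, inferInstance] f

/-! ### Geometric realization of simplicial spaces -/

/-- The relation `(f^* z, t) ∼ (z, f_* t)` defining the geometric realization. -/
inductive RealizationRel (Z : SimplicialObject TopCat.{u}) :
    (Σ n : SimplexCategory, Z.obj (op n) × stdSimplex ℝ (Fin (n.len + 1))) →
    (Σ n : SimplexCategory, Z.obj (op n) × stdSimplex ℝ (Fin (n.len + 1))) → Prop
  | glue {m n : SimplexCategory} (f : m ⟶ n) (z : Z.obj (op n))
      (t : stdSimplex ℝ (Fin (m.len + 1))) :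
      RealizationRel Z ⟨m, (Z.map f.op z, t)⟩ ⟨n, (z, stdSimplex.map f t)⟩

/-- The geometric realization `|Z| = (∐ₙ Zₙ × Δⁿ) / ∼` of a simplicial space, with the
quotient topology.  (As `Δⁿ` is compact Hausdorff, `Zₙ × Δⁿ` is compactly generated as soon as
`Zₙ` is.) -/
def Realization (Z : SimplicialObject TopCat.{u}) : Type u := Quot (RealizationRel Z)

instance (Z : SimplicialObject TopCat.{u}) : TopologicalSpace (Realization Z) :=
  inferInstanceAs (TopologicalSpace (Quot (RealizationRel Z)))

/-- The point `|z, t|` of the realization. -/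
def Realization.mk {Z : SimplicialObject TopCat.{u}} {n : ℕ} (z : Z.obj (op (.mk n)))
    (t : stdSimplex ℝ (Fin (n + 1))) : Realization Z :=
  Quot.mk _ ⟨.mk n, (z, t)⟩

/-! ### Classifying spaces of topological categories

The topology of a topological category is recorded by the topology on the set of all its arrows
(the set of objects embeds into it through the identities). -/

section Nerve

variable (C : Type u) [Category.{v} C] [TopologicalSpace (Arrow C)]

/-- The topology on the set of `n`-simplices `c₀ → ⋯ → cₙ` of the nerve of a topological category:
the subspace topology of a product of copies of the space of arrows. -/
@[reducible]
def nerveTopology (n : ℕ) : TopologicalSpace (ComposableArrows C n) :=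
  ⨅ (i : Fin (n + 1)) (j : Fin (n + 1)) (h : i ≤ j),
    TopologicalSpace.induced (fun F : ComposableArrows C n => Arrow.mk (F.map (homOfLE h)))
      inferInstance

/-- The nerve of a topological category, as a simplicial space. -/
def topNerve : SimplicialObject TopCat.{max u v} where
  obj n := @TopCat.of ((nerve C).obj n) (nerveTopology C n.unop.len)
  map {m n} f := by
    letI : TopologicalSpace ((nerve C).obj m) := nerveTopology C m.unop.len
    letI : TopologicalSpace ((nerve C).obj n) := nerveTopology C n.unop.len
    exact TopCat.ofHom
      { toFun := fun F => (nerve C).map f F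
        continuous_toFun := by
          refine continuous_iInf_rng.2 fun i => continuous_iInf_rng.2 fun j =>
            continuous_iInf_rng.2 fun h => continuous_induced_rng.2 ?_
          have h' : f.unop i ≤ f.unop j := f.unop.toOrderHom.monotone h
          exact (continuous_iInf_dom (i := f.unop i) <| continuous_iInf_dom (i := f.unop j) <|
            continuous_iInf_dom (i := h') continuous_induced_dom) }
  map_id _ := rfl
  map_comp _ _ := rfl

/-- The classifying space `B C` of a topological category. -/
abbrev ClassifyingSpace : Type (max u v) := Realization (topNerve C)

variable {C} in
/-- The point of `B C` given by an `n`-simplex `c₀ → ⋯ → cₙ` and a point of `Δⁿ`. -/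
def ClassifyingSpace.mk {n : ℕ} (s : ComposableArrows C n) (t : stdSimplex ℝ (Fin (n + 1))) :
    ClassifyingSpace C :=
  Realization.mk (Z := topNerve C) s t

end Nerve

/-! ### Translation categories and homotopy colimits -/

section Translation

variable {C : Type w} [Category.{v} C] (Y : C ⥤ TopCat.{u})

/-- The translation category `C ⋉ Y`: objects are pairs `(c, x)` with `x ∈ Y c`, morphisms
`(c, x) ⟶ (c', x')` are morphisms `α : c ⟶ c'` with `Y α x = x'`. -/
abbrev Translation : Type (max w u) := (Y ⋙ forget TopCat.{u}).Elements

/-- The space of arrows of the translation category is `∐_{α : c ⟶ c'} Y c`.  (The space of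
objects is then `∐_c Y c`, and the space of `n`-simplices of the nerve is
`∐_{c₀ → ⋯ → cₙ} Y c₀`.) -/
instance translationArrowTopology : TopologicalSpace (Arrow (Translation Y)) :=
  TopologicalSpace.induced
    (fun a => (⟨Arrow.mk a.hom.val, a.left.2⟩ : Σ α : Arrow C, Y.obj α.left))
    instTopologicalSpaceSigma

/-- The simplicial space of the bar construction: its space of `n`-simplices is
`∐_{c₀ → ⋯ → cₙ} Y c₀`. -/
def barConstruction : SimplicialObject TopCat.{max w v u} where
  obj n := TopCat.of (Σ F : ComposableArrows C n.unop.len, Y.obj (F.obj 0))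
  map {m n} f := TopCat.ofHom
    { toFun := fun z => ⟨(nerve C).map f z.1,
        Y.map (z.1.map (homOfLE (Fin.zero_le (f.unop.toOrderHom 0)))) z.2⟩
      continuous_toFun := by
        refine continuous_sigma fun F => ?_
        exact (continuous_sigmaMk (σ := fun G : ComposableArrows C n.unop.len => Y.obj (G.obj 0))
          (i := (nerve C).map f F)).comp
          (Y.map (F.map (homOfLE (Fin.zero_le (f.unop.toOrderHom 0))))).hom.continuous }
  map_id n := by
    refine TopCat.hom_ext (ContinuousMap.ext fun ⟨F, y⟩ => Sigma.ext rfl (heq_of_eq ?_))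
    change Y.map (F.map (𝟙 _)) y = y
    simp
  map_comp {l m n} f g := by
    refine TopCat.hom_ext (ContinuousMap.ext fun ⟨F, y⟩ => Sigma.ext rfl (heq_of_eq ?_))
    have h0 : 0 ≤ f.unop.toOrderHom 0 := Fin.zero_le _
    have h1 : f.unop.toOrderHom 0 ≤ f.unop.toOrderHom (g.unop.toOrderHom 0) :=
      f.unop.toOrderHom.monotone (Fin.zero_le _)
    change Y.map (F.map (homOfLE (h0.trans h1))) y =
      Y.map (F.map (homOfLE h1)) (Y.map (F.map (homOfLE h0)) y)
    rw [← ConcreteCategory.comp_apply, ← Y.map_comp, ← F.map_comp]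
    rfl

/-- The homotopy colimit `hocolim_C Y`, defined by the bar construction. -/
abbrev Hocolim : Type (max w v u) := Realization (barConstruction Y)

/-- The point of `hocolim_C Y` given by `c₀ → ⋯ → cₙ`, a point of `Y c₀` and a point of `Δⁿ`. -/
def Hocolim.mk {n : ℕ} (F : ComposableArrows C n) (y : Y.obj (F.obj 0))
    (t : stdSimplex ℝ (Fin (n + 1))) : Hocolim Y :=
  Realization.mk (Z := barConstruction Y) (⟨F, y⟩ : Σ F : ComposableArrows C n, Y.obj (F.obj 0)) t

end Translation

/-! ### The category `𝕀` -/

/-- Objects of `𝕀`: the finite sets `𝐧 = {1, …, n}`, one for every integer `n ≥ 0`. -/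
@[ext]
structure FinInj where
  /-- the number of elements -/
  card : ℕ

namespace FinInj

/-- Morphisms of `𝕀`: all injective maps. -/
@[ext]
structure Hom (m n : FinInj) where
  /-- the underlying injective map -/
  emb : Fin m.card ↪ Fin n.card

instance : Category FinInj where
  Hom := Hom
  id m := ⟨Function.Embedding.refl _⟩
  comp f g := ⟨f.emb.trans g.emb⟩

theorem hom_ext {m n : FinInj} {f g : m ⟶ n} (h : ∀ i, f.emb i = g.emb i) : f = g :=
  Hom.ext (Function.Embedding.ext h)

@[simp]
theorem id_emb (m : FinInj) (i : Fin m.card) : Hom.emb (𝟙 m) i = i := rfl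

@[simp]
theorem comp_emb {l m n : FinInj} (f : l ⟶ m) (g : m ⟶ n) (i : Fin l.card) :
    (f ≫ g).emb i = g.emb (f.emb i) := rfl

/-- A bijection as an isomorphism of `𝕀`. -/
@[simps]
def isoMk {m n : FinInj} (e : Fin m.card ≃ Fin n.card) : m ≅ n where
  hom := ⟨e.toEmbedding⟩
  inv := ⟨e.symm.toEmbedding⟩
  hom_inv_id := hom_ext fun i => e.symm_apply_apply i
  inv_hom_id := hom_ext fun i => e.apply_symm_apply i

/-- Concatenation `𝐦 ⊔ 𝐧 = {1, …, m + n}`, with the empty set as unit. -/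
instance : MonoidalCategoryStruct FinInj where
  tensorObj m n := ⟨m.card + n.card⟩
  tensorHom f g := ⟨(finSumFinEquiv.symm.toEmbedding.trans (f.emb.sumMap g.emb)).trans
    finSumFinEquiv.toEmbedding⟩
  whiskerLeft m _ _ g := ⟨(finSumFinEquiv.symm.toEmbedding.trans
    ((Hom.emb (𝟙 m)).sumMap g.emb)).trans finSumFinEquiv.toEmbedding⟩
  whiskerRight f n := ⟨(finSumFinEquiv.symm.toEmbedding.trans
    (f.emb.sumMap (Hom.emb (𝟙 n)))).trans finSumFinEquiv.toEmbedding⟩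
  tensorUnit := ⟨0⟩
  associator _ _ _ := isoMk (finCongr (Nat.add_assoc _ _ _))
  leftUnitor _ := isoMk (finCongr (Nat.zero_add _))
  rightUnitor _ := isoMk (finCongr (Nat.add_zero _))

/-- The inclusion of the first block `𝐦` into the set `𝐦 ⊔ 𝐧`. -/
def inl (m n : FinInj) (i : Fin m.card) : Fin (m ⊗ n).card := Fin.castAdd n.card i

/-- The inclusion of the second block `𝐧` into the set `𝐦 ⊔ 𝐧`. -/
def inr (m n : FinInj) (i : Fin n.card) : Fin (m ⊗ n).card := Fin.natAdd m.card i

theorem sum_cases {m n : FinInj} {p : Fin (m ⊗ n).card → Prop} (h₁ : ∀ i, p (inl m n i))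
    (h₂ : ∀ i, p (inr m n i)) (i : Fin (m ⊗ n).card) : p i := by
  change Fin (m.card + n.card) at i
  induction i using Fin.addCases with
  | left i => exact h₁ i
  | right i => exact h₂ i

theorem sum_hom_ext {m n k : FinInj} {f g : m ⊗ n ⟶ k}
    (h₁ : ∀ i, f.emb (inl m n i) = g.emb (inl m n i))
    (h₂ : ∀ i, f.emb (inr m n i) = g.emb (inr m n i)) : f = g :=
  hom_ext (sum_cases h₁ h₂)

@[simp]
theorem tensorHom_inl {m m' n n' : FinInj} (f : m ⟶ m') (g : n ⟶ n') (i : Fin m.card) :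
    (f ⊗ₘ g).emb (inl m n i) = inl m' n' (f.emb i) := by
  change finSumFinEquiv (Sum.map f.emb g.emb (finSumFinEquiv.symm (Fin.castAdd n.card i))) = _
  rw [finSumFinEquiv_symm_apply_castAdd]
  rfl

@[simp]
theorem tensorHom_inr {m m' n n' : FinInj} (f : m ⟶ m') (g : n ⟶ n') (i : Fin n.card) :
    (f ⊗ₘ g).emb (inr m n i) = inr m' n' (g.emb i) := by
  change finSumFinEquiv (Sum.map f.emb g.emb (finSumFinEquiv.symm (Fin.natAdd m.card i))) = _
  rw [finSumFinEquiv_symm_apply_natAdd]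
  rfl

@[simp]
theorem associator_inl_inl (l m n : FinInj) (i : Fin l.card) :
    (α_ l m n).hom.emb (inl (l ⊗ m) n (inl l m i)) = inl l (m ⊗ n) i := rfl

@[simp]
theorem associator_inl_inr (l m n : FinInj) (i : Fin m.card) :
    (α_ l m n).hom.emb (inl (l ⊗ m) n (inr l m i)) = inr l (m ⊗ n) (inl m n i) := rfl

@[simp]
theorem associator_inr (l m n : FinInj) (i : Fin n.card) :
    (α_ l m n).hom.emb (inr (l ⊗ m) n i) = inr l (m ⊗ n) (inr m n i) :=
  Fin.ext (Nat.add_assoc _ _ _)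

@[simp]
theorem leftUnitor_inr (n : FinInj) (i : Fin n.card) :
    (λ_ n).hom.emb (inr (𝟙_ FinInj) n i) = i :=
  Fin.ext (Nat.zero_add _)

@[simp]
theorem rightUnitor_inl (n : FinInj) (i : Fin n.card) :
    (ρ_ n).hom.emb (inl n (𝟙_ FinInj) i) = i := rfl

instance : MonoidalCategory FinInj :=
  .ofTensorHom
    (id_tensorHom_id := fun m n => sum_hom_ext (fun i => by simp) (fun i => by simp))
    (id_tensorHom := fun _ _ _ _ => rfl)
    (tensorHom_id := fun _ _ => rfl)
    (tensorHom_comp_tensorHom := fun f₁ f₂ g₁ g₂ =>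
      sum_hom_ext (fun i => by simp) (fun i => by simp))
    (associator_naturality := fun f₁ f₂ f₃ => sum_hom_ext
      (sum_cases (fun i => by simp) (fun i => by simp)) (fun i => by simp))
    (leftUnitor_naturality := fun f => sum_hom_ext (fun i => i.elim0) (fun i => by simp))
    (rightUnitor_naturality := fun f => sum_hom_ext (fun i => by simp) (fun i => i.elim0))
    (pentagon := fun _ _ _ _ => sum_hom_ext
      (sum_cases (sum_cases (fun i => by simp) (fun i => by simp)) (fun i => by simp))
      (fun i => by simp))
    (triangle := fun _ _ => sum_hom_ext
      (sum_cases (fun i => by simp) (fun i => i.elim0)) (fun i => by simp))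

/-- The symmetry of `𝕀` is the `(m, n)`-shuffle `τ : 𝐦 ⊔ 𝐧 ⟶ 𝐧 ⊔ 𝐦` exchanging the blocks. -/
def shuffle (m n : FinInj) : m ⊗ n ≅ n ⊗ m :=
  isoMk (m := m ⊗ n) (n := n ⊗ m) (finAddFlip (m := m.card) (n := n.card))

@[simp]
theorem shuffle_inl (m n : FinInj) (i : Fin m.card) :
    (shuffle m n).hom.emb (inl m n i) = inr n m i :=
  finAddFlip_apply_castAdd i n.card

@[simp]
theorem shuffle_inr (m n : FinInj) (i : Fin n.card) :
    (shuffle m n).hom.emb (inr m n i) = inl n m i :=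
  finAddFlip_apply_natAdd i m.card

@[simp]
theorem whiskerLeft_inl (m : FinInj) {n n' : FinInj} (g : n ⟶ n') (i : Fin m.card) :
    (m ◁ g).emb (inl m n i) = inl m n' i := by
  rw [← id_tensorHom, tensorHom_inl, id_emb]

@[simp]
theorem whiskerLeft_inr (m : FinInj) {n n' : FinInj} (g : n ⟶ n') (i : Fin n.card) :
    (m ◁ g).emb (inr m n i) = inr m n' (g.emb i) := by
  rw [← id_tensorHom, tensorHom_inr]

@[simp]
theorem whiskerRight_inl {m m' : FinInj} (f : m ⟶ m') (n : FinInj) (i : Fin m.card) :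
    (f ▷ n).emb (inl m n i) = inl m' n (f.emb i) := by
  rw [← tensorHom_id, tensorHom_inl]

@[simp]
theorem whiskerRight_inr {m m' : FinInj} (f : m ⟶ m') (n : FinInj) (i : Fin n.card) :
    (f ▷ n).emb (inr m n i) = inr m' n i := by
  rw [← tensorHom_id, tensorHom_inr, id_emb]

@[simp]
theorem associator_inv_inl (l m n : FinInj) (i : Fin l.card) :
    (α_ l m n).inv.emb (inl l (m ⊗ n) i) = inl (l ⊗ m) n (inl l m i) := rfl

@[simp]
theorem associator_inv_inr_inl (l m n : FinInj) (i : Fin m.card) :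
    (α_ l m n).inv.emb (inr l (m ⊗ n) (inl m n i)) = inl (l ⊗ m) n (inr l m i) := rfl

@[simp]
theorem associator_inv_inr_inr (l m n : FinInj) (i : Fin n.card) :
    (α_ l m n).inv.emb (inr l (m ⊗ n) (inr m n i)) = inr (l ⊗ m) n i :=
  Fin.ext (Nat.add_assoc _ _ _).symm

instance : SymmetricCategory FinInj where
  braiding := shuffle
  braiding_naturality_right _ _ _ _ := sum_hom_ext (fun i => by simp) (fun i => by simp)
  braiding_naturality_left _ _ := sum_hom_ext (fun i => by simp) (fun i => by simp)
  hexagon_forward _ _ _ := sum_hom_ext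
    (sum_cases (fun i => by simp) (fun i => by simp)) (fun i => by simp)
  hexagon_reverse _ _ _ := sum_hom_ext (fun i => by simp)
    (sum_cases (fun i => by simp) (fun i => by simp))
  symmetry _ _ := sum_hom_ext (fun i => by simp) (fun i => by simp)

end FinInj

/-! ### Commutative `𝕀`-monoids -/

/-- A commutative `𝕀`-monoid: an `𝕀`-space `X` (a functor from `𝕀` to spaces) with natural
transformations `μ : X(𝐦) × X(𝐧) → X(𝐦 ⊔ 𝐧)` and `η : * → X(𝐧)` that are associative, unital and
commutative. -/
structure CommIMonoid where
  /-- the underlying `𝕀`-space -/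
  functor : FinInj ⥤ TopCat.{u}
  compactlyGenerated : ∀ n, CompactlyGeneratedSpace (functor.obj n)
  /-- the multiplication -/
  μ : ∀ m n, functor.obj m → functor.obj n → functor.obj (m ⊗ n)
  μ_continuous : ∀ m n,
    KContinuous fun p : functor.obj m × functor.obj n => μ m n p.1 p.2
  μ_natural : ∀ {m m' n n'} (α : m ⟶ m') (β : n ⟶ n') (x : functor.obj m) (y : functor.obj n),
    functor.map (α ⊗ₘ β) (μ m n x y) = μ m' n' (functor.map α x) (functor.map β y)
  /-- the unit -/
  η : ∀ n, functor.obj n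
  η_natural : ∀ {m n} (α : m ⟶ n), functor.map α (η m) = η n
  μ_assoc : ∀ l m n (x : functor.obj l) (y : functor.obj m) (z : functor.obj n),
    functor.map (α_ l m n).hom (μ (l ⊗ m) n (μ l m x y) z) = μ l (m ⊗ n) x (μ m n y z)
  η_μ : ∀ n (x : functor.obj n),
    functor.map (λ_ n).hom (μ (𝟙_ FinInj) n (η (𝟙_ FinInj)) x) = x
  μ_η : ∀ n (x : functor.obj n),
    functor.map (ρ_ n).hom (μ n (𝟙_ FinInj) x (η (𝟙_ FinInj))) = x
  μ_comm : ∀ m n (x : functor.obj m) (y : functor.obj n),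
    functor.map (β_ m n).hom (μ m n x y) = μ n m y x

/-! ### Permutative categories -/

/-- A permutative category: a symmetric monoidal category that is strictly associative and
strictly unital. -/
class IsPermutative (C : Type u) [Category.{v} C] [MonoidalCategory C] [SymmetricCategory C] :
    Prop where
  tensor_assoc : ∀ a b c : C, (a ⊗ b) ⊗ c = a ⊗ (b ⊗ c)
  associator_eq : ∀ a b c : C, α_ a b c = eqToIso (tensor_assoc a b c)
  unit_tensor : ∀ a : C, 𝟙_ C ⊗ a = a
  leftUnitor_eq : ∀ a : C, λ_ a = eqToIso (unit_tensor a)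
  tensor_unit : ∀ a : C, a ⊗ 𝟙_ C = a
  rightUnitor_eq : ∀ a : C, ρ_ a = eqToIso (tensor_unit a)

namespace CommIMonoid

variable (X : CommIMonoid.{u})

/-- The translation category `𝕀 ⋉ X`. -/
abbrev Trans : Type u := Translation X.functor

variable {X}

/-- An isomorphism of `𝕀 ⋉ X` from an isomorphism of `𝕀`. -/
def transIso {a b : X.Trans} (e : a.1 ≅ b.1) (h : X.functor.map e.hom a.2 = b.2) : a ≅ b :=
  CategoryOfElements.isoMk a b e h

/-- The product `(𝐦, x) ⊕ (𝐧, y) = (𝐦 ⊔ 𝐧, μ(x, y))` and `α ⊕ β = α ⊔ β` on `𝕀 ⋉ X`. -/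
instance : MonoidalCategoryStruct X.Trans where
  tensorObj a b := ⟨a.1 ⊗ b.1, X.μ _ _ a.2 b.2⟩
  tensorHom {a a' b b'} f g := ⟨f.1 ⊗ₘ g.1, by
    have hf : X.functor.map f.1 a.2 = a'.2 := f.2
    have hg : X.functor.map g.1 b.2 = b'.2 := g.2
    exact (X.μ_natural f.1 g.1 a.2 b.2).trans (by rw [hf, hg])⟩
  whiskerLeft a b b' g := ⟨a.1 ◁ g.1, by
    have hg : X.functor.map g.1 b.2 = b'.2 := g.2
    rw [← id_tensorHom]
    exact (X.μ_natural (𝟙 a.1) g.1 a.2 b.2).trans (by rw [hg]; simp)⟩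
  whiskerRight {a a'} f b := ⟨f.1 ▷ b.1, by
    have hf : X.functor.map f.1 a.2 = a'.2 := f.2
    rw [← tensorHom_id]
    exact (X.μ_natural f.1 (𝟙 b.1) a.2 b.2).trans (by rw [hf]; simp)⟩
  tensorUnit := ⟨𝟙_ FinInj, X.η _⟩
  associator a b c := transIso (α_ a.1 b.1 c.1) (X.μ_assoc _ _ _ a.2 b.2 c.2)
  leftUnitor a := transIso (λ_ a.1) (X.η_μ _ a.2)
  rightUnitor a := transIso (ρ_ a.1) (X.μ_η _ a.2)

instance : MonoidalCategory X.Trans where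
  tensorHom_def _ _ := CategoryOfElements.ext _ _ _ (tensorHom_def _ _)
  id_tensorHom_id _ _ := CategoryOfElements.ext _ _ _ (id_tensorHom_id _ _)
  tensorHom_comp_tensorHom _ _ _ _ := CategoryOfElements.ext _ _ _
    (tensorHom_comp_tensorHom _ _ _ _)
  whiskerLeft_id _ _ := CategoryOfElements.ext _ _ _ (MonoidalCategory.whiskerLeft_id _ _)
  id_whiskerRight _ _ := CategoryOfElements.ext _ _ _ (MonoidalCategory.id_whiskerRight _ _)
  associator_naturality _ _ _ := CategoryOfElements.ext _ _ _ (associator_naturality _ _ _)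
  leftUnitor_naturality _ := CategoryOfElements.ext _ _ _ (leftUnitor_naturality _)
  rightUnitor_naturality _ := CategoryOfElements.ext _ _ _ (rightUnitor_naturality _)
  pentagon _ _ _ _ := CategoryOfElements.ext _ _ _ (pentagon _ _ _ _)
  triangle _ _ := CategoryOfElements.ext _ _ _ (triangle _ _)

/-- The symmetry of `𝕀 ⋉ X` is given by the shuffles `τ` of `𝕀`. -/
instance : SymmetricCategory X.Trans where
  braiding a b := transIso (β_ a.1 b.1) (X.μ_comm _ _ a.2 b.2)
  braiding_naturality_right _ _ _ _ := CategoryOfElements.ext _ _ _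
    (BraidedCategory.braiding_naturality_right _ _)
  braiding_naturality_left _ _ := CategoryOfElements.ext _ _ _
    (BraidedCategory.braiding_naturality_left _ _)
  hexagon_forward _ _ _ := CategoryOfElements.ext _ _ _ (BraidedCategory.hexagon_forward _ _ _)
  hexagon_reverse _ _ _ := CategoryOfElements.ext _ _ _ (BraidedCategory.hexagon_reverse _ _ _)
  symmetry _ _ := CategoryOfElements.ext _ _ _ (SymmetricCategory.symmetry _ _)

theorem eq_of_iso {a b : X.Trans} (e : a ≅ b) (h : a.1 = b.1) (he : e.hom.val = eqToHom h) :
    ∃ h' : a = b, e = eqToIso h' := by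
  obtain ⟨m, x⟩ := a
  obtain ⟨n, y⟩ := b
  dsimp only at h
  subst h
  have hxy : x = y := by
    have := e.hom.2
    rw [he] at this
    simpa using this
  subst hxy
  exact ⟨rfl, Iso.ext (CategoryOfElements.ext _ _ _ he)⟩

end CommIMonoid

theorem FinInj.eqToHom_val {m n : FinInj} (h : m = n) (i : Fin m.card) :
    ((eqToHom h).emb i).val = i.val := by
  subst h
  rfl

theorem FinInj.isoMk_finCongr {m n : FinInj} (h : m.card = n.card) :
    (FinInj.isoMk (finCongr h)).hom = eqToHom (FinInj.ext h) :=
  FinInj.hom_ext fun i => Fin.ext (by rw [FinInj.eqToHom_val]; rfl)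

instance (X : CommIMonoid.{u}) : IsPermutative X.Trans where
  tensor_assoc a b c :=
    (CommIMonoid.eq_of_iso (α_ a b c) _ (FinInj.isoMk_finCongr (Nat.add_assoc _ _ _))).1
  associator_eq a b c :=
    (CommIMonoid.eq_of_iso (α_ a b c) _ (FinInj.isoMk_finCongr (Nat.add_assoc _ _ _))).2
  unit_tensor a :=
    (CommIMonoid.eq_of_iso (λ_ a) _ (FinInj.isoMk_finCongr (Nat.zero_add _))).1
  leftUnitor_eq a :=
    (CommIMonoid.eq_of_iso (λ_ a) _ (FinInj.isoMk_finCongr (Nat.zero_add _))).2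
  tensor_unit a :=
    (CommIMonoid.eq_of_iso (ρ_ a) _ (FinInj.isoMk_finCongr (Nat.add_zero _))).1
  rightUnitor_eq a :=
    (CommIMonoid.eq_of_iso (ρ_ a) _ (FinInj.isoMk_finCongr (Nat.add_zero _))).2

/-! ### The Barratt–Eccles functors of a permutative category -/

section Permutative

variable {C : Type u} [Category.{v} C] [MonoidalCategory C]

/-- The iterated product `c₁ ⊕ ⋯ ⊕ cⱼ`, as a functor `Cʲ ⥤ C`. -/
def bigTensor : (j : ℕ) → (Fin j → C) ⥤ C
  | 0 => (Functor.const _).obj (𝟙_ C)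
  | j + 1 =>
    { obj := fun c => c 0 ⊗ (bigTensor j).obj fun i => c i.succ
      map := fun f => f 0 ⊗ₘ (bigTensor j).map fun i => f i.succ
      map_id := fun c => by
        rw [Pi.id_apply]
        exact (congrArg (𝟙 (c 0) ⊗ₘ ·) ((bigTensor j).map_id fun i => c i.succ)).trans
          (id_tensorHom_id _ _)
      map_comp := fun f g => by
        refine Eq.trans ?_ (tensorHom_comp_tensorHom _ _ _ _).symm
        exact congrArg ((f 0 ≫ g 0) ⊗ₘ ·)
          ((bigTensor j).map_comp (fun i => f i.succ) (fun i => g i.succ)) }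

variable [SymmetricCategory C]

/-- The symmetry `c₁ ⊕ ⋯ ⊕ cⱼ₊₁ ≅ cₚ ⊕ (c₁ ⊕ ⋯ ⊕ ĉₚ ⊕ ⋯ ⊕ cⱼ₊₁)` moving one factor to the front
past the preceding ones. -/
def moveToFront : {j : ℕ} → (p : Fin (j + 1)) → (c : Fin (j + 1) → C) →
    ((bigTensor (j + 1)).obj c ≅ c p ⊗ (bigTensor j).obj fun i => c (p.succAbove i))
  | j, ⟨0, _⟩, c => Iso.refl (c 0 ⊗ (bigTensor j).obj fun i => c i.succ)
  | j + 1, ⟨q + 1, hq⟩, c =>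
    let p : Fin (j + 1) := ⟨q, Nat.lt_of_succ_lt_succ hq⟩
    whiskerLeftIso (c 0) (moveToFront p fun i => c i.succ) ≪≫
      (α_ (c 0) (c p.succ) _).symm ≪≫
      whiskerRightIso (β_ (c 0) (c p.succ)) _ ≪≫
      α_ (c p.succ) (c 0) _ ≪≫
      whiskerLeftIso (c p.succ)
        (eqToIso (congrArg₂ (fun (a : C) (b : Fin j → C) => a ⊗ (bigTensor j).obj b)
          (congrArg c (Fin.succ_succAbove_zero p).symm)
          (funext fun i => congrArg c (Fin.succ_succAbove_succ p i).symm)))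

/-- For a permutation `ρ` of `j + 1` letters, the induced bijection from the letters other than
the first one to the letters other than `ρ 0`, both identified with `j` letters in the
order-preserving way. -/
def tailPerm {j : ℕ} (ρ : Equiv.Perm (Fin (j + 1))) : Equiv.Perm (Fin j) :=
  (finSuccAboveEquiv 0).trans
    ((ρ.subtypeEquiv (q := (· ≠ ρ 0)) fun _ => ρ.injective.ne_iff.symm).trans (finSuccAboveEquiv (ρ 0)).symm)

theorem succAbove_tailPerm {j : ℕ} (ρ : Equiv.Perm (Fin (j + 1))) (i : Fin j) :
    (ρ 0).succAbove (tailPerm ρ i) = ρ i.succ := by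
  have h := congrArg Subtype.val ((finSuccAboveEquiv (ρ 0)).apply_symm_apply
    ((ρ.subtypeEquiv (q := (· ≠ ρ 0)) fun _ => ρ.injective.ne_iff.symm) (finSuccAboveEquiv 0 i)))
  exact h

/-- The coherence isomorphism `c₁ ⊕ ⋯ ⊕ cⱼ ≅ c_{ρ(1)} ⊕ ⋯ ⊕ c_{ρ(j)}` permuting the factors. -/
def permIso : {j : ℕ} → (ρ : Equiv.Perm (Fin j)) → (c : Fin j → C) →
    ((bigTensor j).obj c ≅ (bigTensor j).obj fun i => c (ρ i))
  | 0, _, _ => Iso.refl (𝟙_ C)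
  | j + 1, ρ, c =>
    moveToFront (ρ 0) c ≪≫
      whiskerLeftIso (c (ρ 0))
        (permIso (tailPerm ρ) (fun i => c ((ρ 0).succAbove i)) ≪≫
          eqToIso (congrArg (bigTensor j).obj
            (funext fun i => congrArg c (succAbove_tailPerm ρ i))))

variable (C) in
/-- The functor `Σ̃ⱼ × Cʲ ⥤ C` by which the `j`-th category of the Barratt–Eccles operad acts on a
permutative category.  Here `Σ̃ⱼ` is the category with object set `Σⱼ` and exactly one morphism
between any two objects.  On objects it is `(σ; c₁, …, cⱼ) ↦ c_{σ⁻¹(1)} ⊕ ⋯ ⊕ c_{σ⁻¹(j)}`; on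
morphisms it combines the product of morphisms with the coherence isomorphisms permuting the
factors. -/
def barrattEcclesFunctor (j : ℕ) : Codiscrete (Equiv.Perm (Fin j)) × (Fin j → C) ⥤ C where
  obj p := (bigTensor j).obj fun i => p.2 (p.1.as.symm i)
  map {p q} f := (permIso p.1.as.symm p.2).inv ≫ (bigTensor j).map f.2 ≫
    (permIso q.1.as.symm q.2).hom
  map_id p := by
    change _ ≫ (bigTensor j).map (𝟙 p.2) ≫ _ = _
    simp
  map_comp {p q r} f g := by
    change _ ≫ (bigTensor j).map (f.2 ≫ g.2) ≫ _ = _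
    simp

end Permutative

/-! ### Operads and `E_∞`-structures -/

/-- The equivalence `Fin (∑ₛ jₛ) ≃ Fin (∑ₛ j_{e⁻¹(s)})` permuting blocks of letters (in their
lexicographic order) as `e` permutes the indices of the blocks. -/
def blockEquiv {k l : ℕ} (e : Fin k ≃ Fin l) (j : Fin k → ℕ) :
    Fin (∑ s, j s) ≃ Fin (∑ s, j (e.symm s)) :=
  finSigmaFinEquiv.symm.trans
    ((Equiv.sigmaCongrLeft' (β := fun s => Fin (j s)) e).trans finSigmaFinEquiv)

/-- The block sum `e₁ ⊕ ⋯ ⊕ eₖ` of bijections. -/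
def sumEquiv {k : ℕ} {i j : Fin k → ℕ} (e : ∀ s, Fin (i s) ≃ Fin (j s)) :
    Fin (∑ s, i s) ≃ Fin (∑ s, j s) :=
  finSigmaFinEquiv.symm.trans ((Equiv.sigmaCongrRight e).trans finSigmaFinEquiv)

theorem sum_finSigma {k : ℕ} (j : Fin k → ℕ) (i : Fin (∑ s, j s) → ℕ) :
    ∑ t, i t = ∑ s, ∑ q, i (finSigmaFinEquiv ⟨s, q⟩) := by
  rw [← Fintype.sum_sigma', ← Equiv.sum_comp finSigmaFinEquiv]

/-- The structure of a (symmetric) operad on a sequence of compactly generated spaces `𝒪(n)`.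

The right actions of the symmetric groups `Σₙ` are given in the form `act e : 𝒪(n) → 𝒪(m)` for
bijections `e : Fin m ≃ Fin n`: such a bijection exists only if `m = n`, for `m = n` this is the
right action `c ↦ c · e` of `Σₙ`, and `act` of the canonical bijection `finCongr h`, for an equality
`h : m = n` of numbers, is transport along this equality. -/
structure OperadStructure (𝒪 : ℕ → Type u) [∀ n, TopologicalSpace (𝒪 n)] where
  compactlyGenerated : ∀ n, CompactlyGeneratedSpace (𝒪 n)
  /-- the right actions of the symmetric groups -/
  act : ∀ {m n : ℕ}, (Fin m ≃ Fin n) → 𝒪 n → 𝒪 m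
  act_continuous : ∀ {m n : ℕ} (e : Fin m ≃ Fin n), Continuous (act e)
  act_refl : ∀ {n : ℕ} (c : 𝒪 n), act (Equiv.refl (Fin n)) c = c
  act_trans : ∀ {l m n : ℕ} (e : Fin l ≃ Fin m) (e' : Fin m ≃ Fin n) (c : 𝒪 n),
    act (e.trans e') c = act e (act e' c)
  /-- the unit -/
  one : 𝒪 1
  /-- the structure maps `γ : 𝒪(k) × 𝒪(j₁) × ⋯ × 𝒪(jₖ) → 𝒪(j₁ + ⋯ + jₖ)` -/
  γ : ∀ {k : ℕ} (j : Fin k → ℕ), 𝒪 k → (∀ s, 𝒪 (j s)) → 𝒪 (∑ s, j s)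
  γ_continuous : ∀ {k : ℕ} (j : Fin k → ℕ),
    KContinuous fun p : 𝒪 k × (∀ s, 𝒪 (j s)) => γ j p.1 p.2
  /-- associativity -/
  γ_assoc : ∀ {k : ℕ} (j : Fin k → ℕ) (i : Fin (∑ s, j s) → ℕ)
    (c : 𝒪 k) (d : ∀ s, 𝒪 (j s)) (e : ∀ t, 𝒪 (i t)),
    γ i (γ j c d) e = act (finCongr (sum_finSigma j i))
      (γ (fun s => ∑ q, i (finSigmaFinEquiv ⟨s, q⟩)) c fun s =>
        γ (fun q => i (finSigmaFinEquiv ⟨s, q⟩)) (d s) fun q => e (finSigmaFinEquiv ⟨s, q⟩))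
  one_γ : ∀ (j : Fin 1 → ℕ) (d : ∀ s, 𝒪 (j s)),
    γ j one d = act (finCongr (Fin.sum_univ_one j)) (d 0)
  γ_one : ∀ {k : ℕ} (c : 𝒪 k),
    γ (fun _ : Fin k => 1) c (fun _ => one) = act (finCongr (by simp)) c
  /-- equivariance in the first variable -/
  act_γ : ∀ {k l : ℕ} (e : Fin k ≃ Fin l) (j : Fin k → ℕ) (c : 𝒪 l) (d : ∀ s, 𝒪 (j s)),
    γ j (act e c) d =
      act (blockEquiv e j) (γ (fun s => j (e.symm s)) c fun s => d (e.symm s))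
  /-- equivariance in the other variables -/
  γ_act : ∀ {k : ℕ} (i j : Fin k → ℕ) (e : ∀ s, Fin (i s) ≃ Fin (j s)) (c : 𝒪 k)
    (d : ∀ s, 𝒪 (j s)),
    γ i c (fun s => act (e s) (d s)) = act (sumEquiv e) (γ j c d)

/-- An `E_∞`-operad: `𝒪(0)` is a point, each `𝒪(n)` is contractible, and each symmetric group `Σₙ`
acts freely on `𝒪(n)`. -/
structure OperadStructure.IsEInfinity {𝒪 : ℕ → Type u} [∀ n, TopologicalSpace (𝒪 n)]
    (O : OperadStructure 𝒪) : Prop where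
  zero : Nonempty (Unique (𝒪 0))
  contractible : ∀ n, ContractibleSpace (𝒪 n)
  free : ∀ (n : ℕ) (σ : Equiv.Perm (Fin n)) (c : 𝒪 n), O.act σ c = c → σ = 1

/-- An action of an operad on a (compactly generated) space `Y`. -/
structure OperadAction {𝒪 : ℕ → Type v} [∀ n, TopologicalSpace (𝒪 n)] (O : OperadStructure 𝒪)
    (Y : Type u) [TopologicalSpace Y] where
  compactlyGenerated : CompactlyGeneratedSpace Y
  /-- the action maps `𝒪(k) × Yᵏ → Y` -/
  θ : ∀ {k : ℕ}, 𝒪 k → (Fin k → Y) → Y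
  θ_continuous : ∀ k : ℕ, KContinuous fun p : 𝒪 k × (Fin k → Y) => θ p.1 p.2
  θ_one : ∀ y : Fin 1 → Y, θ O.one y = y 0
  θ_act : ∀ {m n : ℕ} (e : Fin m ≃ Fin n) (c : 𝒪 n) (y : Fin m → Y),
    θ (O.act e c) y = θ c fun i => y (e.symm i)
  θ_γ : ∀ {k : ℕ} (j : Fin k → ℕ) (c : 𝒪 k) (d : ∀ s, 𝒪 (j s)) (y : Fin (∑ s, j s) → Y),
    θ (O.γ j c d) y = θ c fun s => θ (d s) fun q => y (finSigmaFinEquiv ⟨s, q⟩)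

/-! ### The Barratt–Eccles operad -/

section BarrattEccles

open Equiv (Perm)

/-- `Σ̃ⱼ` is a discrete category (with unique morphisms between any two objects). -/
instance arrowTopologyPerm (j : ℕ) : TopologicalSpace (Arrow (Codiscrete (Perm (Fin j)))) := ⊥

/-- The `j`-th space `B Σ̃ⱼ = E Σⱼ` of the Barratt–Eccles operad. -/
abbrev BarrattEcclesSpace (j : ℕ) : Type := ClassifyingSpace (Codiscrete (Perm (Fin j)))

/-- The `n`-simplex of the nerve of `Σ̃ⱼ` with vertices `σ₀, …, σₙ`. -/
def permSimplex {j n : ℕ} (σ : Fin (n + 1) → Perm (Fin j)) :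
    ComposableArrows (Codiscrete (Perm (Fin j))) n :=
  Codiscrete.functor σ

/-- The right action of bijections on permutations: `σ ↦ σ ∘ e`. -/
def permAct {m n : ℕ} (e : Fin m ≃ Fin n) (σ : Perm (Fin n)) : Perm (Fin m) :=
  e.trans (σ.trans (finCongr (by simpa using (Fintype.card_congr e).symm)))

/-- The operad composition on permutations, `γ(σ; τ₁, …, τₖ) = σ(j₁, …, jₖ) ∘ (τ₁ ⊕ ⋯ ⊕ τₖ)`,
where `σ(j₁, …, jₖ)` permutes `k` blocks of `j₁, …, jₖ` letters as `σ` permutes `k` letters. -/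
def permγ {k : ℕ} (j : Fin k → ℕ) (σ : Perm (Fin k)) (τ : ∀ s, Perm (Fin (j s))) :
    Perm (Fin (∑ s, j s)) :=
  (sumEquiv τ).trans ((blockEquiv σ j).trans (finCongr (Equiv.sum_comp σ.symm j)))

/-- The structure maps of the Barratt–Eccles operad are those induced by the operad structure of
the sequence of symmetric groups (they are determined by these formulas, since every point of a
product of realizations can be represented by simplices of the same dimension and a common point of
the standard simplex). -/
structure IsBarrattEccles (O : OperadStructure BarrattEcclesSpace) : Prop where
  act_eq : ∀ {l m n : ℕ} (e : Fin l ≃ Fin m) (σ : Fin (n + 1) → Perm (Fin m))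
    (t : stdSimplex ℝ (Fin (n + 1))),
    O.act e (ClassifyingSpace.mk (permSimplex σ) t) =
      ClassifyingSpace.mk (permSimplex fun a => permAct e (σ a)) t
  one_eq : O.one = ClassifyingSpace.mk (n := 0) (permSimplex fun _ => 1) default
  γ_eq : ∀ {k n : ℕ} (j : Fin k → ℕ) (σ : Fin (n + 1) → Perm (Fin k))
    (τ : ∀ s, Fin (n + 1) → Perm (Fin (j s))) (t : stdSimplex ℝ (Fin (n + 1))),
    O.γ j (ClassifyingSpace.mk (permSimplex σ) t)
        (fun s => ClassifyingSpace.mk (permSimplex (τ s)) t) =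
      ClassifyingSpace.mk (permSimplex fun a => permγ j (σ a) fun s => τ s a) t

/-- The action of the Barratt–Eccles operad on `B C` comes from the permutative category `C`: the
action maps `B Σ̃ₖ × (B C)ᵏ → B C` are induced by the functors `Σ̃ₖ × Cᵏ ⥤ C`. -/
def OperadAction.ComesFromPermutative {O : OperadStructure BarrattEcclesSpace}
    {C : Type u} [Category.{v} C] [MonoidalCategory C] [SymmetricCategory C]
    [TopologicalSpace (Arrow C)] (A : OperadAction O (ClassifyingSpace C)) : Prop :=
  ∀ (k n : ℕ) (σ : Fin (n + 1) → Perm (Fin k)) (s : Fin k → ComposableArrows C n)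
    (t : stdSimplex ℝ (Fin (n + 1))),
    A.θ (ClassifyingSpace.mk (permSimplex σ) t) (fun i => ClassifyingSpace.mk (s i) t) =
      ClassifyingSpace.mk
        ((Functor.prod' (permSimplex σ) (Functor.pi' s)) ⋙ barrattEcclesFunctor C k) t

end BarrattEccles

end IHocolim

end

noncomputable section

namespace IHocolim

/-! ### Common refinements of points of simplices -/

/-! Statement 1 holds because the associators and unitors of `𝕀` do not move letters: they are
identities up to equality of objects, and this passes to `𝕀 ⋉ X`.

For statement 2, a simplex of the nerve of `𝕀 ⋉ X` is determined by its underlying chain in `𝕀` and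
by the point over the initial vertex. The resulting bijection with the bar construction is a
homeomorphism in every degree (`nerveTopology_eq_induced`), because the underlying chain is locally
constant.

Statement 3 rests on the compatibility of realization with finite products. Any finitely many points
of simplices are images of one interior point of a common simplex under monotone maps
(`exists_pos_refinement`), and a monotone map is determined by its value on one interior point
(`hom_ext_of_pos`). Hence equality in a realization means having a common refinement
(`Realization.point_eq_point_iff`). Levelwise natural maps therefore induce well-defined maps on
products (`prodMap`), and an identity between such maps need only be checked on simplices of equal
dimension at a common `t`. Continuity is tested on compact Hausdorff spaces (`continuous_prodMap`).

What remains is algebra. A permutation is determined by the order it induces (`equiv_ext_of_lt`),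
and `permγ` induces a lexicographic order (`permγ_lt_iff`); this gives the operad axioms. A morphism
of `𝕀 ⋉ X` with given source and target is determined by its effect on letters. The Barratt–Eccles
functor sends letter `q` of block `i` to letter `fᵢ(q)` of block `i`
(`natMap_barrattEcclesFunctor`), so the axioms of the action become identities between block offsets
and no coherence theorem is needed. Coning with a new vertex contracts `B Σ̃ⱼ`. The action is free
because a fixed point would force `τ ∘ σ = τ` at some vertex `τ`. -/

theorem stdSimplex_map_apply {X Y : Type*} [Fintype X] [Fintype Y] [DecidableEq Y] (f : X → Y)
    (p : stdSimplex ℝ X) (y : Y) :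
    stdSimplex.map f p y = ∑ x, if f x = y then p x else 0 := by
  rw [stdSimplex.map_coe, FunOnFinite.linearMap_apply_apply, Finset.sum_filter]

/-- Two nonnegative vectors with the same total mass are the images of a common vector under
monotone maps. -/
theorem exists_monotone_coupling (N : ℕ) : ∀ (m n : ℕ), m + n = N → ∀ (a : Fin (m + 1) → ℝ)
    (b : Fin (n + 1) → ℝ), (∀ i, 0 ≤ a i) → (∀ i, 0 ≤ b i) → ∑ i, a i = ∑ i, b i →
    ∃ (p : Fin (N + 1) → ℝ) (f : Fin (N + 1) → Fin (m + 1)) (g : Fin (N + 1) → Fin (n + 1)),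
      (∀ i, 0 ≤ p i) ∧ Monotone f ∧ Monotone g ∧
      (∀ i, ∑ x, (if f x = i then p x else 0) = a i) ∧
      (∀ i, ∑ x, (if g x = i then p x else 0) = b i) := by
  have cons_mono : ∀ {N k : ℕ} (f : Fin (N + 1) → Fin (k + 1)), Monotone f →
      Monotone (Fin.cons 0 f : Fin (N + 1 + 1) → Fin (k + 1)) := by
    intro N k f hf x y hxy
    induction x using Fin.cases with
    | zero => simp
    | succ x =>
      induction y using Fin.cases with
      | zero => simp at hxy
      | succ y => simpa using hf (by simpa using hxy)
  -- Greedy coupling: if `a 0 ≤ b 0`, remove the mass `a 0` from both vectors. This uses up entry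
  -- `0` of `a` and leaves `b 0 - a 0` in entry `0` of `b`.
  have step : ∀ (N m n : ℕ), (∀ (a : Fin (m + 1) → ℝ)
    (b : Fin (n + 1) → ℝ), (∀ i, 0 ≤ a i) → (∀ i, 0 ≤ b i) → ∑ i, a i = ∑ i, b i →
    ∃ (p : Fin (N + 1) → ℝ) (f : Fin (N + 1) → Fin (m + 1)) (g : Fin (N + 1) → Fin (n + 1)),
      (∀ i, 0 ≤ p i) ∧ Monotone f ∧ Monotone g ∧
      (∀ i, ∑ x, (if f x = i then p x else 0) = a i) ∧
      (∀ i, ∑ x, (if g x = i then p x else 0) = b i)) →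
      ∀ (a : Fin (m + 1 + 1) → ℝ)
    (b : Fin (n + 1) → ℝ), (∀ i, 0 ≤ a i) → (∀ i, 0 ≤ b i) → ∑ i, a i = ∑ i, b i → a 0 ≤ b 0 →
    ∃ (p : Fin (N + 1 + 1) → ℝ) (f : Fin (N + 1 + 1) → Fin (m + 1 + 1))
      (g : Fin (N + 1 + 1) → Fin (n + 1)),
      (∀ i, 0 ≤ p i) ∧ Monotone f ∧ Monotone g ∧
      (∀ i, ∑ x, (if f x = i then p x else 0) = a i) ∧
      (∀ i, ∑ x, (if g x = i then p x else 0) = b i) := by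
    intro N m n ih a b ha hb hab h0
    obtain ⟨p, f, g, hp, hf, hg, hfa, hgb⟩ := ih (fun i => a i.succ)
      (Fin.cons (b 0 - a 0) fun i => b i.succ) (fun i => ha _)
      (by
        intro i
        induction i using Fin.cases with
        | zero => simpa using h0
        | succ i => simpa using hb _)
      (by
        rw [Fin.sum_univ_succ, Fin.sum_univ_succ b] at hab
        rw [Fin.sum_univ_succ (Fin.cons _ _ : Fin (n + 1) → ℝ)]
        simp only [Fin.cons_zero, Fin.cons_succ]
        linarith)
    -- The index in `a` advances by `succ`, while the one in `b` does not, since entry `0` of `b`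
    -- may still have mass left.
    refine ⟨Fin.cons (a 0) p, Fin.cons 0 (fun x => (f x).succ), Fin.cons 0 g, ?_,
      cons_mono _ (fun x y h => Fin.succ_le_succ_iff.2 (hf h)), cons_mono _ hg, ?_, ?_⟩
    · intro i
      induction i using Fin.cases with
      | zero => simpa using ha 0
      | succ i => simpa using hp i
    · intro i
      rw [Fin.sum_univ_succ]
      induction i using Fin.cases with
      | zero => simp [Fin.succ_ne_zero]
      | succ i => simpa [(Fin.succ_ne_zero i).symm] using hfa i
    · intro i
      have := hgb i
      rw [Fin.sum_univ_succ]
      induction i using Fin.cases with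
      | zero => simp at this ⊢; linarith
      | succ i => simpa [(Fin.succ_ne_zero i).symm] using this
  induction N with
  | zero =>
    intro m n h a b ha hb hab
    obtain rfl : m = 0 := by omega
    obtain rfl : n = 0 := by omega
    refine ⟨a, id, id, ha, monotone_id, monotone_id, fun i => ?_, fun i => ?_⟩
    · obtain rfl : i = 0 := Fin.fin_one_eq_zero i
      simp
    · obtain rfl : i = 0 := Fin.fin_one_eq_zero i
      simpa using hab
  | succ N ih =>
    intro m n h a b ha hb hab
    rcases m with _ | m
    · obtain rfl : n = N + 1 := by omega
      refine ⟨b, fun _ => 0, id, hb, monotone_const, monotone_id, fun i => ?_, fun i => by simp [eq_comm]⟩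
      obtain rfl : i = 0 := Fin.fin_one_eq_zero i
      simpa using hab.symm
    rcases n with _ | n
    · obtain rfl : m = N := by omega
      refine ⟨a, id, fun _ => 0, ha, monotone_id, monotone_const, fun i => by simp [eq_comm], fun i => ?_⟩
      obtain rfl : i = 0 := Fin.fin_one_eq_zero i
      simpa using hab
    rcases le_total (a 0) (b 0) with h0 | h0
    · exact step N m (n + 1) (ih m (n + 1) (by omega)) a b ha hb hab h0
    · obtain ⟨p, f, g, h1, h2, h3, h4, h5⟩ :=
        step N n (m + 1) (fun a b ha hb hab => by
          obtain ⟨p, f, g, h1, h2, h3, h4, h5⟩ := ih (m + 1) n (by omega) b a hb ha hab.symm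
          exact ⟨p, g, f, h1, h3, h2, h5, h4⟩) b a hb ha hab.symm h0
      exact ⟨p, g, f, h1, h3, h2, h5, h4⟩

/-- A morphism of the simplex category from a monotone map. -/
def simplexHom {m n : SimplexCategory} (f : Fin (m.len + 1) → Fin (n.len + 1)) (hf : Monotone f) :
    m ⟶ n :=
  SimplexCategory.Hom.mk ⟨f, hf⟩

theorem map_comp_simplex {l m n : SimplexCategory} (f : l ⟶ m) (g : m ⟶ n)
    (t : stdSimplex ℝ (Fin (l.len + 1))) :
    stdSimplex.map (f ≫ g) t = stdSimplex.map g (stdSimplex.map f t) := by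
  rw [stdSimplex.map_comp_apply]
  rfl

theorem map_id_simplex {l : SimplexCategory} (t : stdSimplex ℝ (Fin (l.len + 1))) :
    stdSimplex.map (𝟙 l) t = t :=
  stdSimplex.map_id_apply t

/-- `N` is chosen before `s` and `t`. This uniformity lets `continuous_prodMap` work with
refinements of one fixed dimension, hence with finitely many tuples of monotone maps. -/
theorem exists_refinement₂ (m n : SimplexCategory) :
    ∃ N : SimplexCategory, ∀ (s : stdSimplex ℝ (Fin (m.len + 1)))
      (t : stdSimplex ℝ (Fin (n.len + 1))),
      ∃ (q : stdSimplex ℝ (Fin (N.len + 1))) (f : N ⟶ m) (g : N ⟶ n),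
        stdSimplex.map f q = s ∧ stdSimplex.map g q = t := by
  refine ⟨.mk (m.len + n.len), fun s t => ?_⟩
  obtain ⟨p, f, g, hp, hf, hg, hfs, hgt⟩ := exists_monotone_coupling _ m.len n.len rfl s t
    (stdSimplex.zero_le s) (stdSimplex.zero_le t)
    ((stdSimplex.sum_eq_one s).trans (stdSimplex.sum_eq_one t).symm)
  have hp1 : ∑ x, p x = 1 := by
    rw [← stdSimplex.sum_eq_one s, ← Finset.sum_congr rfl fun i _ => hfs i, Finset.sum_comm]
    simp
  refine ⟨⟨p, hp, hp1⟩, simplexHom (m := .mk _) f hf, simplexHom (m := .mk _) g hg, ?_, ?_⟩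
  · ext i
    rw [stdSimplex_map_apply]
    exact hfs i
  · ext i
    rw [stdSimplex_map_apply]
    exact hgt i

/-- Finitely many points of simplices have a common refinement, of a dimension that depends only
on the dimensions of the simplices. -/
theorem exists_refinement_fin : ∀ {k : ℕ} (n : Fin k → SimplexCategory),
    ∃ N : SimplexCategory, ∀ t : ∀ i, stdSimplex ℝ (Fin ((n i).len + 1)),
      ∃ (q : stdSimplex ℝ (Fin (N.len + 1))) (f : ∀ i, N ⟶ n i),
        ∀ i, stdSimplex.map (f i) q = t i
  | 0, n => ⟨.mk 0, fun _ => ⟨default, fun i => i.elim0, fun i => i.elim0⟩⟩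
  | k + 1, n => by
    obtain ⟨N, hN⟩ := exists_refinement_fin fun i : Fin k => n i.succ
    obtain ⟨M, hM⟩ := exists_refinement₂ (n 0) N
    refine ⟨M, fun t => ?_⟩
    obtain ⟨q, f, hf⟩ := hN fun i => t i.succ
    obtain ⟨r, g, h, hg, hh⟩ := hM (t 0) q
    refine ⟨r, Fin.cases g fun i => h ≫ f i, fun i => ?_⟩
    induction i using Fin.cases with
    | zero => exact hg
    | succ i => exact (map_comp_simplex h (f i) r).trans (by rw [hh, hf])

theorem exists_refinement {ι : Type*} [Finite ι] (n : ι → SimplexCategory) :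
    ∃ N : SimplexCategory, ∀ t : ∀ i, stdSimplex ℝ (Fin ((n i).len + 1)),
      ∃ (q : stdSimplex ℝ (Fin (N.len + 1))) (f : ∀ i, N ⟶ n i),
        ∀ i, stdSimplex.map (f i) q = t i := by
  obtain ⟨k, ⟨e⟩⟩ := Finite.exists_equiv_fin ι
  obtain ⟨N, hN⟩ := exists_refinement_fin fun i => n (e.symm i)
  refine ⟨N, fun t => ?_⟩
  obtain ⟨q, f, hf⟩ := hN fun i => t (e.symm i)
  have key : ∀ i, ∃ g : N ⟶ n i, stdSimplex.map g q = t i := fun i => by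
    obtain ⟨i, rfl⟩ := e.symm.surjective i
    exact ⟨f i, hf i⟩
  choose g hg using key
  exact ⟨q, g, hg⟩

/-- Every point of a simplex lies in the interior of a face. -/
theorem exists_pos_face (n : SimplexCategory) (t : stdSimplex ℝ (Fin (n.len + 1))) :
    ∃ (m : SimplexCategory) (q : stdSimplex ℝ (Fin (m.len + 1))) (f : m ⟶ n),
      (∀ i, 0 < q i) ∧ stdSimplex.map f q = t := by
  classical
  -- The face is spanned by the support of `t`; its increasing enumeration is the required monotone
  -- map.
  set S : Finset (Fin (n.len + 1)) := Finset.univ.filter fun i => 0 < t i with hS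
  have hsum : ∑ i ∈ S, t i = 1 := by
    rw [← stdSimplex.sum_eq_one t, hS, Finset.sum_filter]
    refine Finset.sum_congr rfl fun i _ => ?_
    split_ifs with h
    · rfl
    · exact le_antisymm (stdSimplex.zero_le t i) (not_lt.1 h)
  have hne : S.Nonempty := by
    by_contra h
    rw [Finset.not_nonempty_iff_eq_empty.1 h] at hsum
    simp at hsum
  obtain ⟨k, hk⟩ : ∃ k, S.card = k + 1 := ⟨S.card - 1, by have := hne.card_pos; omega⟩
  set e := S.orderIsoOfFin hk
  have hpos : ∀ i, 0 < t (e i) := fun i => (Finset.mem_filter.1 (e i).2).2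
  have hpush : ∀ y, ∑ x, (if (e x : Fin (n.len + 1)) = y then t (e x) else 0) = t y := by
    intro y
    rw [show (∑ x, if (e x : Fin (n.len + 1)) = y then t (e x) else 0) = _ from
        Equiv.sum_comp e.toEquiv (fun z : S => if (z : Fin (n.len + 1)) = y then t z else 0),
      Finset.sum_coe_sort S (fun z => if z = y then t z else 0), Finset.sum_ite_eq']
    split_ifs with h
    · rfl
    · simp only [hS, Finset.mem_filter, Finset.mem_univ, true_and] at h
      exact le_antisymm (stdSimplex.zero_le t y) (not_lt.1 h)
  have hsum' : ∑ x, t (e x) = 1 := by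
    rw [show ∑ x, t (e x) = _ from Equiv.sum_comp e.toEquiv (fun z : S => t z), Finset.sum_coe_sort S (fun z => t z), hsum]
  refine ⟨.mk k, ⟨fun i => t (e i), fun i => (hpos i).le, hsum'⟩,
    simplexHom (m := .mk k) (fun i => (e i : Fin (n.len + 1))) fun i j h => e.monotone h, hpos, ?_⟩
  ext y
  rw [stdSimplex_map_apply]
  exact hpush y

/-- A monotone map is determined by its effect on one interior point. -/
theorem hom_ext_of_pos {m n : SimplexCategory} (q : stdSimplex ℝ (Fin (m.len + 1)))
    (hq : ∀ i, 0 < q i) (f g : m ⟶ n) (h : stdSimplex.map f q = stdSimplex.map g q) : f = g := by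
  classical
  -- Suppose `f i < g i` and compare the masses of the initial segment `{y ≤ f i}`. If `g x ≤ f i`,
  -- then `x < i` and so `f x ≤ f i`; thus every vertex counted for `g` is counted for `f`. The
  -- vertex `i` is counted for `f` only, and it has positive mass.
  have aux : ∀ f g : m ⟶ n, stdSimplex.map f q = stdSimplex.map g q → ∀ i, ¬ f i < g i := by
    intro f g h i hi
    have mass : ∀ (k : m ⟶ n) (z : Fin (n.len + 1)),
        ∑ y, (if y ≤ z then stdSimplex.map k q y else 0) = ∑ x, if k x ≤ z then q x else 0 := by
      intro k z
      simp_rw [stdSimplex_map_apply, ← Finset.sum_filter]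
      simp_rw [Finset.sum_filter (fun x => k x = _)]
      rw [Finset.sum_comm, Finset.sum_filter]
      refine Finset.sum_congr rfl fun x _ => ?_
      rw [Finset.sum_ite_eq]
      simp
    have e := (mass f (f i)).symm.trans ((by rw [h]) : _ = _)
    rw [mass g (f i)] at e
    refine absurd e (ne_of_gt ?_)
    refine Finset.sum_lt_sum (fun x _ => ?_) ⟨i, Finset.mem_univ _, ?_⟩
    · split_ifs with h1 h2
      · rfl
      · exfalso
        refine h2 (f.toOrderHom.monotone ?_)
        by_contra hx
        exact absurd ((g.toOrderHom.monotone (not_le.1 hx).le).trans h1) (not_le.2 hi)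
      · exact (hq x).le
      · rfl
    · rw [if_neg (not_le.2 hi), if_pos le_rfl]
      exact hq i
  ext i : 3
  exact le_antisymm (not_lt.1 (aux g f h.symm i)) (not_lt.1 (aux f g h i))

/-- Finitely many points of simplices have a common refinement by an interior point. -/
theorem exists_pos_refinement {ι : Type*} [Finite ι] (n : ι → SimplexCategory)
    (t : ∀ i, stdSimplex ℝ (Fin ((n i).len + 1))) :
    ∃ (N : SimplexCategory) (q : stdSimplex ℝ (Fin (N.len + 1))) (f : ∀ i, N ⟶ n i),
      (∀ a, 0 < q a) ∧ ∀ i, stdSimplex.map (f i) q = t i := by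
  obtain ⟨N, hN⟩ := exists_refinement n
  obtain ⟨p, f, hf⟩ := hN t
  obtain ⟨M, q, d, hq, hd⟩ := exists_pos_face N p
  exact ⟨M, q, fun i => d ≫ f i, hq, fun i => by rw [map_comp_simplex, hd, hf]⟩

theorem exists_pos_refinement_option {ι : Type*} [Finite ι] {m : SimplexCategory}
    (s : stdSimplex ℝ (Fin (m.len + 1))) {n : ι → SimplexCategory}
    (t : ∀ i, stdSimplex ℝ (Fin ((n i).len + 1))) :
    ∃ (N : SimplexCategory) (q : stdSimplex ℝ (Fin (N.len + 1))) (f : N ⟶ m) (g : ∀ i, N ⟶ n i),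
      (∀ a, 0 < q a) ∧ stdSimplex.map f q = s ∧ ∀ i, stdSimplex.map (g i) q = t i := by
  obtain ⟨N, q, f, hq, hf⟩ := exists_pos_refinement (fun i : Option ι => i.elim m n)
    (fun i => Option.rec s t i)
  exact ⟨N, q, f none, fun i => f (some i), hq, hf none, fun i => hf (some i)⟩

/-! ### Compactly generated spaces -/

theorem continuous_of_forall_compact {A : Type v} {D : Type w} [TopologicalSpace A]
    [TopologicalSpace D] [UCompactlyGeneratedSpace.{u} A] (f : A → D)
    (h : ∀ (K : Type u) [TopologicalSpace K] [CompactSpace K] [T2Space K] (a : K → A),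
      Continuous a → Continuous fun x => f (a x)) : Continuous f :=
  continuous_from_uCompactlyGeneratedSpace f fun K g => h K g g.continuous

/-- The compactly generated topology is coinduced from all maps of compact Hausdorff spaces into
`A`. This is the form in which continuity on products is verified below. -/
theorem kContinuous_iff {A : Type u} {D : Type w} [TopologicalSpace A] [TopologicalSpace D]
    {f : A → D} : KContinuous f ↔
      ∀ (K : Type u) [TopologicalSpace K] [CompactSpace K] [T2Space K] (a : K → A),
        Continuous a → Continuous fun x => f (a x) := by
  constructor
  · intro h K _ _ _ a ha
    let F : (Σ i : (S : CompHaus.{u}) × C(S, A), i.fst) → A := fun ⟨⟨_, i⟩, s⟩ => i s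
    have hF : Continuous (f ∘ F) := continuous_coinduced_dom.1 h
    exact hF.comp (continuous_sigmaMk (σ := fun i : (S : CompHaus.{u}) × C(S, A) => i.fst)
      (i := ⟨CompHaus.of K, ⟨a, ha⟩⟩))
  · exact fun h => continuous_from_compactlyGenerated f fun S g => h S g g.continuous

/-- Since `S` is compact Hausdorff, continuity on `A × S` is continuity of the curried map `A → C(S,
_)`. The latter can be tested on compact `K → A`, which leads back to maps out of the compact space
`K × S`. -/
theorem uCompactlyGeneratedSpace_prod {A : Type v} [TopologicalSpace A]
    [UCompactlyGeneratedSpace.{u} A] (S : Type) [TopologicalSpace S] [CompactSpace S] [T2Space S] :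
    UCompactlyGeneratedSpace.{u} (A × S) := by
  refine uCompactlyGeneratedSpace_of_continuous_maps fun f hf => ?_
  have hslice : ∀ a, Continuous fun s => f (a, s) := fun a =>
    (hf (CompHaus.of (ULift.{u} S)) ⟨fun s => (a, s.down), by fun_prop⟩).comp continuous_uliftUp
  have hcurry : Continuous fun a => (⟨_, hslice a⟩ : C(S, _)) := by
    refine continuous_of_forall_compact.{v, u} _ fun K _ _ _ a ha => ?_
    exact ContinuousMap.continuous_of_continuous_uncurry _
      (hf (CompHaus.of (K × S)) ⟨fun x => (a x.1, x.2), by fun_prop⟩)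
  exact ContinuousMap.continuous_uncurry_of_continuous ⟨_, hcurry⟩

/-- Products with a fixed space preserve quotient maps, in compactly generated spaces. -/
theorem continuous_of_isQuotientMap {A B : Type v} {P D : Type*} [TopologicalSpace A]
    [TopologicalSpace B] [TopologicalSpace P] [TopologicalSpace D]
    [UCompactlyGeneratedSpace.{u} A] {q : A → B} (hq : IsQuotientMap q) (F : B → P → D)
    (H : ∀ (K : Type u) [TopologicalSpace K] [CompactSpace K] [T2Space K] (a : K → A) (p : K → P),
      Continuous a → Continuous p → Continuous fun x => F (q (a x)) (p x))
    (K : Type u) [TopologicalSpace K] [CompactSpace K] [T2Space K] (b : K → B) (p : K → P)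
    (hb : Continuous b) (hp : Continuous p) : Continuous fun x => F (b x) (p x) := by
  have hslice : ∀ a, Continuous fun x => F (q a) (p x) := fun a =>
    H K (fun _ => a) p continuous_const hp
  -- A map `b : K → B` need not lift to `A`, so the problem is moved to `A` itself: the test map `p`
  -- is kept fixed and `a` becomes the variable of a map into `C(K, D)`.
  have hcurry : Continuous fun a => (⟨_, hslice a⟩ : C(K, D)) := by
    refine continuous_of_forall_compact.{v, u} _ fun L _ _ _ a ha => ?_
    exact ContinuousMap.continuous_of_continuous_uncurry _
      (H (L × K) (fun x => a x.1) (fun x => p x.2) (by fun_prop) (by fun_prop))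
  have huncurry : Continuous fun x : A × K => F (q x.1) (p x.2) :=
    ContinuousMap.continuous_uncurry_of_continuous ⟨_, hcurry⟩
  -- Since `K` is locally compact, `q × id_K` is again a quotient map.
  exact (hq.continuous_lift_prod_left (g := fun x : B × K => F x.1 (p x.2)) huncurry).comp
    (hb.prodMk continuous_id)

/-- The quotients are undone one factor at a time. After the first one, `A 0` joins the parameter
space, which is why `P` is arbitrary in the induction. -/
theorem continuous_of_isQuotientMap_fin {D : Type*} [TopologicalSpace D] : ∀ {k : ℕ}
    {P : Type (max v w)} {A B : Fin k → Type v} [TopologicalSpace P] [∀ i, TopologicalSpace (A i)]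
    [∀ i, TopologicalSpace (B i)] [∀ i, UCompactlyGeneratedSpace.{u} (A i)] {q : ∀ i, A i → B i}
    (_ : ∀ i, IsQuotientMap (q i)) (F : P → (∀ i, B i) → D)
    (_ : ∀ (K : Type u) [TopologicalSpace K] [CompactSpace K] [T2Space K] (p : K → P)
      (a : ∀ i, K → A i), Continuous p → (∀ i, Continuous (a i)) →
        Continuous fun x => F (p x) fun i => q i (a i x))
    (K : Type u) [TopologicalSpace K] [CompactSpace K] [T2Space K] (p : K → P)
    (b : ∀ i, K → B i) (_ : Continuous p) (_ : ∀ i, Continuous (b i)),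
    Continuous fun x => F (p x) fun i => b i x
  | 0, P, A, B, _, _, _, _, q, hq, F, H, K, _, _, _, p, b, hp, hb => by
    convert H K p (fun i => i.elim0) hp (fun i => i.elim0) using 3
  | k + 1, P, A, B, _, _, _, _, q, hq, F, H, K, _, _, _, p, b, hp, hb => by
    have h := continuous_of_isQuotientMap (hq 0)
      (fun (y : B 0) (r : P × ∀ i : Fin k, B i.succ) => F r.1 (Fin.cons y r.2))
      (fun K _ _ _ a r ha hr => by
        exact continuous_of_isQuotientMap_fin (P := P × A 0) (fun i : Fin k => hq i.succ)
          (fun p y => F p.1 (Fin.cons (q 0 p.2) y))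
          (fun K _ _ _ p a hp ha => by
            convert H K (fun x => (p x).1) (Fin.cons (fun x => (p x).2) a)
              (continuous_fst.comp hp) (Fin.cases (continuous_snd.comp hp) ha) using 3
            funext i
            induction i using Fin.cases with
            | zero => rfl
            | succ i => rfl)
          K (fun x => ((r x).1, a x)) (fun i x => (r x).2 i)
          ((continuous_fst.comp hr).prodMk ha)
          (fun i => (continuous_apply i).comp (continuous_snd.comp hr)))
      K (b 0) (fun x => (p x, fun i => b i.succ x)) (hb 0)
      (hp.prodMk (continuous_pi fun i => hb i.succ))
    convert h using 3
    funext i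
    induction i using Fin.cases with
    | zero => rfl
    | succ i => rfl

/-- Continuity of a map out of a compact Hausdorff space may be tested on pieces on which given
maps to disjoint unions have values in a fixed summand. -/
theorem continuous_of_sigma {ι : Type*} [Finite ι] {J : ι → Type*} {A : ∀ i, J i → Type*}
    [∀ i j, TopologicalSpace (A i j)] {D : Type*} [TopologicalSpace D] {K : Type u}
    [TopologicalSpace K] [CompactSpace K] [T2Space K] (a : ∀ i, K → Σ j, A i j)
    (ha : ∀ i, Continuous (a i)) (f : K → D)
    (H : ∀ (L : Type u) [TopologicalSpace L] [CompactSpace L] [T2Space L] (e : L → K)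
      (n : ∀ i, J i) (a' : ∀ i, L → A i (n i)), Continuous e → (∀ i, Continuous (a' i)) →
        (∀ i l, a i (e l) = ⟨n i, a' i l⟩) → Continuous fun l => f (e l)) : Continuous f := by
  refine continuous_iff_continuousAt.2 fun x => ?_
  -- `U` is the clopen neighbourhood of `x` on which each `a i` stays in its summand at `x`; being
  -- closed in `K`, it is compact Hausdorff.
  set U : Set K := ⋂ i, a i ⁻¹' Set.range (Sigma.mk (a i x).1) with hU
  have hclosed : IsClosed U := isClosed_iInter fun i =>
    (IsClosedEmbedding.sigmaMk.isClosed_range).preimage (ha i)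
  have hopen : IsOpen U := isOpen_iInter_of_finite fun i => isOpen_range_sigmaMk.preimage (ha i)
  have hx : x ∈ U := Set.mem_iInter.2 fun i => ⟨(a i x).2, rfl⟩
  have : CompactSpace U := isCompact_iff_compactSpace.1 hclosed.isCompact
  have hex : ∀ i (l : U), ∃ y, Sigma.mk (a i x).1 y = a i l := fun i l => Set.mem_iInter.1 l.2 i
  choose a' ha' using hex
  have hcont : ∀ i, Continuous (a' i) := fun i => by
    refine (IsOpenEmbedding.sigmaMk (i := (a i x).1)).isEmbedding.continuous_iff.2 ?_
    convert (ha i).comp continuous_subtype_val using 1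
    exact funext fun l => ha' i l
  have := H U Subtype.val (fun i => (a i x).1) a' continuous_subtype_val hcont
    (fun i l => (ha' i l).symm)
  exact (hopen.isOpenEmbedding_subtypeVal.continuousAt_iff (x := ⟨x, hx⟩)).1 this.continuousAt

/-! ### Points of realizations -/

namespace Realization

variable {Z : SimplicialObject TopCat.{u}}

/-- The point `|z, t|`, for simplices indexed by the objects of the simplex category. -/
def point (n : SimplexCategory) (z : Z.obj (op n)) (t : stdSimplex ℝ (Fin (n.len + 1))) :
    Realization Z :=
  Quot.mk _ ⟨n, (z, t)⟩

theorem point_map {m n : SimplexCategory} (f : m ⟶ n) (z : Z.obj (op n))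
    (t : stdSimplex ℝ (Fin (m.len + 1))) :
    point m (Z.map f.op z) t = point n z (stdSimplex.map f t) :=
  Quot.sound (.glue f z t)

theorem exists_point (x : Realization Z) : ∃ n z t, x = point (Z := Z) n z t := by
  induction x using Quot.ind with
  | mk a => exact ⟨a.1, a.2.1, a.2.2, rfl⟩

theorem isQuotientMap_mk : IsQuotientMap (Quot.mk (RealizationRel Z)) := isQuotientMap_quot_mk

theorem continuous_point (n : SimplexCategory) :
    Continuous fun x : Z.obj (op n) × stdSimplex ℝ (Fin (n.len + 1)) => point n x.1 x.2 :=
  isQuotientMap_mk.continuous.comp (continuous_sigmaMk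
    (σ := fun n : SimplexCategory => Z.obj (op n) × stdSimplex ℝ (Fin (n.len + 1))) (i := n))

theorem map_comp_op {l m n : SimplexCategory} (f : l ⟶ m) (g : m ⟶ n) (z : Z.obj (op n)) :
    Z.map (f ≫ g).op z = Z.map f.op (Z.map g.op z) := by
  rw [op_comp, Z.map_comp]
  rfl

/-- Two points of a realization agree iff their representatives have a common refinement. -/
theorem point_eq_point_iff {m n : SimplexCategory} {z : Z.obj (op m)} {z' : Z.obj (op n)}
    {t : stdSimplex ℝ (Fin (m.len + 1))} {t' : stdSimplex ℝ (Fin (n.len + 1))} :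
    point m z t = point n z' t' ↔ ∃ (N : SimplexCategory) (q : stdSimplex ℝ (Fin (N.len + 1)))
      (f : N ⟶ m) (g : N ⟶ n), stdSimplex.map f q = t ∧ stdSimplex.map g q = t' ∧
        Z.map f.op z = Z.map g.op z' := by
  constructor
  · let R : (Σ n : SimplexCategory, Z.obj (op n) × stdSimplex ℝ (Fin (n.len + 1))) →
        (Σ n : SimplexCategory, Z.obj (op n) × stdSimplex ℝ (Fin (n.len + 1))) → Prop := fun a b =>
      ∃ (N : SimplexCategory) (q : stdSimplex ℝ (Fin (N.len + 1)))
        (f : N ⟶ a.1) (g : N ⟶ b.1), stdSimplex.map f q = a.2.2 ∧ stdSimplex.map g q = b.2.2 ∧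
          Z.map f.op a.2.1 = Z.map g.op b.2.1
    have hR : Equivalence R :=
      { refl := fun a => ⟨a.1, a.2.2, 𝟙 _, 𝟙 _, map_id_simplex _, map_id_simplex _, rfl⟩
        symm := fun ⟨N, q, f, g, hf, hg, h⟩ => ⟨N, q, g, f, hg, hf, h.symm⟩
        trans := by
          rintro a b c ⟨N, q, f, g, hf, hg, h⟩ ⟨N', q', f', g', hf', hg', h'⟩
          -- Transitivity is the only point at issue. Refine both refinements by an interior point
          -- `r`; the two composites into the middle simplex agree at `r`, hence are equal.
          obtain ⟨M, r, d, d', hr, h1, h2⟩ := exists_pos_refinement_option q fun _ : Unit => q'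
          have hb : d ≫ g = d' () ≫ f' := by
            refine hom_ext_of_pos r hr _ _ ?_
            rw [map_comp_simplex, map_comp_simplex, h1, h2, hg, hf']
          refine ⟨M, r, d ≫ f, d' () ≫ g', ?_, ?_, ?_⟩
          · rw [map_comp_simplex, h1, hf]
          · rw [map_comp_simplex, h2, hg']
          · rw [map_comp_op, h, map_comp_op, ← h', ← map_comp_op, ← map_comp_op, hb] }
    intro h
    have := Quot.eqvGen_exact h
    have hle : ∀ a b, Relation.EqvGen (RealizationRel Z) a b → R a b := by
      intro a b hab
      induction hab with
      | rel a b hab =>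
        obtain ⟨f, z, t⟩ := hab
        exact ⟨_, t, 𝟙 _, f, map_id_simplex _, rfl, by simp⟩
      | refl a => exact hR.refl a
      | symm a b _ ih => exact hR.symm ih
      | trans a b c _ _ ih ih' => exact hR.trans ih ih'
    exact hle _ _ this
  · rintro ⟨N, q, f, g, rfl, rfl, h⟩
    rw [← point_map, ← point_map, h]

/-- Finitely many points of realizations can be represented by simplices of the same dimension and
a common point of the standard simplex. -/
theorem exists_common {ι : Type*} [Finite ι] {Z : ι → SimplicialObject TopCat.{u}}
    (x : ∀ i, Realization (Z i)) : ∃ (n : SimplexCategory) (z : ∀ i, (Z i).obj (op n))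
      (t : stdSimplex ℝ (Fin (n.len + 1))), ∀ i, x i = point n (z i) t := by
  choose n z t h using fun i => exists_point (x i)
  obtain ⟨N, q, f, -, hf⟩ := exists_pos_refinement n t
  exact ⟨N, fun i => (Z i).map (f i).op (z i), q, fun i => by rw [point_map, hf, h]⟩

/-- The factor `Z₀` is kept apart from the family because it may live in another universe, as the
operad does relative to `B(𝕀 ⋉ X)`. -/
theorem exists_common₂ {ι : Type*} [Finite ι] {Z₀ : SimplicialObject TopCat.{v}}
    {Z : ι → SimplicialObject TopCat.{u}} (x₀ : Realization Z₀) (x : ∀ i, Realization (Z i)) :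
    ∃ (n : SimplexCategory) (z₀ : Z₀.obj (op n)) (z : ∀ i, (Z i).obj (op n))
      (t : stdSimplex ℝ (Fin (n.len + 1))), x₀ = point n z₀ t ∧ ∀ i, x i = point n (z i) t := by
  obtain ⟨n, z, t, h⟩ := exists_common x
  obtain ⟨m, z₀, s, h₀⟩ := exists_point x₀
  obtain ⟨N, hN⟩ := exists_refinement₂ m n
  obtain ⟨q, f, g, rfl, rfl⟩ := hN s t
  exact ⟨N, Z₀.map f.op z₀, fun i => (Z i).map g.op (z i), q, by rw [point_map, h₀],
    fun i => by rw [point_map, h]⟩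

/-! ### Maps out of products of realizations -/

variable {ι : Type*} [Finite ι] {Z₀ : SimplicialObject TopCat.{v}}
  {Z : ι → SimplicialObject TopCat.{u}} {W : SimplicialObject TopCat.{w}}

/-- Naturality of a sequence of maps `Z₀ₙ × ∏ᵢ Zᵢₙ → Wₙ`. -/
def LevelNatural (φ : ∀ n : SimplexCategory,
    Z₀.obj (op n) → (∀ i, (Z i).obj (op n)) → W.obj (op n)) : Prop :=
  ∀ {m n : SimplexCategory} (f : m ⟶ n) (z₀ : Z₀.obj (op n)) (z : ∀ i, (Z i).obj (op n)),
    φ m (Z₀.map f.op z₀) (fun i => (Z i).map f.op (z i)) = W.map f.op (φ n z₀ z)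

/-- The map `|Z₀| × ∏ᵢ |Zᵢ| → |W|` induced by maps `Z₀ₙ × ∏ᵢ Zᵢₙ → Wₙ`. -/
def prodMap (φ : ∀ n : SimplexCategory,
    Z₀.obj (op n) → (∀ i, (Z i).obj (op n)) → W.obj (op n))
    (x₀ : Realization Z₀) (x : ∀ i, Realization (Z i)) : Realization W :=
  -- An arbitrary choice of representatives; for natural `φ` it is irrelevant by
  -- `point_levelMap_eq`.
  let h := exists_common₂ x₀ x
  point h.choose (φ h.choose h.choose_spec.choose h.choose_spec.choose_spec.choose)
    h.choose_spec.choose_spec.choose_spec.choose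

variable {φ : ∀ n : SimplexCategory, Z₀.obj (op n) → (∀ i, (Z i).obj (op n)) → W.obj (op n)}

/-- Each hypothesis supplies its own refinement. Over a common interior point `r` all resulting maps
to `m` coincide, as they all send `r` to `t`, and likewise for `n` and `t'`. Naturality of `φ` then
applies to a single operator on each side. -/
theorem point_levelMap_eq (hφ : LevelNatural φ) {m n : SimplexCategory} {z₀ : Z₀.obj (op m)}
    {z : ∀ i, (Z i).obj (op m)} {t : stdSimplex ℝ (Fin (m.len + 1))} {z₀' : Z₀.obj (op n)}
    {z' : ∀ i, (Z i).obj (op n)} {t' : stdSimplex ℝ (Fin (n.len + 1))}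
    (h₀ : point m z₀ t = point n z₀' t') (h : ∀ i, point m (z i) t = point n (z' i) t') :
    point m (φ m z₀ z) t = point n (φ n z₀' z') t' := by
  obtain ⟨N₀, q₀, f₀, g₀, hf₀, hg₀, h₀⟩ := point_eq_point_iff.1 h₀
  choose N q f g hf hg h using fun i => point_eq_point_iff.1 (h i)
  obtain ⟨M, r, d, d', hr, hd, hd'⟩ := exists_pos_refinement_option q₀ q
  have ht : stdSimplex.map (d ≫ f₀) r = t := by rw [map_comp_simplex, hd, hf₀]
  have ht' : stdSimplex.map (d ≫ g₀) r = t' := by rw [map_comp_simplex, hd, hg₀]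
  have ef : ∀ i, d ≫ f₀ = d' i ≫ f i := fun i => by
    refine hom_ext_of_pos r hr _ _ (ht.trans ?_)
    rw [map_comp_simplex, hd', hf]
  have eg : ∀ i, d ≫ g₀ = d' i ≫ g i := fun i => by
    refine hom_ext_of_pos r hr _ _ (ht'.trans ?_)
    rw [map_comp_simplex, hd', hg]
  rw [← ht, ← ht', ← point_map, ← point_map, ← hφ, ← hφ]
  congr 2
  · rw [map_comp_op, map_comp_op, h₀]
  · funext i
    rw [ef, eg, map_comp_op, map_comp_op, h]

theorem prodMap_eq (hφ : LevelNatural φ) {n : SimplexCategory} {x₀ : Realization Z₀}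
    {x : ∀ i, Realization (Z i)} {z₀ : Z₀.obj (op n)}
    {z : ∀ i, (Z i).obj (op n)} {t : stdSimplex ℝ (Fin (n.len + 1))} (h₀ : x₀ = point n z₀ t)
    (h : ∀ i, x i = point n (z i) t) : prodMap φ x₀ x = point n (φ n z₀ z) t := by
  have hs := (exists_common₂ x₀ x).choose_spec.choose_spec.choose_spec.choose_spec
  exact point_levelMap_eq hφ (hs.1.symm.trans h₀) fun i => (hs.2 i).symm.trans (h i)

theorem prodMap_point (hφ : LevelNatural φ) (n : SimplexCategory) (z₀ : Z₀.obj (op n))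
    (z : ∀ i, (Z i).obj (op n)) (t : stdSimplex ℝ (Fin (n.len + 1))) :
    prodMap φ (point n z₀ t) (fun i => point n (z i) t) = point n (φ n z₀ z) t :=
  prodMap_eq hφ rfl fun _ => rfl

/-- Makes the cover in `continuous_prodMap` finite, so that its disjoint union is compact. -/
instance (m n : SimplexCategory) : Finite (m ⟶ n) :=
  Finite.of_injective (fun f : m ⟶ n => (f : Fin (m.len + 1) → Fin (n.len + 1)))
    fun f g h => by
      ext i : 3
      exact congrFun h i

/-- Realization is compatible with products of compactly generated spaces: continuous maps
`Z₀ₙ × ∏ᵢ Zᵢₙ → Wₙ` induce a continuous map. -/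
theorem continuous_prodMap {k : ℕ} {Z₀ : SimplicialObject TopCat.{v}}
    {Z : Fin k → SimplicialObject TopCat.{u}} {W : SimplicialObject TopCat.{w}}
    [∀ n, UCompactlyGeneratedSpace.{max u v} (Z₀.obj (op n))]
    [∀ i n, UCompactlyGeneratedSpace.{max u v} ((Z i).obj (op n))]
    {φ : ∀ n : SimplexCategory, Z₀.obj (op n) → (∀ i, (Z i).obj (op n)) → W.obj (op n)}
    (hφ : LevelNatural φ)
    (hcont : ∀ (n : SimplexCategory) (K : Type (max u v)) [TopologicalSpace K] [CompactSpace K]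
      [T2Space K] (z₀ : K → Z₀.obj (op n)) (z : ∀ i, K → (Z i).obj (op n)), Continuous z₀ →
        (∀ i, Continuous (z i)) → Continuous fun x => φ n (z₀ x) fun i => z i x)
    (K : Type (max u v)) [TopologicalSpace K] [CompactSpace K] [T2Space K]
    (x₀ : K → Realization Z₀) (x : ∀ i, K → Realization (Z i)) (hx₀ : Continuous x₀)
    (hx : ∀ i, Continuous (x i)) : Continuous fun y => prodMap φ (x₀ y) fun i => x i y := by
  have : ∀ n, UCompactlyGeneratedSpace.{max u v}
      (Z₀.obj (op n) × stdSimplex ℝ (Fin (n.len + 1))) := fun n => uCompactlyGeneratedSpace_prod _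
  have : ∀ i n, UCompactlyGeneratedSpace.{max u v}
      ((Z i).obj (op n) × stdSimplex ℝ (Fin (n.len + 1))) := fun i n =>
    uCompactlyGeneratedSpace_prod _
  -- Replace the realizations by the disjoint unions of the `Zₙ × Δⁿ`, first for `Z₀` and then for
  -- all `Z i`; afterwards localise until the dimensions of all simplices are constant.
  refine continuous_of_isQuotientMap (isQuotientMap_mk (Z := Z₀))
    (fun (y : Realization Z₀) (r : ∀ i, Realization (Z i)) => prodMap φ y r)
    (fun K _ _ _ a r ha hr => ?_) K x₀ (fun y i => x i y) hx₀ (continuous_pi hx)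
  have := continuous_of_isQuotientMap_fin (fun i => isQuotientMap_mk (Z := Z i))
    (P := ULift.{max u v} _)
    (fun (a : ULift.{max u v} (Σ n : SimplexCategory,
      Z₀.obj (op n) × stdSimplex ℝ (Fin (n.len + 1)))) (r : ∀ i, Realization (Z i)) =>
      prodMap φ (Quot.mk _ a.down) r) (fun K _ _ _ a b ha hb => ?_) K (fun y => ⟨a y⟩)
    (fun i y => r y i) (continuous_uliftUp.comp ha) (fun i => (continuous_apply i).comp hr)
  · exact this
  refine continuous_of_sigma (fun (_ : Unit) y => (a y).down)
    (fun _ => continuous_uliftDown.comp ha) _ fun L _ _ _ e m a' he ha' hae => ?_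
  refine continuous_of_sigma (fun i y => b i (e y)) (fun i => (hb i).comp he) _
    fun L' _ _ _ e' n b' he' hb' hbe => ?_
  obtain ⟨N, hN⟩ := exists_refinement (fun i : Option (Fin k) => i.elim (m ()) n)
  -- The common refinement cannot be chosen continuously. Instead, `S g` collects all pairs of a
  -- parameter and a point of `Δᴺ` that refines the given coordinates through the operators `g`.
  let S (g : (N ⟶ m ()) × ∀ i, N ⟶ n i) : Set (L' × stdSimplex ℝ (Fin (N.len + 1))) :=
    {y | stdSimplex.map g.1 y.2 = (a' () (e' y.1)).2} ∩
      ⋂ i, {y | stdSimplex.map (g.2 i) y.2 = (b' i y.1).2}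
  have hS : ∀ g, IsClosed (S g) := fun g =>
    (isClosed_eq ((stdSimplex.continuous_map _).comp continuous_snd)
      (continuous_snd.comp ((ha' ()).comp (he'.comp continuous_fst)))).inter <|
    isClosed_iInter fun i => isClosed_eq ((stdSimplex.continuous_map _).comp continuous_snd)
      (continuous_snd.comp ((hb' i).comp continuous_fst))
  have : ∀ g, CompactSpace (S g) := fun g => isCompact_iff_compactSpace.1 (hS g).isCompact
  let p : (Σ g, S g) → L' := fun y => y.2.1.1
  have hp : Continuous p := continuous_sigma fun g => continuous_fst.comp continuous_subtype_val
  have hsurj : Function.Surjective p := fun l => by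
    obtain ⟨q, f, hf⟩ := hN fun i => Option.rec (a' () (e' l)).2 (fun i => (b' i l).2) i
    exact ⟨⟨(f none, fun i => f (some i)), ⟨(l, q), hf none,
      Set.mem_iInter.2 fun i => hf (some i)⟩⟩, rfl⟩
  -- A surjection from a compact space to a Hausdorff space is a quotient map, so continuity may be
  -- checked on each `S g`. There the map is given by `φ N` with fixed operators.
  refine (hp.isClosedMap.isQuotientMap hp hsurj).continuous_iff.2 (continuous_sigma fun g => ?_)
  have key : ∀ y : S g, prodMap φ (Quot.mk _ (a (e (e' y.1.1))).down)
      (fun i => Quot.mk _ (b i (e (e' y.1.1)))) =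
      point N (φ N (Z₀.map g.1.op (a' () (e' y.1.1)).1)
        fun i => (Z i).map (g.2 i).op (b' i y.1.1).1) y.1.2 := fun y => by
    refine prodMap_eq hφ ?_ fun i => ?_
    · rw [point_map, show stdSimplex.map _ _ = _ from y.2.1, hae]
      rfl
    · rw [point_map, show stdSimplex.map _ _ = _ from Set.mem_iInter.1 y.2.2 i, hbe]
      rfl
  refine Continuous.congr ?_ fun y => (key y).symm
  have hc := hcont N (S g) (fun y => Z₀.map g.1.op (a' () (e' y.1.1)).1)
    (fun i y => (Z i).map (g.2 i).op (b' i y.1.1).1)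
    ((Z₀.map g.1.op).hom.continuous.comp (continuous_fst.comp ((ha' ()).comp (he'.comp
      (continuous_fst.comp continuous_subtype_val)))))
    (fun i => ((Z i).map (g.2 i).op).hom.continuous.comp (continuous_fst.comp ((hb' i).comp
      (continuous_fst.comp continuous_subtype_val))))
  exact (continuous_point N).comp (hc.prodMk (continuous_snd.comp continuous_subtype_val))

theorem compactlyGeneratedSpace [∀ n, UCompactlyGeneratedSpace.{w} (W.obj (op n))] :
    CompactlyGeneratedSpace (Realization W) := by
  have : ∀ n, UCompactlyGeneratedSpace.{w}
      (W.obj (op n) × stdSimplex ℝ (Fin (n.len + 1))) := fun n => uCompactlyGeneratedSpace_prod _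
  exact uCompactlyGeneratedSpace_of_coinduced isQuotientMap_mk.continuous
    isQuotientMap_mk.eq_coinduced

/-- The map of realizations induced by a map of simplicial spaces. -/
def map {Z W : SimplicialObject TopCat.{u}} (φ : Z ⟶ W) : Realization Z → Realization W :=
  Quot.lift (fun a => point a.1 (φ.app (op a.1) a.2.1) a.2.2) fun _ _ h => by
    obtain ⟨f, z, t⟩ := h
    dsimp only
    rw [← point_map, ← ConcreteCategory.comp_apply, ← ConcreteCategory.comp_apply, φ.naturality]

@[simp]
theorem map_point {Z W : SimplicialObject TopCat.{u}} (φ : Z ⟶ W) (n : SimplexCategory)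
    (z : Z.obj (op n)) (t : stdSimplex ℝ (Fin (n.len + 1))) :
    map φ (point n z t) = point n (φ.app (op n) z) t := rfl

theorem continuous_map {Z W : SimplicialObject TopCat.{u}} (φ : Z ⟶ W) : Continuous (map φ) :=
  isQuotientMap_mk.continuous_iff.2 <| continuous_sigma fun n =>
    (continuous_point n).comp (((φ.app (op n)).hom.continuous.comp continuous_fst).prodMk
      continuous_snd)

/-- The homeomorphism of realizations induced by an isomorphism of simplicial spaces. -/
def homeomorph {Z W : SimplicialObject TopCat.{u}} (e : Z ≅ W) : Realization Z ≃ₜ Realization W where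
  toFun := map e.hom
  invFun := map e.inv
  left_inv x := by
    obtain ⟨n, z, t, rfl⟩ := exists_point x
    simp [← ConcreteCategory.comp_apply, ← NatTrans.comp_app]
  right_inv x := by
    obtain ⟨n, z, t, rfl⟩ := exists_point x
    simp [← ConcreteCategory.comp_apply, ← NatTrans.comp_app]
  continuous_toFun := continuous_map _
  continuous_invFun := continuous_map _

end Realization

/-! ### The nerve of a translation category and the bar construction -/

/-- Equality in `Arrow` avoids transport along equalities of objects, which are recovered from the
identity arrows `i ≤ i`. These arrows are also the ones that define `nerveTopology`. -/
theorem composableArrows_ext_of_arrow {C : Type u} [Category.{v} C] {n : ℕ}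
    {F G : ComposableArrows C n} (h : ∀ (i j : Fin (n + 1)) (hij : i ≤ j),
      Arrow.mk (F.map (homOfLE hij)) = Arrow.mk (G.map (homOfLE hij))) : F = G := by
  refine CategoryTheory.Functor.hext (fun i => congrArg (fun a : Arrow C => a.left) (h i i le_rfl))
    fun i j f => ?_
  have hf : f = homOfLE (leOfHom f) := Subsingleton.elim _ _
  rw [hf]
  have := h i j (leOfHom f)
  rw [Arrow.mk_eq_mk_iff] at this
  obtain ⟨h₁, h₂, h₃⟩ := this
  rw [h₃]
  simp

section

variable {C : Type w} [Category.{v} C] {Y : C ⥤ TopCat.{u}}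

theorem Translation.eqToHom_val {a b : Translation Y} (h : a = b) :
    (eqToHom h).val = eqToHom (congrArg Sigma.fst h) := by
  subst h
  rfl

/-- The simplex of the bar construction corresponding to a simplex of the nerve of a translation
category. -/
def toBar {n : ℕ} (s : ComposableArrows (Translation Y) n) :
    Σ F : ComposableArrows C n, Y.obj (F.obj 0) :=
  ⟨s ⋙ CategoryOfElements.π _, (s.obj 0).2⟩

/-- The simplex of the nerve of a translation category corresponding to a simplex of the bar
construction. -/
def ofBar {n : ℕ} (z : Σ F : ComposableArrows C n, Y.obj (F.obj 0)) :
    ComposableArrows (Translation Y) n where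
  obj i := ⟨z.1.obj i, Y.map (z.1.map (homOfLE (Fin.zero_le i))) z.2⟩
  map {i j} f := ⟨z.1.map f, by
    change Y.map (z.1.map f) (Y.map (z.1.map _) z.2) = Y.map (z.1.map _) z.2
    rw [← ConcreteCategory.comp_apply, ← Y.map_comp, ← z.1.map_comp]
    rfl⟩
  map_id i := CategoryOfElements.ext _ _ _ (z.1.map_id i)
  map_comp f g := CategoryOfElements.ext _ _ _ (z.1.map_comp f g)

theorem toBar_ofBar {n : ℕ} (z : Σ F : ComposableArrows C n, Y.obj (F.obj 0)) :
    toBar (ofBar z) = z := by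
  refine Sigma.ext rfl (heq_of_eq ?_)
  change Y.map (z.1.map (𝟙 0)) z.2 = z.2
  simp

theorem map_snd {n : ℕ} (s : ComposableArrows (Translation Y) n) {i j : Fin (n + 1)} (h : i ≤ j) :
    Y.map (s.map (homOfLE h)).val (s.obj i).2 = (s.obj j).2 :=
  (s.map (homOfLE h)).2

theorem ofBar_toBar_obj {n : ℕ} (s : ComposableArrows (Translation Y) n) (i : Fin (n + 1)) :
    (ofBar (toBar s)).obj i = s.obj i :=
  Sigma.ext rfl (heq_of_eq (map_snd s (Fin.zero_le i)))

theorem ofBar_toBar {n : ℕ} (s : ComposableArrows (Translation Y) n) : ofBar (toBar s) = s := by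
  refine CategoryTheory.Functor.ext (ofBar_toBar_obj s) fun i j f =>
    CategoryOfElements.ext _ _ _ ?_
  change (s.map f).val = Subtype.val (eqToHom (ofBar_toBar_obj s i)) ≫ (s.map f).val ≫
    Subtype.val (eqToHom (ofBar_toBar_obj s j).symm)
  rw [Translation.eqToHom_val, Translation.eqToHom_val]
  exact ((Category.id_comp _).trans (Category.comp_id _)).symm

theorem continuous_nerve_arrow (D : Type u) [Category.{v} D] [TopologicalSpace (Arrow D)] {n : ℕ}
    {i j : Fin (n + 1)} (h : i ≤ j) : Continuous[nerveTopology D n, inferInstance]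
      fun F : ComposableArrows D n => Arrow.mk (F.map (homOfLE h)) :=
  continuous_iInf_dom (i := i) <| continuous_iInf_dom (i := j) <| continuous_iInf_dom (i := h)
    continuous_induced_dom

variable (Y) in
theorem continuous_arrow : Continuous fun a : Arrow (Translation Y) =>
    (⟨Arrow.mk a.hom.val, a.left.2⟩ : Σ α : Arrow C, Y.obj α.left) :=
  continuous_induced_dom

variable (Y) in
-- The space of arrows is a disjoint union indexed by the arrows of `C`, so the finitely many
-- underlying arrows of a simplex are locally constant; near a given simplex only the point over the
-- initial vertex varies. Conversely, every arrow depends continuously on the chain and that point.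
theorem nerveTopology_eq_induced (n : ℕ) :
    nerveTopology (Translation Y) n = TopologicalSpace.induced (toBar (Y := Y))
      instTopologicalSpaceSigma := by
  apply le_antisymm
  · let _ := nerveTopology (Translation Y) n
    refine continuous_iff_le_induced.1 (continuous_def.2 fun V hV => ?_)
    refine isOpen_iff_mem_nhds.2 fun s hs => ?_
    have harrow : ∀ (i j : Fin (n + 1)) (h : i ≤ j), Continuous
        fun r : ComposableArrows (Translation Y) n =>
          (⟨Arrow.mk (r.map (homOfLE h)).val, (r.obj i).2⟩ : Σ α : Arrow C, Y.obj α.left) :=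
      fun i j h => (continuous_arrow Y).comp (continuous_nerve_arrow (Translation Y) h)
    have h1 : ∀ (i j : Fin (n + 1)) (h : i ≤ j), ∀ᶠ r : ComposableArrows (Translation Y) n in 𝓝 s,
        Arrow.mk (r.map (homOfLE h)).val = Arrow.mk (s.map (homOfLE h)).val := fun i j h => by
      have := (harrow i j h).continuousAt.preimage_mem_nhds (x := s)
        (isOpen_range_sigmaMk (i := Arrow.mk (s.map (homOfLE h)).val) |>.mem_nhds ⟨_, rfl⟩)
      filter_upwards [this] with r hr
      obtain ⟨y, hy⟩ := hr
      exact (congrArg Sigma.fst hy).symm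
    -- The identity arrow at vertex `0` carries the initial point. The comparison is an `HEq`
    -- because `r` and `s` are not yet known to have the same underlying chain.
    have h2 : ∀ᶠ r : ComposableArrows (Translation Y) n in 𝓝 s, ∃ y, ⟨(toBar s).1, y⟩ ∈ V ∧
        HEq y (r.obj 0).2 := by
      have hU : IsOpen (Sigma.mk (Arrow.mk (s.map (homOfLE (le_refl 0))).val) ''
          ((fun y => (⟨(toBar s).1, y⟩ : Σ F : ComposableArrows C n, Y.obj (F.obj 0))) ⁻¹' V) :
          Set (Σ α : Arrow C, Y.obj α.left)) :=
        isOpenMap_sigmaMk _ (hV.preimage (continuous_sigmaMk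
          (σ := fun F : ComposableArrows C n => Y.obj (F.obj 0)) (i := (toBar s).1)))
      have := (harrow 0 0 le_rfl).continuousAt.preimage_mem_nhds (x := s)
        (hU.mem_nhds ⟨(s.obj 0).2, hs, rfl⟩)
      filter_upwards [this] with r hr
      obtain ⟨y, hy, hyr⟩ := hr
      exact ⟨y, hy, (Sigma.mk.inj hyr).2⟩
    have h3 := Filter.eventually_all.2 fun i => Filter.eventually_all.2 fun j =>
      Filter.eventually_all.2 fun h => h1 i j h
    filter_upwards [h2, h3] with r hr hr'
    obtain ⟨y, hy, hyr⟩ := hr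
    have : toBar r = ⟨(toBar s).1, y⟩ :=
      Sigma.ext (composableArrows_ext_of_arrow fun i j h => hr' i j h) hyr.symm
    change toBar r ∈ V
    rwa [this]
  · refine le_iInf fun i => le_iInf fun j => le_iInf fun h => ?_
    rw [translationArrowTopology, induced_compose]
    let g : (Σ F : ComposableArrows C n, Y.obj (F.obj 0)) → Σ α : Arrow C, Y.obj α.left := fun z =>
      ⟨Arrow.mk (z.1.map (homOfLE h)), Y.map (z.1.map (homOfLE (Fin.zero_le i))) z.2⟩
    have hg : Continuous g := continuous_sigma fun F =>
      (continuous_sigmaMk (σ := fun α : Arrow C => Y.obj α.left)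
        (i := Arrow.mk (F.map (homOfLE h)))).comp
        (Y.map (F.map (homOfLE (Fin.zero_le i)))).hom.continuous
    have hfun : (fun a : Arrow (Translation Y) =>
        (⟨Arrow.mk a.hom.val, a.left.2⟩ : Σ α : Arrow C, Y.obj α.left)) ∘
        (fun F : ComposableArrows (Translation Y) n => Arrow.mk (F.map (homOfLE h))) =
        g ∘ toBar := by
      funext s
      exact Sigma.ext rfl (heq_of_eq (map_snd s (Fin.zero_le i)).symm)
    rw [hfun, ← induced_compose]
    exact induced_mono (continuous_iff_le_induced.1 hg)

variable (Y) in
/-- The spaces of simplices of the nerve of `C ⋉ Y` and of the bar construction agree. -/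
def nerveHomeomorph (n : SimplexCategory) :
    (topNerve (Translation Y)).obj (op n) ≃ₜ (barConstruction Y).obj (op n) :=
  @Equiv.toHomeomorphOfIsInducing _ _ (nerveTopology (Translation Y) n.len)
    instTopologicalSpaceSigma ⟨toBar, ofBar, ofBar_toBar, toBar_ofBar⟩
    (@IsInducing.mk _ _ (nerveTopology (Translation Y) n.len) _ _ (nerveTopology_eq_induced Y n.len))

variable (Y) in
def nerveIso : topNerve (Translation Y) ≅ barConstruction Y :=
  NatIso.ofComponents (fun n => TopCat.isoOfHomeo (nerveHomeomorph Y n.unop)) fun {m n} f => by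
    refine TopCat.hom_ext (ContinuousMap.ext fun s => Sigma.ext rfl (heq_of_eq ?_))
    -- An operator may change the initial vertex; the bar construction then transports the point
    -- along the chain, as the arrows of the translation category already do.
    exact (map_snd s (Fin.zero_le (f.unop.toOrderHom 0))).symm

variable (Y) in
/-- The canonical homeomorphism `hocolim_C Y ≅ B(C ⋉ Y)`. -/
def hocolimHomeomorph : Hocolim Y ≃ₜ ClassifyingSpace (Translation Y) :=
  (Realization.homeomorph (nerveIso Y)).symm

theorem hocolimHomeomorph_mk {n : ℕ} (s : ComposableArrows (Translation Y) n)
    (t : stdSimplex ℝ (Fin (n + 1))) :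
    hocolimHomeomorph Y (Hocolim.mk Y (s ⋙ CategoryOfElements.π _) (s.obj 0).2 t) =
      ClassifyingSpace.mk s t :=
  (Realization.homeomorph (nerveIso Y)).symm_apply_eq.2 rfl

theorem uCompactlyGeneratedSpace_nerve [∀ c, UCompactlyGeneratedSpace.{u} (Y.obj c)]
    (n : SimplexCategory) :
    UCompactlyGeneratedSpace.{u} ((topNerve (Translation Y)).obj (op n)) := by
  have : UCompactlyGeneratedSpace.{u} ((barConstruction Y).obj (op n)) :=
    inferInstanceAs (UCompactlyGeneratedSpace.{u}
      (Σ F : ComposableArrows C n.len, Y.obj (F.obj 0)))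
  exact uCompactlyGeneratedSpace_of_coinduced (nerveHomeomorph Y n).symm.continuous
    (nerveHomeomorph Y n).symm.isQuotientMap.eq_coinduced

end

open Equiv (Perm)

/-! ### The operad structure of the symmetric groups -/

/-- A bijection between initial segments of `ℕ` is determined by the order that it induces. -/
theorem equiv_ext_of_lt {m n : ℕ} {e e' : Fin m ≃ Fin n}
    (h : ∀ x y, e x < e y ↔ e' x < e' y) : e = e' := by
  -- Equal induced orders make `e' ∘ e⁻¹` an order automorphism of `Fin n`, and the only one is the
  -- identity.
  let o : Fin n ≃o Fin n := ⟨e.symm.trans e', fun {a b} => by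
    obtain ⟨a, rfl⟩ := e.surjective a
    obtain ⟨b, rfl⟩ := e.surjective b
    simpa using not_congr (h b a).symm⟩
  have : o = OrderIso.refl _ := Subsingleton.elim _ _
  ext x
  have := congrArg (fun o : Fin n ≃o Fin n => o (e x)) this
  simpa [o, eq_comm] using congrArg Fin.val this

/-- Writing the offset as a sum over all blocks, with an indicator, allows it to be reindexed along
permutations and split by `sum_lex`. -/
theorem finSigmaFinEquiv_val {k : ℕ} (n : Fin k → ℕ) (s : Fin k) (q : Fin (n s)) :
    (finSigmaFinEquiv ⟨s, q⟩ : ℕ) = (∑ s', if s' < s then n s' else 0) + q := by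
  rw [finSigmaFinEquiv_apply]
  congr 1
  dsimp only
  rw [← Finset.sum_filter]
  refine Finset.sum_bij (fun i _ => Fin.castLE s.2.le i) (fun i _ => ?_)
    (fun i _ j _ h => Fin.castLE_injective _ h) (fun i hi => ?_) fun _ _ => rfl
  · rw [Finset.mem_filter]
    exact ⟨Finset.mem_univ _, i.2⟩
  · exact ⟨⟨i, (Finset.mem_filter.1 hi).2⟩, Finset.mem_univ _, rfl⟩

theorem finSigmaFinEquiv_lt_iff {k : ℕ} {n : Fin k → ℕ} {s s' : Fin k} {q : Fin (n s)}
    {q' : Fin (n s')} : finSigmaFinEquiv (n := n) ⟨s, q⟩ < finSigmaFinEquiv ⟨s', q'⟩ ↔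
      s < s' ∨ s = s' ∧ (q : ℕ) < q' := by
  have key : ∀ {s s' : Fin k} (q : Fin (n s)) (q' : Fin (n s')), s < s' →
      finSigmaFinEquiv (n := n) ⟨s, q⟩ < finSigmaFinEquiv ⟨s', q'⟩ := by
    intro s s' q q' h
    rw [Fin.lt_def, finSigmaFinEquiv_val, finSigmaFinEquiv_val]
    have : (∑ r, if r < s then n r else 0) + n s ≤ ∑ r, if r < s' then n r else 0 := by
      rw [← Finset.sum_ite_eq' Finset.univ s n |>.trans (if_pos (Finset.mem_univ s)),
        ← Finset.sum_add_distrib]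
      refine Finset.sum_le_sum fun r _ => ?_
      split_ifs <;> simp_all; omega
    omega
  rcases lt_trichotomy s s' with h | rfl | h
  · simp [h, key]
  · simp only [lt_self_iff_false, true_and, false_or]
    rw [Fin.lt_def, finSigmaFinEquiv_val, finSigmaFinEquiv_val]
    omega
  · simp only [h.not_gt, h.ne', false_or, false_and, iff_false]
    exact (key _ _ h).not_gt

/-- Splitting a sum over the pairs that precede a pair in the lexicographic order. -/
theorem sum_lex {α : Type*} [Fintype α] [DecidableEq α] {β : α → Type*} [∀ a, Fintype (β a)]
    (n : ∀ a, β a → ℕ) (P : α → Prop) [DecidablePred P] (a : α) (ha : ¬ P a)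
    (Q : ∀ a, β a → Prop) [∀ a, DecidablePred (Q a)] :
    (∑ x, ∑ y, if P x ∨ x = a ∧ Q x y then n x y else 0) =
      (∑ x, if P x then ∑ y, n x y else 0) + ∑ y, if Q a y then n a y else 0 := by
  rw [← Finset.sum_ite_eq' Finset.univ a (fun x => ∑ y, if Q x y then n x y else 0) |>.trans
    (if_pos (Finset.mem_univ a)), ← Finset.sum_add_distrib]
  refine Finset.sum_congr rfl fun x _ => ?_
  by_cases hx : x = a
  · subst hx
    simp [ha]
  · by_cases hP : P x <;> simp [hx, hP]

/-- Both sides count the letters that precede `(s, q, r)` lexicographically; `sum_lex` separates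
those in earlier blocks from those in block `s`. -/
theorem finSigmaFinEquiv_assoc {k : ℕ} (j : Fin k → ℕ) (i : Fin (∑ s, j s) → ℕ) (s : Fin k)
    (q : Fin (j s)) (r : Fin (i (finSigmaFinEquiv ⟨s, q⟩))) :
    finCongr (sum_finSigma j i) (finSigmaFinEquiv ⟨finSigmaFinEquiv ⟨s, q⟩, r⟩) =
      finSigmaFinEquiv (n := fun s => ∑ q, i (finSigmaFinEquiv ⟨s, q⟩))
        ⟨s, finSigmaFinEquiv (n := fun q => i (finSigmaFinEquiv ⟨s, q⟩)) ⟨q, r⟩⟩ := by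
  apply Fin.ext
  rw [finCongr_apply, Fin.val_cast, finSigmaFinEquiv_val, finSigmaFinEquiv_val,
    finSigmaFinEquiv_val, ← add_assoc, ← Equiv.sum_comp finSigmaFinEquiv, Fintype.sum_sigma]
  congr 1
  simp_rw [finSigmaFinEquiv_lt_iff]
  have := sum_lex (fun s (q : Fin (j s)) => i (finSigmaFinEquiv ⟨s, q⟩)) (· < s) s (lt_irrefl s)
    (fun s' (q' : Fin (j s')) => (q' : ℕ) < q)
  simpa using this

/-- Indexing by `e.symm a` makes the letter `q` literally the same on both sides, without a cast. -/
theorem blockEquiv_apply {k l : ℕ} (e : Fin k ≃ Fin l) (j : Fin k → ℕ) (a : Fin l)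
    (q : Fin (j (e.symm a))) :
    blockEquiv e j (finSigmaFinEquiv ⟨e.symm a, q⟩) =
      finSigmaFinEquiv (n := fun a => j (e.symm a)) ⟨a, q⟩ := by
  rw [← Equiv.eq_symm_apply]
  change _ = finSigmaFinEquiv ((Equiv.sigmaCongrLeft' (β := fun s => Fin (j s)) e).symm
    (finSigmaFinEquiv.symm (finSigmaFinEquiv ⟨a, q⟩)))
  rw [Equiv.symm_apply_apply]
  rfl

theorem sumEquiv_apply {k : ℕ} {i j : Fin k → ℕ} (e : ∀ s, Fin (i s) ≃ Fin (j s)) (s : Fin k)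
    (q : Fin (i s)) :
    sumEquiv e (finSigmaFinEquiv ⟨s, q⟩) = finSigmaFinEquiv ⟨s, e s q⟩ := by
  simp [sumEquiv]

theorem permAct_lt_iff {m n : ℕ} (e : Fin m ≃ Fin n) (σ : Perm (Fin n)) (x y : Fin m) :
    permAct e σ x < permAct e σ y ↔ σ (e x) < σ (e y) := by
  simp [permAct]

theorem permγ_apply {k : ℕ} (j : Fin k → ℕ) (σ : Perm (Fin k)) (τ : ∀ s, Perm (Fin (j s)))
    (a : Fin k) (q : Fin (j (σ.symm a))) :
    permγ j σ τ (finSigmaFinEquiv ⟨σ.symm a, q⟩) = finCongr (Equiv.sum_comp σ.symm j)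
      (finSigmaFinEquiv (n := fun a => j (σ.symm a)) ⟨a, τ _ q⟩) := by
  rw [permγ, Equiv.trans_apply, sumEquiv_apply, Equiv.trans_apply, blockEquiv_apply]

/-- This lexicographic description, together with `equiv_ext_of_lt`, carries all the operad
identities: casts between equal sums preserve order and drop out. -/
theorem permγ_lt_iff {k : ℕ} (j : Fin k → ℕ) (σ : Perm (Fin k)) (τ : ∀ s, Perm (Fin (j s)))
    (s s' : Fin k) (q : Fin (j s)) (q' : Fin (j s')) :
    permγ j σ τ (finSigmaFinEquiv ⟨s, q⟩) < permγ j σ τ (finSigmaFinEquiv ⟨s', q'⟩) ↔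
      σ s < σ s' ∨ s = s' ∧ (τ s q : ℕ) < τ s' q' := by
  obtain ⟨a, rfl⟩ := σ.symm.surjective s
  obtain ⟨a', rfl⟩ := σ.symm.surjective s'
  rw [permγ_apply, permγ_apply]
  change finSigmaFinEquiv (n := fun a => j (σ.symm a)) _ < finSigmaFinEquiv _ ↔ _
  rw [finSigmaFinEquiv_lt_iff]
  simp

theorem permAct_refl {n : ℕ} (σ : Perm (Fin n)) : permAct (Equiv.refl (Fin n)) σ = σ :=
  equiv_ext_of_lt fun x y => by simp [permAct_lt_iff]

theorem permAct_trans {l m n : ℕ} (e : Fin l ≃ Fin m) (e' : Fin m ≃ Fin n) (σ : Perm (Fin n)) :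
    permAct (e.trans e') σ = permAct e (permAct e' σ) :=
  equiv_ext_of_lt fun x y => by simp [permAct_lt_iff]

/-- Both sides induce the lexicographic order on triples: by `σ` on outer blocks, then by `τ`, then
by `ρ`. -/
theorem permγ_assoc {k : ℕ} (j : Fin k → ℕ) (i : Fin (∑ s, j s) → ℕ) (σ : Perm (Fin k))
    (τ : ∀ s, Perm (Fin (j s))) (ρ : ∀ t, Perm (Fin (i t))) :
    permγ i (permγ j σ τ) ρ = permAct (finCongr (sum_finSigma j i))
      (permγ (fun s => ∑ q, i (finSigmaFinEquiv ⟨s, q⟩)) σ fun s =>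
        permγ (fun q => i (finSigmaFinEquiv ⟨s, q⟩)) (τ s) fun q => ρ (finSigmaFinEquiv ⟨s, q⟩)) := by
  refine equiv_ext_of_lt fun x y => ?_
  obtain ⟨⟨x, r⟩, rfl⟩ := finSigmaFinEquiv.surjective x
  obtain ⟨⟨s, q⟩, rfl⟩ := finSigmaFinEquiv.surjective x
  obtain ⟨⟨y, r'⟩, rfl⟩ := finSigmaFinEquiv.surjective y
  obtain ⟨⟨s', q'⟩, rfl⟩ := finSigmaFinEquiv.surjective y
  rw [permAct_lt_iff, finSigmaFinEquiv_assoc, finSigmaFinEquiv_assoc, permγ_lt_iff, permγ_lt_iff,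
    permγ_lt_iff, EmbeddingLike.apply_eq_iff_eq]
  by_cases h : s = s'
  · subst h
    have := permγ_lt_iff (fun q => i (finSigmaFinEquiv ⟨s, q⟩)) (τ s)
      (fun q => ρ (finSigmaFinEquiv ⟨s, q⟩)) q q' r r'
    rw [Fin.lt_def] at this
    simp [this]
  · simp [h]

theorem one_permγ (j : Fin 1 → ℕ) (τ : ∀ s, Perm (Fin (j s))) :
    permγ j 1 τ = permAct (finCongr (Fin.sum_univ_one j)) (τ 0) := by
  have h : ∀ q : Fin (j 0), finCongr (Fin.sum_univ_one j) (finSigmaFinEquiv ⟨0, q⟩) = q :=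
    fun q => Fin.ext (by rw [finCongr_apply, Fin.val_cast, finSigmaFinEquiv_val]; simp)
  refine equiv_ext_of_lt fun x y => ?_
  obtain ⟨⟨s, q⟩, rfl⟩ := finSigmaFinEquiv.surjective x
  obtain ⟨⟨s', q'⟩, rfl⟩ := finSigmaFinEquiv.surjective y
  obtain rfl : s = 0 := Subsingleton.elim _ _
  obtain rfl : s' = 0 := Subsingleton.elim _ _
  rw [permAct_lt_iff, permγ_lt_iff, h, h]
  simp

theorem permγ_one {k : ℕ} (σ : Perm (Fin k)) :
    permγ (fun _ : Fin k => 1) σ (fun _ => 1) = permAct (finCongr (by simp)) σ := by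
  have h : ∀ (s : Fin k) (q : Fin 1), finCongr (by simp)
      (finSigmaFinEquiv (n := fun _ : Fin k => 1) ⟨s, q⟩) = s := fun s q => Fin.ext (by
    rw [finCongr_apply, Fin.val_cast, finSigmaFinEquiv_val, ← Finset.sum_filter,
      show Finset.univ.filter (· < s) = Finset.Iio s by ext; simp]
    simp)
  refine equiv_ext_of_lt fun x y => ?_
  obtain ⟨⟨s, q⟩, rfl⟩ := finSigmaFinEquiv.surjective x
  obtain ⟨⟨s', q'⟩, rfl⟩ := finSigmaFinEquiv.surjective y
  rw [permAct_lt_iff, permγ_lt_iff, h, h]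
  simp

theorem permAct_permγ {k l : ℕ} (e : Fin k ≃ Fin l) (j : Fin k → ℕ) (σ : Perm (Fin l))
    (τ : ∀ s, Perm (Fin (j s))) : permγ j (permAct e σ) τ =
      permAct (blockEquiv e j) (permγ (fun s => j (e.symm s)) σ fun s => τ (e.symm s)) := by
  refine equiv_ext_of_lt fun x y => ?_
  obtain ⟨⟨s, q⟩, rfl⟩ := finSigmaFinEquiv.surjective x
  obtain ⟨⟨s', q'⟩, rfl⟩ := finSigmaFinEquiv.surjective y
  obtain ⟨a, rfl⟩ := e.symm.surjective s
  obtain ⟨a', rfl⟩ := e.symm.surjective s'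
  rw [permAct_lt_iff, permγ_lt_iff, permAct_lt_iff, blockEquiv_apply, blockEquiv_apply,
    permγ_lt_iff]
  simp

theorem permγ_permAct {k : ℕ} (i j : Fin k → ℕ) (e : ∀ s, Fin (i s) ≃ Fin (j s))
    (σ : Perm (Fin k)) (τ : ∀ s, Perm (Fin (j s))) :
    permγ i σ (fun s => permAct (e s) (τ s)) = permAct (sumEquiv e) (permγ j σ τ) := by
  refine equiv_ext_of_lt fun x y => ?_
  obtain ⟨⟨s, q⟩, rfl⟩ := finSigmaFinEquiv.surjective x
  obtain ⟨⟨s', q'⟩, rfl⟩ := finSigmaFinEquiv.surjective y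
  rw [permAct_lt_iff, permγ_lt_iff, sumEquiv_apply, sumEquiv_apply, permγ_lt_iff]
  simp [permAct]

/-! ### The Barratt–Eccles operad -/

instance discreteTopology_nerve (C : Type u) [Category.{v} C] [TopologicalSpace (Arrow C)]
    [DiscreteTopology (Arrow C)] (n : SimplexCategory) :
    DiscreteTopology ((topNerve C).obj (op n)) := by
  let _ := nerveTopology C n.len
  change DiscreteTopology (ComposableArrows C n.len)
  refine discreteTopology_iff_isOpen_singleton.2 fun s => ?_
  have : ({s} : Set (ComposableArrows C n.len)) = ⋂ (i : Fin (n.len + 1)) (j : Fin (n.len + 1))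
      (h : i ≤ j), (fun F : ComposableArrows C n.len => Arrow.mk (F.map (homOfLE h))) ⁻¹'
        {Arrow.mk (s.map (homOfLE h))} := by
    ext F
    simp only [Set.mem_singleton_iff, Set.mem_iInter, Set.mem_preimage]
    exact ⟨fun h => by subst h; exact fun _ _ _ => rfl, fun h => composableArrows_ext_of_arrow h⟩
  rw [this]
  exact isOpen_iInter_of_finite fun i => isOpen_iInter_of_finite fun j =>
    isOpen_iInter_of_finite fun h => (isOpen_discrete _).preimage (continuous_nerve_arrow C h)

instance (j : ℕ) : DiscreteTopology (Arrow (Codiscrete (Perm (Fin j)))) := ⟨rfl⟩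

/-- The nerve of `Σ̃ⱼ`. -/
abbrev permNerve (j : ℕ) : SimplicialObject TopCat.{0} := topNerve (Codiscrete (Perm (Fin j)))

/-- The point of `B Σ̃ⱼ` given by the vertices of a simplex and a point of the standard simplex. -/
def permPoint {j : ℕ} (n : SimplexCategory) (σ : Fin (n.len + 1) → Perm (Fin j))
    (t : stdSimplex ℝ (Fin (n.len + 1))) : BarrattEcclesSpace j :=
  Realization.point (Z := permNerve j) n (permSimplex σ) t

theorem permPoint_map {j : ℕ} {m n : SimplexCategory} (f : m ⟶ n)
    (σ : Fin (n.len + 1) → Perm (Fin j)) (t : stdSimplex ℝ (Fin (m.len + 1))) :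
    permPoint m (fun a => σ (f a)) t = permPoint n σ (stdSimplex.map f t) :=
  Realization.point_map f (Z := permNerve j) (permSimplex σ) t

theorem exists_permPoint {ι : Type*} [Finite ι] {j : ι → ℕ} (c : ∀ i, BarrattEcclesSpace (j i)) :
    ∃ (n : SimplexCategory) (σ : ∀ i, Fin (n.len + 1) → Perm (Fin (j i)))
      (t : stdSimplex ℝ (Fin (n.len + 1))), ∀ i, c i = permPoint n (σ i) t := by
  obtain ⟨n, z, t, h⟩ := Realization.exists_common c
  exact ⟨n, fun i a => ((z i).obj a).as, t, h⟩

/-- The map of nerves induced by a map of permutations. -/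
def permNerveMap {i j : ℕ} (f : Perm (Fin i) → Perm (Fin j)) : permNerve i ⟶ permNerve j where
  app n := @TopCat.ofHom ((permNerve i).obj n) ((permNerve j).obj n) _ _
    { toFun := fun s => permSimplex fun a => f (s.obj a).as
      continuous_toFun := continuous_of_discreteTopology (α := (permNerve i).obj (op n.unop)) }

theorem map_permNerveMap {i j : ℕ} (f : Perm (Fin i) → Perm (Fin j)) (n : SimplexCategory)
    (σ : Fin (n.len + 1) → Perm (Fin i)) (t : stdSimplex ℝ (Fin (n.len + 1))) :
    Realization.map (permNerveMap f) (permPoint n σ t) = permPoint n (fun a => f (σ a)) t := rfl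

/-- The maps of simplices which induce the operad composition. -/
def permγSimplex {k : ℕ} (j : Fin k → ℕ) (n : SimplexCategory) (s : (permNerve k).obj (op n))
    (r : ∀ i, (permNerve (j i)).obj (op n)) : (permNerve (∑ i, j i)).obj (op n) :=
  permSimplex fun a => permγ j (s.obj a).as fun i => ((r i).obj a).as

theorem levelNatural_permγSimplex {k : ℕ} (j : Fin k → ℕ) :
    Realization.LevelNatural (permγSimplex j) := fun _ _ _ => rfl

theorem prodMap_permγSimplex {k : ℕ} (j : Fin k → ℕ) (n : SimplexCategory)
    (σ : Fin (n.len + 1) → Perm (Fin k)) (τ : ∀ s, Fin (n.len + 1) → Perm (Fin (j s)))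
    (t : stdSimplex ℝ (Fin (n.len + 1))) :
    Realization.prodMap (permγSimplex j) (permPoint n σ t) (fun s => permPoint n (τ s) t) =
      permPoint n (fun a => permγ j (σ a) fun s => τ s a) t :=
  Realization.prodMap_point (levelNatural_permγSimplex j) n _ _ t

theorem uCompactlyGeneratedSpace_permNerve (k : ℕ) (n : SimplexCategory) :
    UCompactlyGeneratedSpace.{u} ((permNerve k).obj (op n)) := inferInstance

theorem continuous_permγSimplex {k : ℕ} (j : Fin k → ℕ) (n : SimplexCategory) {K : Type*}
    [TopologicalSpace K] {z₀ : K → (permNerve k).obj (op n)}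
    {z : ∀ i, K → (permNerve (j i)).obj (op n)} (hz₀ : Continuous z₀)
    (hz : ∀ i, Continuous (z i)) : Continuous fun x => permγSimplex j n (z₀ x) fun i => z i x := by
  refine continuous_def.2 fun U _ => ?_
  exact (isOpen_discrete {p : (permNerve k).obj (op n) × ∀ i, (permNerve (j i)).obj (op n) |
    permγSimplex j n p.1 p.2 ∈ U}).preimage (hz₀.prodMk (continuous_pi hz))

theorem continuous_prodMap_permγSimplex {k : ℕ} (j : Fin k → ℕ) (K : Type) [TopologicalSpace K]
    [CompactSpace K] [T2Space K] (c : K → BarrattEcclesSpace k)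
    (d : ∀ i, K → BarrattEcclesSpace (j i)) (hc : Continuous c) (hd : ∀ i, Continuous (d i)) :
    Continuous fun x => Realization.prodMap (permγSimplex j) (c x) fun i => d i x := by
  have h := @Realization.continuous_prodMap.{0, 0, 0} k (permNerve k) (fun i => permNerve (j i))
    (permNerve (∑ i, j i)) (uCompactlyGeneratedSpace_permNerve k)
    (fun i => uCompactlyGeneratedSpace_permNerve (j i)) (permγSimplex j)
    (levelNatural_permγSimplex j)
  have h' := h fun n K _ _ _ z₀ z hz₀ hz => continuous_permγSimplex j n hz₀ hz
  exact h' K c d hc hd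

theorem kContinuous_prodMap_permγSimplex {k : ℕ} (j : Fin k → ℕ) :
    KContinuous fun p : BarrattEcclesSpace k × (∀ s, BarrattEcclesSpace (j s)) =>
      Realization.prodMap (permγSimplex j) p.1 p.2 :=
  kContinuous_iff.2 fun K _ _ _ a ha =>
    continuous_prodMap_permγSimplex j K (fun x => (a x).1) (fun i x => (a x).2 i)
      (continuous_fst.comp ha) fun i => (continuous_apply i).comp (continuous_snd.comp ha)

/-- A constant simplex is degenerate. Thus the operad unit, a vertex, can be represented in whatever
dimension and at whatever `t` the other points require. -/
theorem permPoint_const {j : ℕ} (n : SimplexCategory) (σ : Perm (Fin j))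
    (t : stdSimplex ℝ (Fin (n.len + 1))) :
    permPoint n (fun _ => σ) t = permPoint (.mk 0) (fun _ => σ) default :=
  (permPoint_map (m := n) (n := .mk 0) (simplexHom (fun _ => 0) monotone_const) (fun _ => σ) t).trans
    (congrArg (permPoint (.mk 0) _) (Subsingleton.elim (α := stdSimplex ℝ (Fin 1)) _ _))

/-- The Barratt–Eccles operad. -/
def barrattEccles : OperadStructure BarrattEcclesSpace where
  compactlyGenerated n := Realization.compactlyGeneratedSpace (W := permNerve n)
  act {m n} e := Realization.map (permNerveMap (permAct e))
  act_continuous e := Realization.continuous_map _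
  act_refl {n} c := by
    obtain ⟨N, σ, t, h⟩ := exists_permPoint fun _ : Unit => c
    rw [h ()]
    simp only [map_permNerveMap, permAct_refl]
  act_trans e e' c := by
    obtain ⟨N, σ, t, h⟩ := exists_permPoint fun _ : Unit => c
    rw [h ()]
    simp only [map_permNerveMap, permAct_trans]
  one := ClassifyingSpace.mk (n := 0) (permSimplex fun _ => 1) default
  γ j c d := Realization.prodMap (permγSimplex j) c d
  γ_continuous {k} j := kContinuous_prodMap_permγSimplex j
  γ_assoc {k} j i c d e := by
    -- One index type for all points involved gives them a common dimension and a common `t`; the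
    -- identity is then that of permutations at each vertex.
    obtain ⟨n, σ, t, h⟩ := exists_permPoint (ι := Unit ⊕ Fin k ⊕ Fin (∑ s, j s))
      (j := Sum.elim (fun _ => k) (Sum.elim j i)) (Sum.rec (fun _ => c) (Sum.rec d e))
    obtain rfl : c = permPoint n (σ (.inl ())) t := h (.inl ())
    obtain rfl : d = fun s => permPoint n (σ (.inr (.inl s))) t := funext fun s => h (.inr (.inl s))
    obtain rfl : e = fun s => permPoint n (σ (.inr (.inr s))) t := funext fun s => h (.inr (.inr s))
    refine (congrArg (fun x => Realization.prodMap (permγSimplex i) x _)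
      (prodMap_permγSimplex j n _ _ t)).trans ?_
    refine (prodMap_permγSimplex i n _ _ t).trans ?_
    refine Eq.trans ?_ (congrArg _ (congrArg (Realization.prodMap _ _)
      (funext fun s => (prodMap_permγSimplex _ n _ _ t).symm)))
    refine Eq.trans ?_ (congrArg _ (prodMap_permγSimplex _ n _ _ t).symm)
    exact congrArg (permPoint n · t) (funext fun a => permγ_assoc j i _ _ _)
  one_γ j d := by
    obtain ⟨n, σ, t, h⟩ := exists_permPoint d
    obtain rfl : d = fun s => permPoint n (σ s) t := funext h
    have h1 : (ClassifyingSpace.mk (n := 0) (permSimplex fun _ => 1) default :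
        BarrattEcclesSpace 1) = permPoint n (fun _ => 1) t := (permPoint_const n 1 t).symm
    rw [h1, prodMap_permγSimplex]
    exact congrArg (permPoint n · t) (funext fun a => one_permγ j _)
  γ_one {k} c := by
    obtain ⟨n, σ, t, h⟩ := exists_permPoint fun _ : Unit => c
    obtain rfl := h ()
    have h1 : (ClassifyingSpace.mk (n := 0) (permSimplex fun _ => 1) default :
        BarrattEcclesSpace 1) = permPoint n (fun _ => 1) t := (permPoint_const n 1 t).symm
    rw [h1]
    refine (prodMap_permγSimplex (fun _ : Fin k => 1) n _ (fun _ _ => 1) t).trans ?_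
    exact congrArg (permPoint n · t) (funext fun a => permγ_one _)
  act_γ {k l} e j c d := by
    obtain ⟨n, σ, t, h⟩ := exists_permPoint (ι := Unit ⊕ Fin k)
      (j := Sum.elim (fun _ => l) j) (Sum.rec (fun _ => c) d)
    obtain rfl : c = permPoint n (σ (.inl ())) t := h (.inl ())
    obtain rfl : d = fun s => permPoint n (σ (.inr s)) t := funext fun s => h (.inr s)
    refine (prodMap_permγSimplex j n (fun a => permAct e _) _ t).trans ?_
    refine Eq.trans ?_ (congrArg _ (prodMap_permγSimplex _ n _ _ t).symm)
    exact congrArg (permPoint n · t) (funext fun a => permAct_permγ e j _ _)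
  γ_act {k} i j e c d := by
    obtain ⟨n, σ, t, h⟩ := exists_permPoint (ι := Unit ⊕ Fin k)
      (j := Sum.elim (fun _ => k) j) (Sum.rec (fun _ => c) d)
    obtain rfl : c = permPoint n (σ (.inl ())) t := h (.inl ())
    obtain rfl : d = fun s => permPoint n (σ (.inr s)) t := funext fun s => h (.inr s)
    refine (prodMap_permγSimplex i n _ (fun s a => permAct (e s) _) t).trans ?_
    refine Eq.trans ?_ (congrArg _ (prodMap_permγSimplex _ n _ _ t).symm)
    exact congrArg (permPoint n · t) (funext fun a => permγ_permAct i j e _ _)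

theorem isBarrattEccles_barrattEccles : IsBarrattEccles barrattEccles where
  act_eq {_ _ n} e σ t := map_permNerveMap (permAct e) (.mk n) σ t
  one_eq := rfl
  γ_eq {_ n} j σ τ t := prodMap_permγSimplex j (.mk n) σ τ t

/-! ### The Barratt–Eccles operad is an `E_∞`-operad -/

/-- The point of the join of the new vertex `0` with `Δⁿ`. -/
def conePoint {n : ℕ} (x : unitInterval) (t : stdSimplex ℝ (Fin (n + 1))) :
    stdSimplex ℝ (Fin (n + 1 + 1)) :=
  ⟨Fin.cons x fun i => (1 - x) * t i, Fin.cases x.2.1 fun i =>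
    mul_nonneg (sub_nonneg.2 x.2.2) (stdSimplex.zero_le t i), by
      rw [Fin.sum_univ_succ]
      simp only [Fin.cons_zero, Fin.cons_succ]
      rw [← Finset.mul_sum, stdSimplex.sum_eq_one]
      ring⟩

theorem continuous_conePoint (n : ℕ) :
    Continuous fun p : unitInterval × stdSimplex ℝ (Fin (n + 1)) => conePoint p.1 p.2 := by
  refine Continuous.subtype_mk (continuous_pi fun i => ?_) _
  induction i using Fin.cases with
  | zero => exact continuous_subtype_val.comp continuous_fst
  | succ i =>
    exact (continuous_const.sub (continuous_subtype_val.comp continuous_fst)).mul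
      ((continuous_apply i).comp (continuous_subtype_val.comp continuous_snd))

/-- The extension of a morphism of the simplex category to the cones. -/
def coneHom {m n : SimplexCategory} (f : m ⟶ n) :
    SimplexCategory.mk (m.len + 1) ⟶ SimplexCategory.mk (n.len + 1) :=
  simplexHom (m := .mk (m.len + 1)) (n := .mk (n.len + 1))
    (Fin.cons 0 fun i : Fin (m.len + 1) => (f i).succ) fun x y h => by
      induction x using Fin.cases with
      | zero => exact Fin.zero_le _
      | succ x =>
        induction y using Fin.cases with
        | zero => simp at h
        | succ y =>
          simp only [Fin.cons_succ, Fin.succ_le_succ_iff]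
          exact f.toOrderHom.monotone (Fin.succ_le_succ_iff.1 h)

/-- Naturality of the cone, which makes `permContraction` respect the gluing relation. -/
theorem map_coneHom {m n : SimplexCategory} (f : m ⟶ n) (x : unitInterval)
    (t : stdSimplex ℝ (Fin (m.len + 1))) :
    stdSimplex.map (coneHom f) (conePoint x t) = conePoint x (stdSimplex.map f t) := by
  ext i
  rw [stdSimplex_map_apply]
  refine (Fin.sum_univ_succ _).trans ?_
  change (if (0 : Fin (n.len + 1 + 1)) = i then (x : ℝ) else 0) +
    (∑ y : Fin (m.len + 1), if (f y).succ = i then (1 - x : ℝ) * t y else 0) =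
    Fin.cons (α := fun _ => ℝ) (x : ℝ) (fun i => (1 - x) * stdSimplex.map f t i) i
  induction i using Fin.cases with
  | zero => simp [Fin.succ_ne_zero]
  | succ i =>
    simp only [(Fin.succ_ne_zero i).symm, Fin.succ_inj, if_false, zero_add, Fin.cons_succ]
    rw [stdSimplex_map_apply, Finset.mul_sum]
    exact Finset.sum_congr rfl fun y _ => by split_ifs <;> simp

/-- The contraction of `B Σ̃ⱼ`. -/
def permContraction (j : ℕ) : BarrattEcclesSpace j → unitInterval → BarrattEcclesSpace j :=
  Quot.lift (fun a x => permPoint (.mk (a.1.len + 1))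
      -- Any sequence of permutations spans a simplex of `Σ̃ⱼ`, so a vertex can be prepended freely;
      -- the choice of `1` is immaterial.
      (Fin.cons 1 fun i : Fin (a.1.len + 1) => (a.2.1.obj i).as) (conePoint x a.2.2)) fun _ _ h => by
    obtain ⟨f, z, t⟩ := h
    funext x
    dsimp only
    rw [← map_coneHom, ← permPoint_map]
    congr 1
    funext i
    change Fin _ at i
    induction i using Fin.cases with
    | zero => rfl
    | succ i => rfl

theorem permContraction_permPoint {j : ℕ} (n : SimplexCategory)
    (σ : Fin (n.len + 1) → Perm (Fin j)) (t : stdSimplex ℝ (Fin (n.len + 1))) (x : unitInterval) :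
    permContraction j (permPoint n σ t) x =
      permPoint (.mk (n.len + 1)) (Fin.cons 1 σ) (conePoint x t) := rfl

/-- The interval is locally compact, so its product with the quotient map is a quotient map and
continuity is checked on each `Zₙ × Δⁿ × I`. -/
theorem continuous_permContraction (j : ℕ) :
    Continuous fun p : BarrattEcclesSpace j × unitInterval => permContraction j p.1 p.2 := by
  refine (Realization.isQuotientMap_mk (Z := permNerve j)).continuous_lift_prod_left ?_
  refine Homeomorph.sigmaProdDistrib.symm.isQuotientMap.continuous_iff.2
    (continuous_sigma fun n => ?_)
  have : Continuous fun z : (permNerve j).obj (op n) =>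
      (show (permNerve j).obj (op (.mk (n.len + 1))) from
        permSimplex (Fin.cons 1 fun i : Fin (n.len + 1) => (z.obj i).as)) := continuous_of_discreteTopology
  exact (Realization.continuous_point (Z := permNerve j) (.mk (n.len + 1))).comp
    ((this.comp (continuous_fst.comp continuous_fst)).prodMk ((continuous_conePoint n.len).comp
      (continuous_snd.prodMk (continuous_snd.comp continuous_fst))))

/-- At time `0` the point lies on the face opposite the cone vertex, which gives the identity; at
time `1` it is the cone vertex, which gives the constant map. -/
theorem conePoint_zero (n : SimplexCategory) (t : stdSimplex ℝ (Fin (n.len + 1))) :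
    conePoint 0 t = stdSimplex.map (simplexHom (m := n) (n := .mk (n.len + 1)) Fin.succ
      (Fin.strictMono_succ.monotone)) t := by
  ext i
  rw [stdSimplex_map_apply]
  change Fin.cons (α := fun _ => ℝ) ((0 : unitInterval) : ℝ) _ i = ∑ x : Fin (n.len + 1),
    if x.succ = i then t x else 0
  induction i using Fin.cases with
  | zero => simp [Fin.succ_ne_zero]
  | succ i => simp

theorem conePoint_one (n : SimplexCategory) (t : stdSimplex ℝ (Fin (n.len + 1))) :
    conePoint 1 t = stdSimplex.map (simplexHom (m := .mk 0) (n := .mk (n.len + 1)) (fun _ => 0)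
      monotone_const) default := by
  ext i
  rw [stdSimplex_map_apply]
  change Fin.cons (α := fun _ => ℝ) ((1 : unitInterval) : ℝ) _ i = ∑ x : Fin 1,
    if (0 : Fin (n.len + 2)) = i then (default : stdSimplex ℝ (Fin 1)) x else 0
  induction i using Fin.cases with
  | zero => simp
  | succ i => simp [(Fin.succ_ne_zero i).symm]

theorem contractibleSpace_barrattEcclesSpace (j : ℕ) : ContractibleSpace (BarrattEcclesSpace j) := by
  refine (contractible_iff_id_nullhomotopic _).2 ⟨permPoint (.mk 0) (fun _ => 1) default, ⟨?_⟩⟩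
  refine ⟨⟨fun p => permContraction j p.2 p.1,
    (continuous_permContraction j).comp continuous_swap⟩, fun c => ?_, fun c => ?_⟩
  · obtain ⟨n, σ, t, h⟩ := exists_permPoint fun _ : Unit => c
    obtain rfl := h ()
    refine (permContraction_permPoint n (σ ()) t 0).trans ?_
    rw [conePoint_zero, ← permPoint_map]
    rfl
  · obtain ⟨n, σ, t, h⟩ := exists_permPoint fun _ : Unit => c
    obtain rfl := h ()
    refine (permContraction_permPoint n (σ ()) t 1).trans ?_
    rw [conePoint_one, ← permPoint_map]
    rfl

theorem isEInfinity_barrattEccles : barrattEccles.IsEInfinity where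
  zero := ⟨⟨⟨permPoint (.mk 0) (fun _ => 1) default⟩, fun c => by
    obtain ⟨n, σ, t, h⟩ := exists_permPoint fun _ : Unit => c
    obtain rfl := h ()
    rw [Subsingleton.elim (σ ()) fun _ => 1, permPoint_const]
    rfl⟩⟩
  contractible := contractibleSpace_barrattEcclesSpace
  free n σ c h := by
    obtain ⟨N, τ, t, hc⟩ := exists_permPoint fun _ : Unit => c
    obtain rfl := hc ()
    obtain ⟨L, p, f, g, hf, hg, hfg⟩ := Realization.point_eq_point_iff.1 h
    -- Both operators send `p` to the same `t`, so they agree on the face that has `p` in its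
    -- interior. Comparing the simplices at one vertex of that face gives `τ ∘ σ = τ`.
    obtain ⟨M, q, d, hq, rfl⟩ := exists_pos_face L p
    have hd : d ≫ f = d ≫ g := hom_ext_of_pos q hq _ _ (by
      rw [map_comp_simplex, map_comp_simplex, hf, hg])
    have hd0 : f (d 0) = g (d 0) := congrArg (fun k : M ⟶ N => k 0) hd
    have h0 : permAct σ (τ () (f (d 0))) = τ () (g (d 0)) :=
      congrArg (fun s : ComposableArrows (Codiscrete (Perm (Fin n))) L.len => (s.obj (d 0)).as) hfg
    rw [hd0] at h0
    ext x : 1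
    exact (τ () (g (d 0))).injective (congrArg (fun ρ : Perm (Fin n) => ρ x) h0)

/-! ### Morphisms of `𝕀` as functions of natural numbers -/

namespace FinInj

/-- The function on natural numbers underlying a morphism of `𝕀`. -/
def natMap {m n : FinInj} (f : m ⟶ n) (x : ℕ) : ℕ :=
  if h : x < m.card then f.emb ⟨x, h⟩ else 0

theorem natMap_of_lt {m n : FinInj} (f : m ⟶ n) {x : ℕ} (h : x < m.card) :
    natMap f x = f.emb ⟨x, h⟩ := dif_pos h

theorem natMap_val {m n : FinInj} (f : m ⟶ n) (i : Fin m.card) : natMap f i = f.emb i :=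
  dif_pos i.2

theorem natMap_lt {m n : FinInj} (f : m ⟶ n) {x : ℕ} (h : x < m.card) : natMap f x < n.card := by
  rw [natMap_of_lt f h]
  exact (f.emb _).2

theorem hom_ext_natMap {m n : FinInj} {f g : m ⟶ n} (h : ∀ x < m.card, natMap f x = natMap g x) :
    f = g :=
  hom_ext fun i => Fin.ext (by rw [← natMap_val, ← natMap_val, h i i.2])

theorem arrow_ext {m m' n n' : FinInj} {f : m ⟶ n} {f' : m' ⟶ n'} (hm : m.card = m'.card)
    (hn : n.card = n'.card) (h : ∀ x < m.card, natMap f x = natMap f' x) :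
    Arrow.mk f = Arrow.mk f' := by
  obtain rfl : m = m' := FinInj.ext hm
  obtain rfl : n = n' := FinInj.ext hn
  rw [hom_ext_natMap h]

theorem natMap_comp {l m n : FinInj} (f : l ⟶ m) (g : m ⟶ n) {x : ℕ} (h : x < l.card) :
    natMap (f ≫ g) x = natMap g (natMap f x) := by
  rw [natMap_of_lt _ h, natMap_of_lt f h, natMap_val]
  rfl

theorem natMap_id (m : FinInj) {x : ℕ} (h : x < m.card) : natMap (𝟙 m) x = x := by
  rw [natMap_of_lt _ h]
  rfl

theorem natMap_eqToHom {m n : FinInj} (e : m = n) {x : ℕ} (h : x < m.card) :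
    natMap (eqToHom e) x = x := by
  rw [natMap_of_lt _ h, eqToHom_val]

theorem natMap_inv_of_hom {m n : FinInj} (e : m ≅ n) {x y : ℕ} (h : x < m.card)
    (hxy : natMap e.hom x = y) : natMap e.inv y = x := by
  rw [← hxy, ← natMap_comp _ _ h, e.hom_inv_id, natMap_id _ h]

theorem natMap_tensorHom_left {m m' n n' : FinInj} (f : m ⟶ m') (g : n ⟶ n') {x : ℕ}
    (h : x < m.card) : natMap (f ⊗ₘ g) x = natMap f x := by
  have := natMap_val (f ⊗ₘ g) (inl m n ⟨x, h⟩)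
  rw [tensorHom_inl] at this
  exact this.trans (natMap_of_lt f h).symm

theorem natMap_tensorHom_right {m m' n n' : FinInj} (f : m ⟶ m') (g : n ⟶ n') {x : ℕ}
    (h : x < n.card) : natMap (f ⊗ₘ g) (m.card + x) = m'.card + natMap g x := by
  have := natMap_val (f ⊗ₘ g) (inr m n ⟨x, h⟩)
  rw [tensorHom_inr] at this
  exact this.trans (by rw [natMap_of_lt g h]; rfl)

theorem natMap_whiskerLeft_left (m : FinInj) {n n' : FinInj} (g : n ⟶ n') {x : ℕ}
    (h : x < m.card) : natMap (m ◁ g) x = x := by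
  rw [← id_tensorHom, natMap_tensorHom_left _ _ h, natMap_id _ h]

theorem natMap_whiskerLeft_right (m : FinInj) {n n' : FinInj} (g : n ⟶ n') {x : ℕ}
    (h : x < n.card) : natMap (m ◁ g) (m.card + x) = m.card + natMap g x := by
  rw [← id_tensorHom, natMap_tensorHom_right _ _ h]

theorem natMap_whiskerRight_left {m m' : FinInj} (f : m ⟶ m') (n : FinInj) {x : ℕ}
    (h : x < m.card) : natMap (f ▷ n) x = natMap f x := by
  rw [← tensorHom_id, natMap_tensorHom_left _ _ h]

theorem natMap_whiskerRight_right {m m' : FinInj} (f : m ⟶ m') (n : FinInj) {x : ℕ}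
    (h : x < n.card) : natMap (f ▷ n) (m.card + x) = m'.card + x := by
  rw [← tensorHom_id, natMap_tensorHom_right _ _ h, natMap_id _ h]

theorem natMap_braiding_left (m n : FinInj) {x : ℕ} (h : x < m.card) :
    natMap (β_ m n).hom x = n.card + x :=
  (natMap_val (β_ m n).hom (inl m n ⟨x, h⟩)).trans
    (congrArg Fin.val (shuffle_inl m n ⟨x, h⟩))

theorem natMap_braiding_right (m n : FinInj) {x : ℕ} (h : x < n.card) :
    natMap (β_ m n).hom (m.card + x) = x :=
  (natMap_val (β_ m n).hom (inr m n ⟨x, h⟩)).trans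
    (congrArg Fin.val (shuffle_inr m n ⟨x, h⟩))

theorem natMap_associator_hom (l m n : FinInj) {x : ℕ} (h : x < l.card + m.card + n.card) :
    natMap (α_ l m n).hom x = x := by
  rw [natMap_of_lt (α_ l m n).hom h]
  rfl

theorem natMap_associator_inv (l m n : FinInj) {x : ℕ} (h : x < l.card + (m.card + n.card)) :
    natMap (α_ l m n).inv x = x := by
  rw [natMap_of_lt (α_ l m n).inv h]
  rfl

/-- The symmetry exchanging the first two of three factors. -/
def swapFirst (a b r : FinInj) : a ⊗ (b ⊗ r) ⟶ b ⊗ (a ⊗ r) :=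
  (α_ a b r).inv ≫ (β_ a b).hom ▷ r ≫ (α_ b a r).hom

/-- The associators are the identity on letters, so only the braiding is visible. -/
theorem natMap_swapFirst (a b r : FinInj) {x : ℕ} (h : x < a.card + (b.card + r.card)) :
    natMap (swapFirst a b r) x = natMap ((β_ a b).hom ▷ r) x := by
  have h' : natMap (α_ a b r).inv x = x := natMap_associator_inv a b r h
  have h'' : x < ((a ⊗ b) ⊗ r).card := by rw [← h']; exact natMap_lt _ h
  rw [swapFirst, natMap_comp _ _ h, natMap_comp _ _ (natMap_lt _ h), h',
    natMap_associator_hom _ _ _ (natMap_lt _ h'')]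

theorem natMap_swapFirst_fst (a b r : FinInj) {x : ℕ} (h : x < a.card) :
    natMap (swapFirst a b r) x = b.card + x := by
  rw [natMap_swapFirst _ _ _ (by omega),
    natMap_whiskerRight_left _ _ (h.trans_le (Nat.le_add_right a.card b.card)),
    natMap_braiding_left _ _ h]

theorem natMap_swapFirst_snd (a b r : FinInj) {x : ℕ} (h : x < b.card) :
    natMap (swapFirst a b r) (a.card + x) = x := by
  rw [natMap_swapFirst _ _ _ (by omega),
    natMap_whiskerRight_left _ _ (Nat.add_lt_add_left h a.card),
    natMap_braiding_right _ _ h]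

theorem natMap_swapFirst_trd (a b r : FinInj) {x : ℕ} (h : x < r.card) :
    natMap (swapFirst a b r) (a.card + (b.card + x)) = b.card + (a.card + x) := by
  rw [natMap_swapFirst _ _ _ (by omega), ← add_assoc]
  refine (natMap_whiskerRight_right (β_ a b).hom r h).trans ?_
  rw [← add_assoc]
  rfl

/-- The morphism by which `moveToFront` is defined recursively. -/
def moveStep {a b r s t : FinInj} (f : t ⟶ b ⊗ r) (e : a ⊗ r ⟶ s) : a ⊗ t ⟶ b ⊗ s :=
  a ◁ f ≫ swapFirst a b r ≫ b ◁ e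

section

variable {a b r s t : FinInj} (f : t ⟶ b ⊗ r) (e : a ⊗ r ⟶ s)

theorem natMap_moveStep {x : ℕ} (hx : x < a.card + t.card) :
    natMap (moveStep f e) x = natMap (b ◁ e) (natMap (swapFirst a b r) (natMap (a ◁ f) x)) := by
  rw [moveStep, natMap_comp _ _ hx, natMap_comp _ _ (natMap_lt _ hx)]

/-- The next three lemmas follow the letters of `a`, of `b` and of `r`, where `f` presents `t` as `b
⊗ r`. The hypothesis `he` stands for the `eqToHom` that ends the recursion of `moveToFront`. -/
theorem natMap_moveStep_fst (he : ∀ x < a.card + r.card, natMap e x = x) {x : ℕ}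
    (hx : x < a.card) : natMap (moveStep f e) x = b.card + x := by
  have hx' : x < (a ⊗ r).card := hx.trans_le (Nat.le_add_right _ _)
  rw [natMap_moveStep f e (hx.trans_le (Nat.le_add_right _ _)), natMap_whiskerLeft_left _ _ hx,
    natMap_swapFirst_fst _ _ _ hx, natMap_whiskerLeft_right _ _ hx', he _ hx']

theorem natMap_moveStep_snd {x : ℕ} (hx : x < t.card) (hf : natMap f x < b.card) :
    natMap (moveStep f e) (a.card + x) = natMap f x := by
  rw [natMap_moveStep f e (Nat.add_lt_add_left hx _), natMap_whiskerLeft_right _ _ hx,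
    natMap_swapFirst_snd _ _ _ hf, natMap_whiskerLeft_left _ _ hf]

theorem natMap_moveStep_trd (he : ∀ x < a.card + r.card, natMap e x = x) {x y : ℕ}
    (hx : x < t.card) (hy : y < r.card) (hf : natMap f x = b.card + y) :
    natMap (moveStep f e) (a.card + x) = b.card + (a.card + y) := by
  have hy' : a.card + y < (a ⊗ r).card := Nat.add_lt_add_left hy _
  rw [natMap_moveStep f e (Nat.add_lt_add_left hx _), natMap_whiskerLeft_right _ _ hx, hf,
    natMap_swapFirst_trd _ _ _ hy, natMap_whiskerLeft_right _ _ hy', he _ hy']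

end

end FinInj

/-! ### Positions of blocks -/

/-- The number of letters in the blocks that precede the block `p`. -/
def blockOffset {j : ℕ} (n : Fin j → ℕ) (p : Fin j) : ℕ := ∑ i, if i < p then n i else 0

@[simp]
theorem blockOffset_zero {j : ℕ} (n : Fin (j + 1) → ℕ) : blockOffset n 0 = 0 := by
  simp [blockOffset]

@[simp]
theorem blockOffset_succ {j : ℕ} (n : Fin (j + 1) → ℕ) (p : Fin j) :
    blockOffset n p.succ = n 0 + blockOffset (fun i => n i.succ) p := by
  simp [blockOffset, Fin.sum_univ_succ]

theorem exists_blockOffset {j : ℕ} (n : Fin j → ℕ) {x : ℕ} (h : x < ∑ i, n i) :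
    ∃ p, ∃ q < n p, x = blockOffset n p + q := by
  obtain ⟨⟨p, q⟩, hpq⟩ := finSigmaFinEquiv.surjective (⟨x, h⟩ : Fin (∑ i, n i))
  refine ⟨p, q, q.2, ?_⟩
  have := congrArg Fin.val hpq
  rw [finSigmaFinEquiv_val] at this
  exact this.symm

theorem blockOffset_add_lt {j : ℕ} (n : Fin j → ℕ) (p : Fin j) {q : ℕ} (h : q < n p) :
    blockOffset n p + q < ∑ i, n i := by
  have := (finSigmaFinEquiv (n := n) ⟨p, ⟨q, h⟩⟩).2
  rwa [finSigmaFinEquiv_val] at this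

theorem blockOffset_symm {j : ℕ} (σ : Perm (Fin j)) (n : Fin j → ℕ) (i : Fin j) :
    blockOffset (fun a => n (σ.symm a)) (σ i) = ∑ y, if σ y < σ i then n y else 0 := by
  rw [blockOffset, ← Equiv.sum_comp σ]
  simp

/-- Since `permγ` orders blocks lexicographically, the letters before block `(s, q)` are those in
outer blocks before `s` and those in outer block `s` but in inner blocks before `q`. -/
theorem blockOffset_permγ {k : ℕ} (j : Fin k → ℕ) (σ : Perm (Fin k)) (τ : ∀ s, Perm (Fin (j s)))
    (n : Fin (∑ s, j s) → ℕ) (s : Fin k) (q : Fin (j s)) :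
    blockOffset (fun t => n ((permγ j σ τ).symm t)) (permγ j σ τ (finSigmaFinEquiv ⟨s, q⟩)) =
      blockOffset (fun a => ∑ r, n (finSigmaFinEquiv ⟨σ.symm a, (τ _).symm r⟩)) (σ s) +
        blockOffset (fun r => n (finSigmaFinEquiv ⟨s, (τ s).symm r⟩)) (τ s q) := by
  rw [blockOffset_symm, blockOffset_symm σ
    (fun a => ∑ r, n (finSigmaFinEquiv ⟨a, (τ a).symm r⟩)), blockOffset_symm (τ s)
    (fun r => n (finSigmaFinEquiv ⟨s, r⟩)), ← Equiv.sum_comp finSigmaFinEquiv, Fintype.sum_sigma]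
  simp_rw [permγ_lt_iff]
  have h : ∀ a, ∑ r, n (finSigmaFinEquiv ⟨a, (τ a).symm r⟩) = ∑ r, n (finSigmaFinEquiv ⟨a, r⟩) :=
    fun a => Equiv.sum_comp (τ a).symm fun r => n (finSigmaFinEquiv ⟨a, r⟩)
  simp_rw [h]
  have := sum_lex (fun s (q : Fin (j s)) => n (finSigmaFinEquiv ⟨s, q⟩)) (σ · < σ s) s
    (lt_irrefl _) (fun s' (q' : Fin (j s')) => (τ s' q' : ℕ) < τ s q)
  simpa using this

/-! ### The Barratt–Eccles functors of `𝕀 ⋉ X` -/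

open FinInj

variable {X : CommIMonoid.{u}}

theorem card_bigTensor : ∀ {j : ℕ} (c : Fin j → X.Trans),
    ((bigTensor j).obj c).1.card = ∑ i, (c i).1.card
  | 0, _ => rfl
  | j + 1, c => by
    rw [Fin.sum_univ_succ, ← card_bigTensor fun i => c i.succ]
    rfl

theorem natMap_bigTensor : ∀ {j : ℕ} {c c' : Fin j → X.Trans} (f : c ⟶ c') (p : Fin j) {q : ℕ}
    (_ : q < (c p).1.card), natMap ((bigTensor j).map f).val
      (blockOffset (fun i => (c i).1.card) p + q) =
        blockOffset (fun i => (c' i).1.card) p + natMap (f p).val q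
  | j + 1, c, c', f, p, q, hq => by
    change natMap ((f 0).val ⊗ₘ ((bigTensor j).map fun i => f i.succ).val) _ = _
    induction p using Fin.cases with
    | zero => simp [natMap_tensorHom_left _ _ hq]
    | succ p =>
      have h := natMap_bigTensor (fun i => f i.succ : (fun i => c i.succ) ⟶ fun i => c' i.succ) p hq
      have hlt := blockOffset_add_lt (fun i => (c i.succ).1.card) p hq
      rw [← card_bigTensor] at hlt
      rw [blockOffset_succ, blockOffset_succ, add_assoc, natMap_tensorHom_right _ _ hlt, h,
        add_assoc]

/-- Block `p` lands at the start and the other blocks follow in their old order. Since every letter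
lies in one of these blocks, this determines the isomorphism. -/
theorem natMap_moveToFront : ∀ {j : ℕ} (p : Fin (j + 1)) (c : Fin (j + 1) → X.Trans),
    (∀ q < (c p).1.card, natMap (moveToFront p c).hom.val
      (blockOffset (fun i => (c i).1.card) p + q) = q) ∧
    (∀ i, ∀ q < (c (p.succAbove i)).1.card, natMap (moveToFront p c).hom.val
      (blockOffset (fun i => (c i).1.card) (p.succAbove i) + q) =
        (c p).1.card + (blockOffset (fun i => (c (p.succAbove i)).1.card) i + q))
  | j, ⟨0, _⟩, c => by
    have h0 : ∀ x < ∑ i, (c i).1.card, natMap (moveToFront 0 c).hom.val x = x := fun x hx => by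
      rw [← card_bigTensor] at hx
      cases j <;> exact natMap_id _ hx
    change (∀ q < (c 0).1.card, natMap (moveToFront 0 c).hom.val
        (blockOffset (fun i => (c i).1.card) 0 + q) = q) ∧
      (∀ i, ∀ q < (c ((0 : Fin (j + 1)).succAbove i)).1.card, natMap (moveToFront 0 c).hom.val
        (blockOffset (fun i => (c i).1.card) ((0 : Fin (j + 1)).succAbove i) + q) =
          (c 0).1.card + (blockOffset (fun i => (c ((0 : Fin (j + 1)).succAbove i)).1.card) i + q))
    refine ⟨fun q hq => ?_, fun i q hq => ?_⟩
    · rw [h0 _ (blockOffset_add_lt _ _ hq), blockOffset_zero, zero_add]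
    · rw [h0 _ (blockOffset_add_lt _ _ hq)]
      simp [add_assoc]
  | j + 1, ⟨q + 1, hq⟩, c => by
    set p : Fin (j + 1) := ⟨q, Nat.lt_of_succ_lt_succ hq⟩ with hp
    have hp' : (⟨q + 1, hq⟩ : Fin (j + 1 + 1)) = p.succ := rfl
    rw [hp']
    obtain ⟨ih₁, ih₂⟩ := natMap_moveToFront p fun i => c i.succ
    have hobj : (c 0 ⊗ (bigTensor j).obj fun i => c (p.succAbove i).succ) =
        (bigTensor (j + 1)).obj fun i => c (p.succ.succAbove i) :=
      congrArg₂ (fun (a : X.Trans) (b : Fin j → X.Trans) => a ⊗ (bigTensor j).obj b)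
          (congrArg c (Fin.succ_succAbove_zero p).symm)
          (funext fun i => congrArg c (Fin.succ_succAbove_succ p i).symm)
    -- Rebracketing the recursive definition isolates the exchange of the first block with block
    -- `p.succ`, the rest of which is covered by the induction hypothesis.
    have hval : (moveToFront p.succ c).hom.val =
        moveStep (moveToFront p fun i => c i.succ).hom.val (eqToHom hobj).val := by
      rw [moveStep, swapFirst, Category.assoc, Category.assoc]
      rfl
    have he : ∀ x < (c 0).1.card + ((bigTensor j).obj fun i => c (p.succAbove i).succ).1.card,
        natMap (eqToHom hobj).val x = x := fun x hx => by
      rw [Translation.eqToHom_val]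
      exact natMap_eqToHom _ hx
    have hlt : ∀ (i : Fin (j + 1)) {q : ℕ}, q < (c i.succ).1.card →
        blockOffset (fun i => (c i.succ).1.card) i + q <
          ((bigTensor (j + 1)).obj fun i => c i.succ).1.card := fun i q hq => by
      rw [card_bigTensor]
      exact blockOffset_add_lt (fun i => (c i.succ).1.card) i hq
    rw [hval]
    refine ⟨fun q hq => ?_, fun i q hq => ?_⟩
    · rw [blockOffset_succ, add_assoc (c 0).1.card]
      exact (natMap_moveStep_snd _ _ (hlt p hq) ((ih₁ q hq).trans_lt hq)).trans (ih₁ q hq)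
    · induction i using Fin.cases with
      | zero =>
        rw [Fin.succ_succAbove_zero] at hq ⊢
        rw [blockOffset_zero, blockOffset_zero, zero_add]
        exact natMap_moveStep_fst _ _ he hq
      | succ i =>
        rw [Fin.succ_succAbove_succ] at hq ⊢
        have hr : blockOffset (fun i => (c (p.succAbove i).succ).1.card) i + q <
            ((bigTensor j).obj fun i => c (p.succAbove i).succ).1.card := by
          rw [card_bigTensor]
          exact blockOffset_add_lt (fun i => (c (p.succAbove i).succ).1.card) i hq
        rw [blockOffset_succ, add_assoc (c 0).1.card]
        refine (natMap_moveStep_trd _ _ he (hlt _ hq) hr (ih₂ i q hq)).trans ?_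
        simp only [blockOffset_succ, Fin.succ_succAbove_zero, Fin.succ_succAbove_succ, add_assoc]

/-- Block `ρ i` ends at place `i`: for `i = 0` by `moveToFront`, and for the other places by
induction applied to `tailPerm ρ`. -/
theorem natMap_permIso : ∀ {j : ℕ} (ρ : Perm (Fin j)) (c : Fin j → X.Trans) (i : Fin j) {q : ℕ}
    (_ : q < (c (ρ i)).1.card), natMap (permIso ρ c).hom.val
      (blockOffset (fun i => (c i).1.card) (ρ i) + q) =
        blockOffset (fun i => (c (ρ i)).1.card) i + q
  | j + 1, ρ, c, i, q, hq => by
    obtain ⟨h₁, h₂⟩ := natMap_moveToFront (ρ 0) c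
    have hobj : ((bigTensor j).obj fun i => c ((ρ 0).succAbove (tailPerm ρ i))) =
        (bigTensor j).obj fun i => c (ρ i.succ) :=
      congrArg (bigTensor j).obj (funext fun i => congrArg c (succAbove_tailPerm ρ i))
    have hval : ∀ x < ((bigTensor (j + 1)).obj c).1.card, natMap (permIso ρ c).hom.val x =
        natMap ((c (ρ 0)).1 ◁ ((permIso (tailPerm ρ) fun i => c ((ρ 0).succAbove i)).hom.val ≫
          (eqToHom hobj).val)) (natMap (moveToFront (ρ 0) c).hom.val x) := fun x hx =>
      natMap_comp (moveToFront (ρ 0) c).hom.val ((c (ρ 0)).1 ◁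
        ((permIso (tailPerm ρ) fun i => c ((ρ 0).succAbove i)).hom.val ≫ (eqToHom hobj).val)) hx
    have hlt := blockOffset_add_lt (fun i => (c i).1.card) (ρ i) hq
    rw [← card_bigTensor] at hlt
    rw [hval _ hlt]
    induction i using Fin.cases with
    | zero => rw [h₁ q hq, natMap_whiskerLeft_left _ _ hq, blockOffset_zero, zero_add]
    | succ i =>
      have hi := succAbove_tailPerm ρ i
      have hq' : q < (c ((ρ 0).succAbove (tailPerm ρ i))).1.card := by rwa [hi]
      have hr := blockOffset_add_lt (fun i => (c ((ρ 0).succAbove i)).1.card) (tailPerm ρ i) hq'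
      rw [← card_bigTensor fun i => c ((ρ 0).succAbove i)] at hr
      rw [← hi, h₂ _ q hq', natMap_whiskerLeft_right _ _ hr, natMap_comp _ _ hr,
        Translation.eqToHom_val, natMap_eqToHom _ (natMap_lt _ hr),
        natMap_permIso (tailPerm ρ) (fun i => c ((ρ 0).succAbove i)) i hq', blockOffset_succ,
        add_assoc]
      simp only [succAbove_tailPerm]

/-- This takes the place of a coherence theorem. Block `i` sits at place `σ i` in the source and at
place `σ' i` in the target, and the morphism acts on its letters through `fᵢ`. -/
theorem natMap_barrattEcclesFunctor {j : ℕ} {p p' : Codiscrete (Perm (Fin j)) × (Fin j → X.Trans)}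
    (f : p ⟶ p') (i : Fin j) {q : ℕ} (hq : q < (p.2 i).1.card) :
    natMap ((barrattEcclesFunctor X.Trans j).map f).val
      (blockOffset (fun a => (p.2 (p.1.as.symm a)).1.card) (p.1.as i) + q) =
      blockOffset (fun a => (p'.2 (p'.1.as.symm a)).1.card) (p'.1.as i) +
        natMap (f.2 i).val q := by
  have key : ∀ (r : Codiscrete (Perm (Fin j)) × (Fin j → X.Trans)) {q : ℕ},
      q < (r.2 i).1.card → natMap (permIso r.1.as.symm r.2).hom.val
        (blockOffset (fun a => (r.2 a).1.card) i + q) =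
        blockOffset (fun a => (r.2 (r.1.as.symm a)).1.card) (r.1.as i) + q := fun r q hq => by
    have := natMap_permIso r.1.as.symm r.2 (r.1.as i) (q := q) (by simpa using hq)
    rwa [Equiv.symm_apply_apply] at this
  have hlt := blockOffset_add_lt (fun a => (p.2 a).1.card) i hq
  have hlt' := blockOffset_add_lt (fun a => (p'.2 a).1.card) i (natMap_lt (f.2 i).val hq)
  rw [← card_bigTensor] at hlt hlt'
  have hinv : natMap (permIso p.1.as.symm p.2).inv.val
      (blockOffset (fun a => (p.2 (p.1.as.symm a)).1.card) (p.1.as i) + q) =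
        blockOffset (fun a => (p.2 a).1.card) i + q :=
    natMap_inv_of_hom ((CategoryOfElements.π _).mapIso (permIso p.1.as.symm p.2)) hlt (key p hq)
  have hlt₂ : blockOffset (fun a => (p.2 (p.1.as.symm a)).1.card) (p.1.as i) + q <
      ((bigTensor j).obj fun a => p.2 (p.1.as.symm a)).1.card := by
    rw [← key p hq]
    exact natMap_lt _ hlt
  change natMap ((permIso p.1.as.symm p.2).inv.val ≫ ((bigTensor j).map f.2).val ≫
    (permIso p'.1.as.symm p'.2).hom.val) _ = _
  rw [natMap_comp _ _ hlt₂, hinv, natMap_comp _ _ hlt, natMap_bigTensor f.2 i hq,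
    key p' (natMap_lt _ hq)]

/-! ### Iterated products in permutative categories -/

/-- Both lists of indices are strictly increasing with the same members, hence equal; then apply
`c`. -/
theorem ofFn_sum {α : Type*} {k : ℕ} (j : Fin k → ℕ) (c : Fin (∑ s, j s) → α) :
    List.ofFn c =
      (List.ofFn fun s => List.ofFn fun q => c (finSigmaFinEquiv ⟨s, q⟩)).flatten := by
  have key : List.finRange (∑ s, j s) =
      (List.ofFn fun s => List.ofFn fun q : Fin (j s) => finSigmaFinEquiv ⟨s, q⟩).flatten := by
    have h₁ : (List.finRange (∑ s, j s)).Pairwise (· < ·) := by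
      rw [← List.ofFn_id, List.pairwise_ofFn]
      exact fun _ _ h => h
    have h₂ : (List.ofFn fun s => List.ofFn fun q : Fin (j s) =>
        finSigmaFinEquiv ⟨s, q⟩).flatten.Pairwise (· < ·) := by
      rw [List.pairwise_flatten, List.pairwise_ofFn]
      constructor
      · intro l hl
        obtain ⟨s, rfl⟩ := List.mem_ofFn.1 hl
        rw [List.pairwise_ofFn]
        exact fun a b h => finSigmaFinEquiv_lt_iff.2 (Or.inr ⟨rfl, h⟩)
      · intro s s' h x hx y hy
        obtain ⟨a, rfl⟩ := List.mem_ofFn.1 hx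
        obtain ⟨b, rfl⟩ := List.mem_ofFn.1 hy
        exact finSigmaFinEquiv_lt_iff.2 (Or.inl h)
    refine List.Perm.eq_of_pairwise (fun _ _ _ _ h h' => (lt_asymm h h').elim) h₁ h₂ ?_
    rw [List.perm_ext_iff_of_nodup (h₁.imp ne_of_lt) (h₂.imp ne_of_lt)]
    intro x
    obtain ⟨⟨s, q⟩, rfl⟩ := finSigmaFinEquiv.surjective x
    simp only [List.mem_finRange, List.mem_flatten, List.mem_ofFn, true_iff]
    exact ⟨_, ⟨s, rfl⟩, List.mem_ofFn.2 ⟨q, rfl⟩⟩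
  have h := congrArg (List.map c) key
  rw [List.map_flatten, List.map_ofFn] at h
  rw [List.ofFn_eq_map, h]
  congr 2
  funext s
  exact List.map_ofFn

section Permutative

variable {C : Type u} [Category.{v} C] [MonoidalCategory C]

/-- The iterated product of a list of objects. -/
def tensorList (l : List C) : C := l.foldr (· ⊗ ·) (𝟙_ C)

/-- Lists forget the length as a type index, so regrouping a product becomes `List.flatten`. -/
theorem bigTensor_obj : ∀ {j : ℕ} (c : Fin j → C), (bigTensor j).obj c = tensorList (List.ofFn c)
  | 0, _ => rfl
  | j + 1, c => by
    rw [List.ofFn_succ]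
    exact congrArg (c 0 ⊗ ·) (bigTensor_obj fun i => c i.succ)

variable [SymmetricCategory C]

/-- The object `c_{σ⁻¹(1)} ⊕ ⋯ ⊕ c_{σ⁻¹(j)}`. -/
abbrev permTensor {j : ℕ} (σ : Perm (Fin j)) (c : Fin j → C) : C :=
  (barrattEcclesFunctor C j).obj (⟨σ⟩, c)

/-- The value of the Barratt–Eccles functor on the morphism from `(σ; c)` to `(σ'; c')` given by
`f : c ⟶ c'`. -/
abbrev permTensorMap {j : ℕ} (σ σ' : Perm (Fin j)) {c c' : Fin j → C} (f : c ⟶ c') :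
    permTensor σ c ⟶ permTensor σ' c' :=
  (barrattEcclesFunctor C j).map (X := (⟨σ⟩, c)) (Y := (⟨σ'⟩, c')) (⟨⟩, f)

variable [IsPermutative C]

theorem tensorList_append (l l' : List C) :
    tensorList (l ++ l') = tensorList l ⊗ tensorList l' := by
  induction l with
  | nil => exact (IsPermutative.unit_tensor _).symm
  | cons a l ih => exact (congrArg (a ⊗ ·) ih).trans (IsPermutative.tensor_assoc _ _ _).symm

theorem tensorList_flatten (L : List (List C)) :
    tensorList L.flatten = tensorList (L.map tensorList) := by
  induction L with
  | nil => rfl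
  | cons l L ih =>
    rw [List.flatten_cons, tensorList_append, ih]
    rfl

/-- Strict associativity and unitality make the regrouping an equality of objects; the inverse of
`permγ` is read off from `permγ_apply`. -/
theorem permTensor_permγ {k : ℕ} (j : Fin k → ℕ) (σ : Perm (Fin k))
    (τ : ∀ s, Perm (Fin (j s))) (c : Fin (∑ s, j s) → C) :
    permTensor (permγ j σ τ) c =
      permTensor σ fun s => permTensor (τ s) fun q => c (finSigmaFinEquiv ⟨s, q⟩) := by
  change (bigTensor _).obj (fun i => c ((permγ j σ τ).symm i)) = (bigTensor k).obj fun a =>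
    (bigTensor _).obj fun b => c (finSigmaFinEquiv ⟨σ.symm a, (τ (σ.symm a)).symm b⟩)
  have h : ∀ a b, (permγ j σ τ).symm (finCongr (Equiv.sum_comp σ.symm j)
      (finSigmaFinEquiv (n := fun a => j (σ.symm a)) ⟨a, b⟩)) =
      finSigmaFinEquiv ⟨σ.symm a, (τ (σ.symm a)).symm b⟩ := fun a b => by
    rw [Equiv.symm_apply_eq, permγ_apply, Equiv.apply_symm_apply]
  rw [bigTensor_obj, List.ofFn_congr (Equiv.sum_comp σ.symm j).symm, ofFn_sum, tensorList_flatten,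
    bigTensor_obj, List.map_ofFn]
  congr 2
  funext a
  rw [bigTensor_obj]
  exact congrArg (fun f => tensorList (List.ofFn f)) (funext fun b => congrArg c (h a b))

end Permutative

/-! ### Relations between the Barratt–Eccles functors of `𝕀 ⋉ X` -/

/-- The ends agree only propositionally, hence the formulation in `Arrow`; between fixed ends a
morphism is its effect on letters. -/
theorem trans_arrow_ext {a a' b b' : X.Trans} {f : a ⟶ b} {f' : a' ⟶ b'} (ha : a = a')
    (hb : b = b') (h : ∀ x < a.1.card, natMap f.val x = natMap f'.val x) :
    Arrow.mk f = Arrow.mk f' := by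
  subst ha hb
  exact congrArg Arrow.mk (CategoryOfElements.ext _ _ _ (hom_ext_natMap h))

theorem card_permTensor {j : ℕ} (σ : Perm (Fin j)) (c : Fin j → X.Trans) :
    (permTensor σ c).1.card = ∑ a, (c (σ.symm a)).1.card :=
  card_bigTensor _

theorem permTensorMap_arrow_ext {j : ℕ} {σ σ' : Perm (Fin j)} {c c' : Fin j → X.Trans}
    {f : c ⟶ c'} {a b : X.Trans} {g : a ⟶ b} (ha : permTensor σ c = a) (hb : permTensor σ' c' = b)
    (h : ∀ (i : Fin j), ∀ r < (c i).1.card,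
      blockOffset (fun a => (c' (σ'.symm a)).1.card) (σ' i) + natMap (f i).val r =
        natMap g.val (blockOffset (fun a => (c (σ.symm a)).1.card) (σ i) + r)) :
    Arrow.mk (permTensorMap σ σ' f) = Arrow.mk g := by
  refine trans_arrow_ext ha hb fun x hx => ?_
  obtain ⟨i', r, hr, rfl⟩ := exists_blockOffset (fun a => (c (σ.symm a)).1.card)
    (hx.trans_eq (card_permTensor _ _))
  obtain ⟨i, rfl⟩ := σ.surjective i'
  rw [Equiv.symm_apply_apply] at hr
  exact (natMap_barrattEcclesFunctor (p := (⟨σ⟩, c)) (p' := (⟨σ'⟩, c')) (⟨⟩, f) i hr).trans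
    (h i r hr)

theorem natMap_permTensorMap {j : ℕ} (σ σ' : Perm (Fin j)) {c c' : Fin j → X.Trans}
    (f : c ⟶ c') (i : Fin j) {q : ℕ} (hq : q < (c i).1.card) :
    natMap (permTensorMap σ σ' f).val
      (blockOffset (fun a => (c (σ.symm a)).1.card) (σ i) + q) =
      blockOffset (fun a => (c' (σ'.symm a)).1.card) (σ' i) + natMap (f i).val q :=
  natMap_barrattEcclesFunctor (p := (⟨σ⟩, c)) (p' := (⟨σ'⟩, c')) (⟨⟩, f) i hq

/-- A letter of block `(s, q)` is followed through the outer functor and then through the inner one;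
the two offsets add up by `blockOffset_permγ`. -/
theorem permTensorMap_permγ {k : ℕ} (j : Fin k → ℕ) (σ σ' : Perm (Fin k))
    (τ τ' : ∀ s, Perm (Fin (j s))) {c c' : Fin (∑ s, j s) → X.Trans} (f : c ⟶ c') :
    Arrow.mk (permTensorMap (permγ j σ τ) (permγ j σ' τ') f) =
      Arrow.mk (permTensorMap σ σ'
        (fun s => permTensorMap (τ s) (τ' s)
          (fun q => f (finSigmaFinEquiv ⟨s, q⟩) : (fun q => c (finSigmaFinEquiv ⟨s, q⟩)) ⟶
            fun q => c' (finSigmaFinEquiv ⟨s, q⟩)) :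
        (fun s => permTensor (τ s) fun q => c (finSigmaFinEquiv ⟨s, q⟩)) ⟶
          fun s => permTensor (τ' s) fun q => c' (finSigmaFinEquiv ⟨s, q⟩))) := by
  have hoff : ∀ (σ : Perm (Fin k)) (τ : ∀ s, Perm (Fin (j s))) (c : Fin (∑ s, j s) → X.Trans)
      (s : Fin k) (q : Fin (j s)),
      blockOffset (fun t => (c ((permγ j σ τ).symm t)).1.card)
        (permγ j σ τ (finSigmaFinEquiv ⟨s, q⟩)) =
      blockOffset (fun a => (permTensor (τ (σ.symm a)) fun q =>
          c (finSigmaFinEquiv ⟨σ.symm a, q⟩)).1.card) (σ s) +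
        blockOffset (fun r => (c (finSigmaFinEquiv ⟨s, (τ s).symm r⟩)).1.card) (τ s q) :=
    fun σ τ c s q => by
      simp_rw [card_permTensor]
      exact blockOffset_permγ j σ τ (fun t => (c t).1.card) s q
  refine permTensorMap_arrow_ext (permTensor_permγ j σ τ c) (permTensor_permγ j σ' τ' c')
    fun i r hr => ?_
  obtain ⟨⟨s, q⟩, rfl⟩ := finSigmaFinEquiv.surjective i
  have hlt : blockOffset (fun r => (c (finSigmaFinEquiv ⟨s, (τ s).symm r⟩)).1.card) (τ s q) + r <
      (permTensor (τ s) fun q => c (finSigmaFinEquiv ⟨s, q⟩)).1.card := by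
    rw [card_permTensor]
    exact blockOffset_add_lt (fun r => (c (finSigmaFinEquiv ⟨s, (τ s).symm r⟩)).1.card) (τ s q)
      (by rwa [Equiv.symm_apply_apply])
  rw [hoff, hoff, add_assoc, add_assoc]
  refine Eq.symm ((natMap_permTensorMap σ σ' _ s hlt).trans (congrArg _ ?_))
  exact natMap_permTensorMap (τ s) (τ' s) _ q hr

theorem permTensorMap_one (c c' : Fin 1 → X.Trans) (f : c ⟶ c') :
    Arrow.mk (permTensorMap 1 1 f) = Arrow.mk (f 0) := by
  refine permTensorMap_arrow_ext (IsPermutative.tensor_unit (c 0))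
    (IsPermutative.tensor_unit (c' 0)) fun i r hr => ?_
  obtain rfl : i = 0 := Subsingleton.elim _ _
  change blockOffset _ 0 + _ = natMap _ (blockOffset _ 0 + _)
  rw [blockOffset_zero, blockOffset_zero, zero_add, zero_add]

theorem permTensorMap_permAct {m n : ℕ} (e : Fin m ≃ Fin n) (σ σ' : Perm (Fin n))
    {c c' : Fin m → X.Trans} (f : c ⟶ c') :
    Arrow.mk (permTensorMap (permAct e σ) (permAct e σ') f) =
      Arrow.mk (permTensorMap σ σ' (fun i => f (e.symm i) :
        (fun i => c (e.symm i)) ⟶ fun i => c' (e.symm i))) := by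
  -- Once `m` and `n` are identified, the cast in `permAct` is trivial and `permAct` is plain
  -- composition.
  obtain rfl : m = n := by simpa using Fintype.card_congr e
  have hact : ∀ σ : Perm (Fin m), permAct e σ = e.trans σ := fun σ => Equiv.ext fun _ => rfl
  rw [hact, hact]
  refine permTensorMap_arrow_ext rfl rfl fun i r hr => ?_
  obtain ⟨i, rfl⟩ := e.symm.surjective i
  refine Eq.trans ?_ (Eq.trans (natMap_permTensorMap σ σ' (fun i => f (e.symm i) :
        (fun i => c (e.symm i)) ⟶ fun i => c' (e.symm i)) i hr).symm ?_)
  · simp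
  · simp

/-! ### Products of simplices of the nerve -/

/-- The product of `n`-simplices of the nerve, permuted according to an `n`-simplex of `Σ̃ⱼ`. -/
def permTensorSimplex {C : Type u} [Category.{v} C] [MonoidalCategory C] [SymmetricCategory C]
    [TopologicalSpace (Arrow C)] (k : ℕ) (n : SimplexCategory) (z₀ : (permNerve k).obj (op n))
    (z : Fin k → (topNerve C).obj (op n)) : (topNerve C).obj (op n) :=
  Functor.prod' z₀ (Functor.pi' z) ⋙ barrattEcclesFunctor C k

theorem levelNatural_permTensorSimplex {C : Type u} [Category.{v} C] [MonoidalCategory C]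
    [SymmetricCategory C] [TopologicalSpace (Arrow C)] (k : ℕ) :
    Realization.LevelNatural (permTensorSimplex (C := C) k) := fun _ _ _ => rfl

theorem permTensorSimplex_one (n : SimplexCategory)
    (z : Fin 1 → (topNerve X.Trans).obj (op n)) :
    permTensorSimplex 1 n (permSimplex fun _ => 1) z = z 0 :=
  composableArrows_ext_of_arrow fun _ _ h =>
    permTensorMap_one _ _ fun i => (z i).map (homOfLE h)

theorem permTensorSimplex_permAct {l m : ℕ} (e : Fin l ≃ Fin m) (n : SimplexCategory)
    (σ : Fin (n.len + 1) → Perm (Fin m)) (z : Fin l → (topNerve X.Trans).obj (op n)) :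
    permTensorSimplex l n (permSimplex fun a => permAct e (σ a)) z =
      permTensorSimplex m n (permSimplex σ) fun i => z (e.symm i) :=
  composableArrows_ext_of_arrow fun a b h =>
    permTensorMap_permAct e (σ a) (σ b) fun i => (z i).map (homOfLE h)

theorem permTensorSimplex_permγ {k : ℕ} (j : Fin k → ℕ) (n : SimplexCategory)
    (σ : Fin (n.len + 1) → Perm (Fin k)) (τ : ∀ s, Fin (n.len + 1) → Perm (Fin (j s)))
    (z : Fin (∑ s, j s) → (topNerve X.Trans).obj (op n)) :
    permTensorSimplex _ n (permSimplex fun a => permγ j (σ a) fun s => τ s a) z =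
      permTensorSimplex k n (permSimplex σ) fun s =>
        permTensorSimplex (j s) n (permSimplex (τ s)) fun q => z (finSigmaFinEquiv ⟨s, q⟩) :=
  composableArrows_ext_of_arrow fun a b h =>
    permTensorMap_permγ j (σ a) (σ b) (fun s => τ s a) (fun s => τ s b)
      fun i => (z i).map (homOfLE h)

theorem prodMap_permTensorSimplex {k : ℕ} {n : SimplexCategory} {c : BarrattEcclesSpace k}
    {y : Fin k → ClassifyingSpace X.Trans} {σ : Fin (n.len + 1) → Perm (Fin k)}
    {z : Fin k → (topNerve X.Trans).obj (op n)} {t : stdSimplex ℝ (Fin (n.len + 1))}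
    (hc : c = permPoint n σ t) (hy : ∀ i, y i = Realization.point n (z i) t) :
    Realization.prodMap (permTensorSimplex k) c y =
      Realization.point n (permTensorSimplex k n (permSimplex σ) z) t :=
  Realization.prodMap_eq (levelNatural_permTensorSimplex k) hc hy

theorem prodMap_permTensorSimplex_one (y : Fin 1 → ClassifyingSpace X.Trans) :
    Realization.prodMap (permTensorSimplex 1) barrattEccles.one y = y 0 := by
  obtain ⟨n, z, t, h⟩ := Realization.exists_common y
  have h₁ : barrattEccles.one = permPoint n (fun _ => 1) t := (permPoint_const n 1 t).symm
  rw [prodMap_permTensorSimplex h₁ h, permTensorSimplex_one, h 0]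

theorem exists_perm_common {ι κ : Type*} [Finite ι] [Finite κ] {j : ι → ℕ}
    (c : ∀ i, BarrattEcclesSpace (j i)) (y : κ → ClassifyingSpace X.Trans) :
    ∃ (n : SimplexCategory) (σ : ∀ i, Fin (n.len + 1) → Perm (Fin (j i)))
      (z : κ → (topNerve X.Trans).obj (op n)) (t : stdSimplex ℝ (Fin (n.len + 1))),
      (∀ i, c i = permPoint n (σ i) t) ∧ ∀ i, y i = Realization.point n (z i) t := by
  obtain ⟨m, σ, s, hc⟩ := exists_permPoint c
  obtain ⟨n, z, t, hy⟩ := Realization.exists_common y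
  obtain ⟨N, hN⟩ := exists_refinement₂ m n
  obtain ⟨q, f, g, rfl, rfl⟩ := hN s t
  exact ⟨N, fun i a => σ i (f a), fun i => (topNerve X.Trans).map g.op (z i), q,
    fun i => by rw [hc, permPoint_map], fun i => by rw [hy, Realization.point_map]⟩

theorem prodMap_permTensorSimplex_act {l m : ℕ} (e : Fin l ≃ Fin m) (c : BarrattEcclesSpace m)
    (y : Fin l → ClassifyingSpace X.Trans) :
    Realization.prodMap (permTensorSimplex l) (barrattEccles.act e c) y =
      Realization.prodMap (permTensorSimplex m) c fun i => y (e.symm i) := by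
  obtain ⟨n, σ, z, t, hc, hy⟩ := exists_perm_common (fun _ : Unit => c) y
  have h : barrattEccles.act e c = permPoint n (fun a => permAct e (σ () a)) t :=
    (congrArg _ (hc ())).trans (map_permNerveMap (permAct e) n (σ ()) t)
  rw [prodMap_permTensorSimplex h hy, prodMap_permTensorSimplex (hc ()) fun i => hy (e.symm i), permTensorSimplex_permAct]

theorem prodMap_permTensorSimplex_γ {k : ℕ} (j : Fin k → ℕ) (c : BarrattEcclesSpace k)
    (d : ∀ s, BarrattEcclesSpace (j s)) (y : Fin (∑ s, j s) → ClassifyingSpace X.Trans) :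
    Realization.prodMap (permTensorSimplex (∑ s, j s)) (barrattEccles.γ j c d) y =
      Realization.prodMap (permTensorSimplex k) c fun s =>
        Realization.prodMap (permTensorSimplex (j s)) (d s) fun q =>
          y (finSigmaFinEquiv ⟨s, q⟩) := by
  obtain ⟨n, σ, z, t, hc, hy⟩ := exists_perm_common
    (j := fun i : Option (Fin k) => i.elim k j) (fun i => match i with | none => c | some s => d s) y
  have hc₀ : c = permPoint n (σ none) t := hc none
  have hc₁ : ∀ s, d s = permPoint n (σ (some s)) t := fun s => hc (some s)
  have hγ : barrattEccles.γ j c d =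
      permPoint n (fun a => permγ j (σ none a) fun s => σ (some s) a) t := by
    rw [hc₀, funext hc₁]
    exact prodMap_permγSimplex j n _ _ t
  rw [prodMap_permTensorSimplex hγ hy, prodMap_permTensorSimplex hc₀ fun s =>
    prodMap_permTensorSimplex (hc₁ s) fun q => hy (finSigmaFinEquiv ⟨s, q⟩)]
  exact congrArg (Realization.point n · t) (permTensorSimplex_permγ j n _ _ z)

/-! ### Continuity of the action -/

theorem continuous_of_discrete_parameter {K S D : Type*} [TopologicalSpace K] [TopologicalSpace S]
    [DiscreteTopology S] [TopologicalSpace D] {s : K → S} (hs : Continuous s) (f : S → K → D)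
    (hf : ∀ p, Continuous (f p)) : Continuous fun x => f (s x) x := by
  refine continuous_iff_continuousAt.2 fun x => ((hf (s x)).continuousAt (x := x)).congr ?_
  have : ∀ᶠ y in 𝓝 x, s y = s x := hs.continuousAt (isOpen_discrete {s x} |>.mem_nhds rfl)
  filter_upwards [this] with y hy
  rw [hy]

/-- An object of `𝕀 ⋉ X` as a point of the space of objects `∐ₙ X(n)`. -/
def toSigma (a : X.Trans) : Σ n, X.functor.obj n := ⟨a.1, a.2⟩

section

variable {K : Type u} [TopologicalSpace K] [CompactSpace K] [T2Space K]

/-- The multiplication is continuous only for the compactly generated product topology, so it is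
composed with maps from compact pieces of `K` on which both underlying objects of `𝕀` are constant.
-/
theorem continuous_toSigma_tensor {a b : K → X.Trans} (ha : Continuous fun x => toSigma (a x))
    (hb : Continuous fun x => toSigma (b x)) : Continuous fun x => toSigma (a x ⊗ b x) := by
  refine continuous_of_sigma (ι := Bool) (A := fun _ n => X.functor.obj n)
    (fun i x => toSigma (cond i (a x) (b x))) (fun i => by cases i <;> assumption) _
    fun L _ _ _ e n a' _ ha' h => ?_
  have hμ := kContinuous_iff.1 (X.μ_continuous (n true) (n false)) L
    (fun l => (a' true l, a' false l)) ((ha' true).prodMk (ha' false))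
  refine (continuous_sigmaMk (σ := fun n => X.functor.obj n)
    (i := n true ⊗ n false) |>.comp hμ).congr fun l => ?_
  have h₁ : a (e l) = ⟨n true, a' true l⟩ := h true l
  have h₂ : b (e l) = ⟨n false, a' false l⟩ := h false l
  rw [h₁, h₂]
  rfl

theorem continuous_toSigma_bigTensor : ∀ {j : ℕ} {c : Fin j → K → X.Trans}
    (_ : ∀ i, Continuous fun x => toSigma (c i x)),
    Continuous fun x => toSigma ((bigTensor j).obj fun i => c i x)
  | 0, _, _ => continuous_of_const fun _ _ => rfl
  | _ + 1, _, hc =>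
    continuous_toSigma_tensor (hc 0) (continuous_toSigma_bigTensor fun i => hc i.succ)

end

/-- The underlying injection of the product depends only on the injections underlying the factors,
not on the points of `X`; hence it is locally constant in families. -/
theorem permTensorMap_val_congr {j : ℕ} (σ σ' : Perm (Fin j)) {c c' d d' : Fin j → X.Trans}
    {f : c ⟶ c'} {g : d ⟶ d'} (h : ∀ i, Arrow.mk (f i).val = Arrow.mk (g i).val) :
    Arrow.mk (permTensorMap σ σ' f).val = Arrow.mk (permTensorMap σ σ' g).val := by
  have hl : ∀ i, (c i).1.card = (d i).1.card := fun i =>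
    congrArg (fun α : Arrow FinInj => α.left.card) (h i)
  have hr : ∀ i, (c' i).1.card = (d' i).1.card := fun i =>
    congrArg (fun α : Arrow FinInj => α.right.card) (h i)
  have hm : ∀ i, natMap (f i).val = natMap (g i).val := fun i =>
    congrArg (fun α : Arrow FinInj => natMap α.hom) (h i)
  refine arrow_ext ?_ ?_ fun x hx => ?_
  · rw [card_permTensor, card_permTensor]
    simp_rw [hl]
  · rw [card_permTensor, card_permTensor]
    simp_rw [hr]
  · obtain ⟨i', r, hr', rfl⟩ := exists_blockOffset (fun a => (c (σ.symm a)).1.card)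
      (hx.trans_eq (card_permTensor _ _))
    obtain ⟨i, rfl⟩ := σ.surjective i'
    rw [Equiv.symm_apply_apply] at hr'
    have h₁ := natMap_permTensorMap σ σ' f i hr'
    have h₂ := natMap_permTensorMap σ σ' g i (hr'.trans_eq (hl i))
    simp_rw [hl, hr, hm] at h₁
    simp_rw [hl]
    exact h₁.trans h₂.symm

/-- Over a fixed arrow `α` of `𝕀`, the space of arrows of `𝕀 ⋉ X` is a copy of `X(α.left)`, so only
the source has to vary continuously. -/
theorem continuous_arrow_of_const {L : Type*} [TopologicalSpace L] {a b : L → X.Trans}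
    {f : ∀ l, a l ⟶ b l} (α : Arrow FinInj) (hα : ∀ l, Arrow.mk (f l).val = α)
    (ha : Continuous fun l => toSigma (a l)) : Continuous fun l => Arrow.mk (f l) := by
  refine continuous_induced_rng.2 ?_
  have h : ∀ l, ∃ y : X.functor.obj α.left, toSigma (a l) = ⟨α.left, y⟩ := fun l => by
    obtain rfl := hα l
    exact ⟨(a l).2, rfl⟩
  choose y hy using h
  have hy' : Continuous y := by
    rw [(Topology.IsEmbedding.sigmaMk (σ := fun n => X.functor.obj n)
      (i := α.left)).continuous_iff]
    exact ha.congr hy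
  refine (continuous_sigmaMk (σ := fun α : Arrow FinInj => X.functor.obj α.left)
    (i := α) |>.comp hy').congr fun l => ?_
  refine Sigma.ext (hα l).symm ?_
  exact ((Sigma.mk.inj (hy l)).2).symm

theorem continuous_permTensorSimplex_right {k : ℕ} (n : SimplexCategory)
    (z₀ : (permNerve k).obj (op n)) {K : Type u} [TopologicalSpace K] [CompactSpace K] [T2Space K]
    {z : Fin k → K → (topNerve X.Trans).obj (op n)} (hz : ∀ i, Continuous (z i)) :
    Continuous fun x => permTensorSimplex k n z₀ fun i => z i x := by
  refine continuous_iInf_rng.2 fun i => continuous_iInf_rng.2 fun j =>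
    continuous_iInf_rng.2 fun h => continuous_induced_rng.2 ?_
  have harrow : ∀ a, Continuous fun x => (⟨Arrow.mk ((z a x).map (homOfLE h)).val,
      ((z a x).obj i).2⟩ : Σ α : Arrow FinInj, X.functor.obj α.left) := fun a =>
    let _ := nerveTopology X.Trans n.len
    (continuous_arrow X.functor).comp ((continuous_nerve_arrow X.Trans h).comp (hz a))
  have hleft : ∀ a, Continuous fun x => toSigma ((z a x).obj i) := fun a =>
    (continuous_sigma fun α => continuous_sigmaMk (σ := fun n => X.functor.obj n) (i := α.left) :
      Continuous fun p : Σ α : Arrow FinInj, X.functor.obj α.left =>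
        (⟨p.1.left, p.2⟩ : Σ n, X.functor.obj n)).comp (harrow a)
  -- Cut `K` into pieces on which the arrow of `𝕀` underlying each factor is constant.
  refine continuous_of_sigma _ harrow _ fun L _ _ _ e α y he _ hα => ?_
  have hval : ∀ a l, Arrow.mk ((z a (e l)).map (homOfLE h)).val = α a := fun a l =>
    congrArg Sigma.fst (hα a l)
  -- A base point `l₀` is needed to name the constant arrow underlying the product.
  rcases isEmpty_or_nonempty L with hL | ⟨⟨l₀⟩⟩
  · exact continuous_of_const fun l => hL.elim l
  refine continuous_arrow_of_const
    (a := fun l => permTensor (z₀.obj i).as fun a => (z a (e l)).obj i)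
    (f := fun l => permTensorMap (z₀.obj i).as (z₀.obj j).as fun a => (z a (e l)).map (homOfLE h))
    (Arrow.mk (permTensorMap (z₀.obj i).as (z₀.obj j).as
      (fun a => (z a (e l₀)).map (homOfLE h))).val) (fun l => ?_) ?_
  · exact permTensorMap_val_congr _ _ fun a => (hval a l).trans (hval a l₀).symm
  · exact continuous_toSigma_bigTensor fun a => (hleft ((z₀.obj i).as.symm a)).comp he

theorem uCompactlyGeneratedSpace_topNerve_trans (n : SimplexCategory) :
    UCompactlyGeneratedSpace.{u} ((topNerve X.Trans).obj (op n)) :=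
  have := X.compactlyGenerated
  uCompactlyGeneratedSpace_nerve n

theorem kContinuous_prodMap_permTensorSimplex (k : ℕ) :
    KContinuous fun p : BarrattEcclesSpace k × (Fin k → ClassifyingSpace X.Trans) =>
      Realization.prodMap (permTensorSimplex k) p.1 p.2 := by
  have h := @Realization.continuous_prodMap.{0, u, u} k (permNerve k) (fun _ => topNerve X.Trans)
    (topNerve X.Trans) (uCompactlyGeneratedSpace_permNerve k)
    (fun _ => uCompactlyGeneratedSpace_topNerve_trans) (permTensorSimplex k)
    (levelNatural_permTensorSimplex k)
  have h' := h fun n K _ _ _ z₀ z hz₀ hz => continuous_of_discrete_parameter hz₀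
    (fun p x => permTensorSimplex k n p fun i => z i x)
    fun p => continuous_permTensorSimplex_right n p hz
  exact kContinuous_iff.2 fun K _ _ _ a ha => h' K (fun x => (a x).1) (fun i x => (a x).2 i)
    (continuous_fst.comp ha) fun i => (continuous_apply i).comp (continuous_snd.comp ha)

variable (X) in
/-- The action of the Barratt–Eccles operad on `B(𝕀 ⋉ X)`. -/
def barrattEcclesAction : OperadAction barrattEccles (ClassifyingSpace X.Trans) where
  compactlyGenerated :=
    have := uCompactlyGeneratedSpace_topNerve_trans (X := X)
    Realization.compactlyGeneratedSpace
  θ {k} := Realization.prodMap (permTensorSimplex k)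
  θ_continuous := kContinuous_prodMap_permTensorSimplex
  θ_one := prodMap_permTensorSimplex_one
  θ_act := prodMap_permTensorSimplex_act
  θ_γ := prodMap_permTensorSimplex_γ

theorem comesFromPermutative_barrattEcclesAction :
    (barrattEcclesAction X).ComesFromPermutative := fun k n σ s t =>
  Realization.prodMap_point (levelNatural_permTensorSimplex k) (.mk n) (permSimplex σ) s t

end IHocolim

end

/-! ### Assembly of the three statements -/

theorem theorem2p2 (X : IHocolim.CommIMonoid.{u}) :
    IHocolim.IsPermutative X.Trans ∧
    (∃ h : IHocolim.Hocolim X.functor ≃ₜ IHocolim.ClassifyingSpace X.Trans,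
      ∀ (n : ℕ) (s : ComposableArrows X.Trans n) (t : stdSimplex ℝ (Fin (n + 1))),
        h (IHocolim.Hocolim.mk X.functor (s ⋙ CategoryOfElements.π _) (s.obj 0).2 t) =
          IHocolim.ClassifyingSpace.mk s t) ∧
    ∃ O : IHocolim.OperadStructure IHocolim.BarrattEcclesSpace,
      IHocolim.IsBarrattEccles O ∧ O.IsEInfinity ∧
      ∃ A : IHocolim.OperadAction O (IHocolim.ClassifyingSpace X.Trans),
        A.ComesFromPermutative :=
  ⟨inferInstance,
    ⟨IHocolim.hocolimHomeomorph X.functor, fun _ s t => IHocolim.hocolimHomeomorph_mk s t⟩,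
    IHocolim.barrattEccles, IHocolim.isBarrattEccles_barrattEccles,
    IHocolim.isEInfinity_barrattEccles, IHocolim.barrattEcclesAction X,
    IHocolim.comesFromPermutative_barrattEcclesAction⟩
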